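/- Let $k$ be a field, $n\ge 0$ an integer, $\hat O=k[[x_1,\dots,x_n]]$, and let $\operatorname{supp}(f)$ denote the set of exponents of the terms of $f$. For $Q\subseteq\mathbb R^N$ and $u\in\mathbb R^N$ put $\mathrm{face}_u(Q)=\{x\in Q: u\cdot y\le u\cdot x\ \forall y\in Q\}$, and for a set $U$ of weights let $\mathrm{Norm}_Q(F)=\{u'\in U:\mathrm{face}_{u'}(Q)=F\}$. For a filtered ring with associated graded ring $\mathrm{gr}^u$, an ideal $I$ (left ideal in the noncommutative case) and a weight $u\in U$, the initial form $\mathrm{in}_u(f)$ is the sum of the terms of $f$ of maximal $u$-weight, $\mathrm{in}_u(I)\subseteq \mathrm{gr}^u$ is the (left) ideal generated by the $\mathrm{in}_u(f)$, $f\in I$, and the Gröbner cone is $C_I[u]=\{u'\in U:\mathrm{gr}^{u'}=\mathrm{gr}^{u},\ \mathrm{in}_{u'}(I)=\mathrm{in}_u(I)\}$; here classes in $\mathrm{gr}^u$ are represented by sums of terms, and $\mathrm{gr}^{u'}=\mathrm{gr}^u$ means equality of the underlying sets of representatives and of the products. For a monomial order $\prec$, $\exp_\prec(f)$ is the $\prec$-largest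 element of $\operatorname{supp}(f)$, $f\neq0$, and $\mathrm{Exp}_\prec(I)=\{\exp_\prec(f):0\ne f\in I\}$. A finite set $G\subset I\setminus\{0\}$ is a reduced $\prec$-standard basis of $I$ if $\mathrm{Exp}_\prec(I)$ is the set of all sums of some $\exp_\prec(g)$, $g\in G$, and an exponent; if $g,g'\in G$ and $\exp_\prec(g)-\exp_\prec(g')$ has no negative entry then $g=g'$; and each $g\in G$ has leading coefficient $1$ and no exponent in $\mathrm{Exp}_\prec(I)$ other than $\exp_\prec(g)$. The order $\prec_u$ compares first $u$-weights and then uses $\prec$. **(1) Power series.** Let $U=\{u\in\mathbb R^n:u_i\le0\ \forall i\}$, let $I\subseteq\hat O$ be an ideal and $u\in U$. If $I\ne0$ and $\prec$ is a local order (a total order on $\mathbb N^n$ compatible with addition such that $\alpha\preceq0$ for all $\alpha$), then $I$ has a unique reduced $\prec_u$-standard basis $G$, and $$C_I[u]=\mathrm{Norm}_Q(\mathrm{face}_u(Q)),\qquad Q=\sum_{g\in G}\mathrm{New}(g)\ \text{(Minkowski sum)},\quad \mathrm{New}(g)=\mathrm{conv}(\operatorname{supp}(g)+\mathbb N^n).$$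 For every ideal $I$ and every $u\in U$, $C_I[u]$ is a relatively open, convex, rational polyhedral cone. **(2) Differential operators.** Let $h_{(0,1)}(\hat D)$ be the $k$-algebra generated by $\hat O,\partial_1,\dots,\partial_n,h$ whose only nontrivial commutation relations are $\partial_i c-c\,\partial_i=\frac{\partial c}{\partial x_i}h$ for $c\in\hat O$. The exponents of its elements are the $(\alpha,\beta,m)\in\mathbb N^{2n+1}$ of the terms $x^\alpha\partial^\beta h^m$. Let $U=\{w=(u,v)\in\mathbb R^{2n}:u_i\le0,\ u_i+v_i\ge0\ \forall i\}$; the $w$-weight of $(\alpha,\beta,m)$ is $u\cdot\alpha+v\cdot\beta$. Let $I$ be a homogeneous left ideal, i.e. one generated by elements all of whose terms have the same degree $|\beta|+m$, and let $w\in U$. Let $\prec$ be an admissible order: a total order on $\mathbb N^{2n}$, compatible with addition, such that $x_i\prec1\prec x_i\xi_i$ for all $i$, where $x^\alpha\xi^\beta$ stands for $(\alpha,\beta)$. Let $\prec_w^h$ be the order on $\mathbb N^{2n+1}$ that compares first the degrees $|\beta|+m$ and then $(\alpha,\beta)$ by $\prec_w$. If $I\ne0$, then $I$ has a unique reduced $\prec_w^h$-standard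 basis $G$, and $$C_I[w]=\mathrm{Norm}_Q(\mathrm{face}_w(Q)),\quad Q=\sum_{g\in G}\mathrm{New}(g),\quad \mathrm{New}(g)=\mathrm{conv}\bigl(\pi(\operatorname{supp}(g))+\{z\in\mathbb Z^{2n}: w'\cdot z\le0\ \forall w'\in U\}\bigr),$$ where $\pi(\alpha,\beta,m)=(\alpha,\beta)$. For every homogeneous left ideal $I$ and every $w\in U$, $C_I[w]$ is a relatively open, convex, rational polyhedral cone. -/

import Mathlib

open scoped Pointwise

noncomputable section

namespace LocalGroebner

/-! ### Polyhedra, faces, normal cones -/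

section Polyhedra

variable {ι : Type*} [Fintype ι]

/-- The face of `Q ⊆ ℝ^ι` on which the linear form `u` is maximal. -/
def face (u : ι → ℝ) (Q : Set (ι → ℝ)) : Set (ι → ℝ) :=
  {x | x ∈ Q ∧ ∀ y ∈ Q, u ⬝ᵥ y ≤ u ⬝ᵥ x}

/-- The normal cone of `F` as a face of `Q`, in the weight space `W`: the weights `u' ∈ W` whose
face is exactly `F`. -/
def normalCone (W : Set (ι → ℝ)) (Q F : Set (ι → ℝ)) : Set (ι → ℝ) :=
  {u' | u' ∈ W ∧ face u' Q = F}

/-- `C` is a relatively open, convex, rational polyhedral cone: it is convex, equal to its relative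
interior, and its closure is defined by finitely many homogeneous linear inequalities with integer
coefficients. -/
structure IsRelOpenRationalCone (C : Set (ι → ℝ)) : Prop where
  convex : Convex ℝ C
  relOpen : intrinsicInterior ℝ C = C
  rational : ∃ B : Finset (ι → ℤ), closure C = {x | ∀ b ∈ B, ∑ i, (b i : ℝ) * x i ≤ 0}

end Polyhedra

/-! ### Monomial orders and reduced standard bases

`M` is the monoid of exponents, and `c f a` is the coefficient of `f` at the exponent `a`. -/

section StandardBases

/-- A monomial order, given by its strict part. -/
structure IsMonomialOrder {M : Type*} [AddCommMonoid M] (lt : M → M → Prop) : Prop where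
  strictTotal : IsStrictTotalOrder M lt
  add_left : ∀ d a b, lt a b → lt (d + a) (d + b)

/-- The order comparing first by the weight `φ`, and then by `lt`. -/
def refine {M : Type*} (φ : M → ℝ) (lt : M → M → Prop) (a b : M) : Prop :=
  φ a < φ b ∨ (φ a = φ b ∧ lt a b)

variable {R M k : Type*} [AddCommMonoid M] [Field k]

/-- `e` is the leading exponent of `f`: the maximum of its support. -/
def IsLeadingExp (c : R → M → k) (lt : M → M → Prop) (f : R) (e : M) : Prop :=
  c f e ≠ 0 ∧ ∀ a, c f a ≠ 0 → a ≠ e → lt a e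

/-- The set `Exp(J)` of the leading exponents of the nonzero elements of `J`. -/
def leadingExps (c : R → M → k) (lt : M → M → Prop) (J : Set R) : Set M :=
  {e | ∃ f ∈ J, IsLeadingExp c lt f e}

/-- `G` is a reduced standard basis of `J`. -/
structure IsReducedStandardBasis (c : R → M → k) (lt : M → M → Prop) (J : Set R)
    (G : Finset R) : Prop where
  subset : ∀ g ∈ G, g ∈ J
  standard : leadingExps c lt J = {a | ∃ g ∈ G, ∃ e, IsLeadingExp c lt g e ∧ ∃ d, a = e + d}
  minimal : ∀ g ∈ G, ∀ g' ∈ G, ∀ e e', IsLeadingExp c lt g e → IsLeadingExp c lt g' e' →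
    (∃ d, e = e' + d) → g = g'
  unitary_reduced : ∀ g ∈ G, ∃ e, IsLeadingExp c lt g e ∧ c g e = 1 ∧
    ∀ a, c g a ≠ 0 → a ≠ e → a ∉ leadingExps c lt J

end StandardBases

/-! ### The ring of formal power series `k[[x₁, …, xₙ]]` -/

namespace Comm

variable {n : ℕ} {k : Type*} [Field k]

/-- The local weight vectors `u`, with `uᵢ ≤ 0` for all `i`. -/
def Uloc (n : ℕ) : Set (Fin n → ℝ) := {u | ∀ i, u i ≤ 0}

/-- An exponent, as a point of `ℝⁿ`. -/
def pt (a : Fin n →₀ ℕ) : Fin n → ℝ := fun i => (a i : ℝ)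

/-- The weight `u · a` of an exponent `a`. -/
def wt (u : Fin n → ℝ) (a : Fin n →₀ ℕ) : ℝ := u ⬝ᵥ pt a

/-- The coefficient of `xᵃ` in `f`. -/
def coef (f : MvPowerSeries (Fin n) k) (a : Fin n →₀ ℕ) : k := MvPowerSeries.coeff a f

/-- A local order: a monomial order with `a ≼ 0` for all `a`. -/
structure IsLocalOrder (lt : (Fin n →₀ ℕ) → (Fin n →₀ ℕ) → Prop) : Prop
    extends IsMonomialOrder lt where
  lt_zero : ∀ a, a ≠ 0 → lt a 0

/-- The sum of the terms of `f` with exponents satisfying `p`. -/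
def terms (p : (Fin n →₀ ℕ) → Prop) (f : MvPowerSeries (Fin n) k) : MvPowerSeries (Fin n) k :=
  open Classical in fun a => if p a then coef f a else 0

/-- The initial form `in_u(f)`: the sum of the terms of `f` of maximal weight. -/
def initialForm (u : Fin n → ℝ) (f : MvPowerSeries (Fin n) k) : MvPowerSeries (Fin n) k :=
  terms (fun a => ∀ b, coef f b ≠ 0 → wt u b ≤ wt u a) f

/-- `f` is `u`-homogeneous: all its terms have the same weight. -/
def IsHomogeneous (u : Fin n → ℝ) (f : MvPowerSeries (Fin n) k) : Prop :=
  ∃ d, ∀ a, coef f a ≠ 0 → wt u a = d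

/-- The graded ring `gr^u = ⨁_d F_d / F_{<d}` of the filtration of `k[[x]]` by the `u`-order, as a
subring of `k[[x]]`: each class in `F_d / F_{<d}` is represented by the unique element of it whose
terms have weight `d`. -/
def gr (k : Type*) [Field k] (u : Fin n → ℝ) : Subalgebra k (MvPowerSeries (Fin n) k) :=
  Algebra.adjoin k {f | IsHomogeneous u f}

/-- The initial ideal `in_u(I)`, the ideal of `gr^u` generated by the initial forms of the elements
of `I`. -/
def initialIdeal (u : Fin n → ℝ) (I : Ideal (MvPowerSeries (Fin n) k)) : Ideal (gr k u) :=
  Ideal.span {F | ∃ f ∈ I, (F : MvPowerSeries (Fin n) k) = initialForm u f}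

/-- The Gröbner cone `C_I[u]`: the local weights `u'` with `gr^{u'} = gr^u` and
`in_{u'}(I) = in_u(I)`. -/
def groebnerCone (I : Ideal (MvPowerSeries (Fin n) k)) (u : Fin n → ℝ) : Set (Fin n → ℝ) :=
  {u' | u' ∈ Uloc n ∧ gr k u = gr k u' ∧
    (Subtype.val '' (initialIdeal u I : Set (gr k u)) : Set (MvPowerSeries (Fin n) k)) =
      Subtype.val '' (initialIdeal u' I : Set (gr k u'))}

/-- The Newton polyhedron `conv(supp(g) + ℕⁿ)`. -/
def newton (g : MvPowerSeries (Fin n) k) : Set (Fin n → ℝ) :=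
  convexHull ℝ {x | ∃ a b : Fin n →₀ ℕ, coef g a ≠ 0 ∧ x = pt a + pt b}

end Comm

/-! ### The homogenized ring of differential operators

An element `∑ c_{β,m}(x) ∂^β h^m` is stored as the finitely supported family of its coefficients
`c_{β,m} ∈ k[[x]]`. -/

section Operators

variable {n : ℕ} {k : Type*} [Field k]

/-- The free `k[[x]]`-module on the monomials `∂^β h^m`. -/
abbrev Sym (n : ℕ) (k : Type*) [Field k] : Type _ :=
  ((Fin n →₀ ℕ) × ℕ) →₀ MvPowerSeries (Fin n) k

/-- Left multiplication by the power series `c`. -/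
def serOp (c : MvPowerSeries (Fin n) k) : Module.End k (Sym n k) :=
  Module.toModuleEnd k (S := MvPowerSeries (Fin n) k) (Sym n k) c

/-- Left multiplication by `h`. -/
def hOp : Module.End k (Sym n k) :=
  Finsupp.lmapDomain _ k fun m => m + (0, 1)

/-- Left multiplication by `∂ᵢ`, that is
`∂ᵢ · c ∂^β h^m = c ∂^{β + eᵢ} h^m + (∂c/∂xᵢ) ∂^β h^{m+1}`. -/
def dOp (i : Fin n) : Module.End k (Sym n k) :=
  Finsupp.lmapDomain _ k (fun m => m + (Finsupp.single i 1, 0)) +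
    hOp ∘ₗ Finsupp.mapRange.linearMap (MvPowerSeries.pderiv k i).toLinearMap

lemma serOp_single (c a : MvPowerSeries (Fin n) k) (m) :
    serOp c (Finsupp.single m a) = Finsupp.single m (c * a) := by
  simp [serOp]

lemma hOp_single (a : MvPowerSeries (Fin n) k) (m) :
    hOp (Finsupp.single m a) = Finsupp.single (m + (0, 1)) a := by
  simp [hOp]

lemma dOp_single (i : Fin n) (a : MvPowerSeries (Fin n) k) (m) :
    dOp i (Finsupp.single m a) = Finsupp.single (m + (Finsupp.single i 1, 0)) a +
      Finsupp.single (m + (0, 1)) (MvPowerSeries.pderiv k i a) := by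
  simp [dOp, hOp_single]

lemma pderiv_comm (i j : Fin n) (f : MvPowerSeries (Fin n) k) :
    MvPowerSeries.pderiv k i (MvPowerSeries.pderiv k j f) =
      MvPowerSeries.pderiv k j (MvPowerSeries.pderiv k i f) := by
  ext a
  simp only [MvPowerSeries.coeff_pderiv, Finsupp.add_apply]
  by_cases h : i = j
  · subst h; rfl
  · rw [add_right_comm, Finsupp.single_eq_of_ne (by tauto), Finsupp.single_eq_of_ne (by tauto)]
    push_cast
    ring

lemma hOp_commute_serOp (c : MvPowerSeries (Fin n) k) : Commute hOp (serOp c) := by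
  refine Finsupp.lhom_ext fun m a => ?_
  simp only [Module.End.mul_apply, serOp_single, hOp_single]

lemma hOp_commute_dOp (i : Fin n) : Commute (hOp : Module.End k (Sym n k)) (dOp i) := by
  refine Finsupp.lhom_ext fun m a => ?_
  simp [dOp_single, hOp_single, add_right_comm]

lemma dOp_commute (i j : Fin n) : Commute (dOp i : Module.End k (Sym n k)) (dOp j) := by
  refine Finsupp.lhom_ext fun m a => ?_
  simp only [Module.End.mul_apply, dOp_single, map_add, pderiv_comm i j]
  rw [add_right_comm m (Finsupp.single j 1, 0) (Finsupp.single i 1, 0),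
    add_right_comm m (0, 1) (Finsupp.single i 1, 0),
    add_right_comm m (0, 1) (Finsupp.single j 1, 0)]
  exact add_add_add_comm (G := Sym n k) _ _ _ _

lemma dOp_mul_serOp (i : Fin n) (c : MvPowerSeries (Fin n) k) :
    dOp i * serOp c = serOp c * dOp i + serOp (MvPowerSeries.pderiv k i c) * hOp := by
  refine Finsupp.lhom_ext fun m a => ?_
  simp only [Module.End.mul_apply, LinearMap.add_apply, dOp_single, serOp_single, hOp_single,
    map_add, Derivation.leibniz, smul_eq_mul, Finsupp.single_add, add_assoc]
  rw [mul_comm a]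

/-- Left multiplication by the monomial `∂^β h^m`. -/
def monOp (m : (Fin n →₀ ℕ) × ℕ) : Module.End k (Sym n k) :=
  hOp ^ m.2 * Finset.univ.noncommProd (fun i => dOp i ^ m.1 i)
    fun i _ j _ _ => (dOp_commute i j).pow_pow _ _

lemma hOp_commute_prod (b : Fin n →₀ ℕ) (r : ℕ) :
    Commute ((hOp : Module.End k (Sym n k)) ^ r)
      (Finset.univ.noncommProd (fun i => dOp i ^ b i)
        fun i _ j _ _ => (dOp_commute i j).pow_pow _ _) :=
  Finset.noncommProd_commute _ _ _ _ fun i _ => (hOp_commute_dOp i).pow_pow _ _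

lemma monOp_add (m m' : (Fin n →₀ ℕ) × ℕ) :
    (monOp (m + m') : Module.End k (Sym n k)) = monOp m * monOp m' := by
  have h := Finset.noncommProd_mul_distrib (s := (Finset.univ : Finset (Fin n)))
    (fun i => (dOp i : Module.End k (Sym n k)) ^ m.1 i) (fun i => dOp i ^ m'.1 i)
    (fun i _ j _ _ => (dOp_commute i j).pow_pow _ _)
    (fun i _ j _ _ => (dOp_commute i j).pow_pow _ _)
    (fun i _ j _ _ => (dOp_commute i j).pow_pow _ _)
  simp only [monOp, Prod.fst_add, Prod.snd_add, Finsupp.add_apply, pow_add]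
  refine (congrArg _ h).trans ?_
  rw [mul_assoc, mul_assoc, ← mul_assoc (hOp ^ m'.2), (hOp_commute_prod m.1 m'.2).eq]
  simp only [mul_assoc]

lemma monOp_h : (monOp (0, 1) : Module.End k (Sym n k)) = hOp := by
  simp only [monOp, Finsupp.coe_zero, Pi.zero_apply, pow_zero, pow_one]
  rw [Finset.noncommProd_eq_pow_card _ _ _ 1 (fun _ _ => rfl)]
  simp

lemma monOp_d (i : Fin n) :
    (monOp (Finsupp.single i 1, 0) : Module.End k (Sym n k)) = dOp i := by
  have key : ∀ (s : Finset (Fin n)) (hs : s = insert i (Finset.univ.erase i)) (f : Fin n →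
      Module.End k (Sym n k)) (comm : (s : Set (Fin n)).Pairwise (Function.onFun Commute f)),
      (∀ j, j ≠ i → f j = 1) → s.noncommProd f comm = f i := by
    intro s hs f comm hf
    subst hs
    rw [Finset.noncommProd_insert_of_notMem _ _ _ _ (Finset.notMem_erase _ _),
      Finset.noncommProd_eq_pow_card (Finset.univ.erase i) _ _ 1, one_pow, mul_one]
    intro j hj
    exact hf j (Finset.ne_of_mem_erase hj)
  have h := key _ (Finset.insert_erase (Finset.mem_univ i)).symm
    (fun j => dOp j ^ (Finsupp.single i 1 : Fin n →₀ ℕ) j)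
    (fun i _ j _ _ => (dOp_commute i j).pow_pow _ _)
    fun j hj => by rw [Finsupp.single_eq_of_ne hj, pow_zero]
  refine (congrArg (hOp ^ 0 * ·) h).trans ?_
  simp

lemma monOp_zero : (monOp 0 : Module.End k (Sym n k)) = 1 := by
  simp only [monOp, Prod.fst_zero, Prod.snd_zero, Finsupp.coe_zero, Pi.zero_apply, pow_zero]
  rw [Finset.noncommProd_eq_pow_card _ _ _ 1 (fun _ _ => rfl)]
  simp

/-- Left multiplication by `∑ c_{β,m} ∂^β h^m`. -/
def leftMul : Sym n k →ₗ[k] Module.End k (Sym n k) :=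
  Finsupp.lsum k fun m =>
    (LinearMap.mulRight k (monOp m : Module.End k (Sym n k))).comp
      (Algebra.lsmul k k (Sym n k) : MvPowerSeries (Fin n) k →ₐ[k] _).toLinearMap

lemma leftMul_single (m : (Fin n →₀ ℕ) × ℕ) (c : MvPowerSeries (Fin n) k) :
    leftMul (Finsupp.single m c) = serOp c * monOp m := by
  simp only [leftMul, Finsupp.lsum_single]
  rfl

lemma leftMul_induction {S : Module.End k (Sym n k) → Prop}
    (hadd : ∀ A B, S A → S B → S (A + B)) (hmul : ∀ A B, S A → S B → S (A * B))
    (h1 : S 1) (h0 : S 0) (hs : ∀ c, S (serOp c)) (hh : S hOp) (hd : ∀ i, S (dOp i))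
    (P : Sym n k) : S (leftMul P) := by
  have hpow : ∀ A, S A → ∀ r : ℕ, S (A ^ r) := by
    intro A hA r
    induction r with
    | zero => simpa using h1
    | succ r ih => rw [pow_succ]; exact hmul _ _ ih hA
  induction P using Finsupp.induction_linear with
  | zero => simpa using h0
  | add P Q hP hQ => rw [map_add]; exact hadd _ _ hP hQ
  | single m c =>
    rw [leftMul_single, monOp]
    exact hmul _ _ (hs c) (hmul _ _ (hpow _ hh _)
      (Finset.noncommProd_induction _ _ _ S hmul h1 fun i _ => hpow _ (hd i) _))

lemma leftMul_leftMul (P Q : Sym n k) : leftMul (leftMul P Q) = leftMul P * leftMul Q := by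
  revert Q
  refine leftMul_induction (S := fun A => ∀ Q, leftMul (A Q) = A * leftMul Q)
    ?_ ?_ ?_ ?_ ?_ ?_ ?_ P
  · intro A B hA hB Q
    rw [LinearMap.add_apply, map_add, hA, hB, add_mul]
  · intro A B hA hB Q
    rw [Module.End.mul_apply, hA, hB, mul_assoc]
  · intro Q; simp
  · intro Q; simp
  · intro c Q
    induction Q using Finsupp.induction_linear with
    | zero => simp
    | add P Q hP hQ => simp only [map_add, hP, hQ, mul_add]
    | single m a =>
      rw [serOp_single, leftMul_single, leftMul_single, ← mul_assoc]
      congr 1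
      exact map_mul (Module.toModuleEnd k (S := MvPowerSeries (Fin n) k) (Sym n k)) c a
  · intro Q
    induction Q using Finsupp.induction_linear with
    | zero => simp
    | add P Q hP hQ => simp only [map_add, hP, hQ, mul_add]
    | single m a =>
      rw [hOp_single, leftMul_single, leftMul_single, ← mul_assoc, (hOp_commute_serOp a).eq,
        add_comm, monOp_add, monOp_h, mul_assoc]
  · intro i Q
    induction Q using Finsupp.induction_linear with
    | zero => simp
    | add P Q hP hQ => simp only [map_add, hP, hQ, mul_add]
    | single m a =>
      rw [dOp_single, map_add, leftMul_single, leftMul_single, leftMul_single, ← mul_assoc,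
        dOp_mul_serOp, add_comm m, add_comm m, monOp_add, monOp_add, monOp_h, monOp_d, add_mul,
        mul_assoc, mul_assoc]

lemma monOp_single (m m' : (Fin n →₀ ℕ) × ℕ) :
    monOp m (Finsupp.single m' (1 : MvPowerSeries (Fin n) k)) = Finsupp.single (m + m') 1 := by
  have hsplit : ∀ m₁ m₂ : (Fin n →₀ ℕ) × ℕ,
      (∀ m', monOp m₁ (Finsupp.single m' (1 : MvPowerSeries (Fin n) k)) =
        Finsupp.single (m₁ + m') 1) →
      (∀ m', monOp m₂ (Finsupp.single m' (1 : MvPowerSeries (Fin n) k)) =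
        Finsupp.single (m₂ + m') 1) →
      ∀ m', monOp (m₁ + m₂) (Finsupp.single m' (1 : MvPowerSeries (Fin n) k)) =
        Finsupp.single (m₁ + m₂ + m') 1 := by
    intro m₁ m₂ h₁ h₂ m'
    rw [monOp_add, Module.End.mul_apply, h₂, h₁, add_assoc]
  have hz : ∀ m', monOp 0 (Finsupp.single m' (1 : MvPowerSeries (Fin n) k)) =
      Finsupp.single (0 + m') 1 := by
    intro m'; simp [monOp_zero]
  have hb : ∀ b : Fin n →₀ ℕ, ∀ m', monOp (b, 0) (Finsupp.single m'
      (1 : MvPowerSeries (Fin n) k)) = Finsupp.single ((b, 0) + m') 1 := by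
    intro b
    induction b using Finsupp.induction_linear with
    | zero => exact hz
    | add f g hf hg => simpa using hsplit _ _ hf hg
    | single i r =>
      induction r with
      | zero => rw [Finsupp.single_zero]; exact hz
      | succ r ih =>
        have h := hsplit _ (Finsupp.single i 1, 0) ih fun m' => by
          rw [monOp_d, dOp_single, Derivation.map_one_eq_zero, Finsupp.single_zero, add_zero, add_comm]
        simpa [Finsupp.single_add] using h
  have hr : ∀ r : ℕ, ∀ m', monOp ((0 : Fin n →₀ ℕ), r) (Finsupp.single m'
      (1 : MvPowerSeries (Fin n) k)) = Finsupp.single ((0, r) + m') 1 := by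
    intro r
    induction r with
    | zero => exact hz
    | succ r ih =>
      have h := hsplit _ (0, 1) ih fun m' => by
        rw [monOp_h, hOp_single, add_comm]
      simpa using h
  have h := hsplit _ _ (hb m.1) (hr m.2) m'
  simpa using h

lemma leftMul_one : leftMul (Finsupp.single 0 (1 : MvPowerSeries (Fin n) k)) = 1 := by
  rw [leftMul_single, monOp_zero, mul_one]
  exact map_one (Module.toModuleEnd k (S := MvPowerSeries (Fin n) k) (Sym n k))

lemma leftMul_apply_one (P : Sym n k) : leftMul P (Finsupp.single 0 1) = P := by
  induction P using Finsupp.induction_linear with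
  | zero => simp
  | add P Q hP hQ => rw [map_add, LinearMap.add_apply, hP, hQ]
  | single m a =>
    rw [leftMul_single, Module.End.mul_apply, monOp_single, serOp_single, add_zero, mul_one]

end Operators

/-- The ring `h₍₀,₁₎(D̂)`: the `k`-algebra generated by `k[[x₁, …, xₙ]]`, `∂₁, …, ∂ₙ` and `h`, whose
only nontrivial commutation relations are `∂ᵢ c(x) - c(x) ∂ᵢ = (∂c/∂xᵢ) h`. Its elements are
written uniquely as finite sums of terms `c_{β,m}(x) ∂^β h^m`. -/
def HD (n : ℕ) (k : Type*) [Field k] : Type _ := Sym n k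

namespace HD

variable {n : ℕ} {k : Type*} [Field k]

instance : AddCommGroup (HD n k) := inferInstanceAs (AddCommGroup (Sym n k))

instance : Module k (HD n k) := inferInstanceAs (Module k (Sym n k))

instance : Ring (HD n k) where
  __ := (inferInstance : AddCommGroup (HD n k))
  mul P Q := leftMul P Q
  one := (Finsupp.single 0 1 : Sym n k)
  mul_assoc P Q R := congrArg (fun A : Module.End k (Sym n k) => A R) (leftMul_leftMul P Q)
  one_mul P := congrArg (fun A : Module.End k (Sym n k) => A P) leftMul_one
  mul_one P := leftMul_apply_one P
  zero_mul P := congrArg (fun A : Module.End k (Sym n k) => A P) (map_zero leftMul)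
  mul_zero P := map_zero (leftMul P)
  left_distrib P Q R := map_add (leftMul P) Q R
  right_distrib P Q R := congrArg (fun A : Module.End k (Sym n k) => A R) (map_add leftMul P Q)

/-- The family of coefficients `c_{β,m}` of an element `∑ c_{β,m} ∂^β h^m`. -/
def family (n : ℕ) (k : Type*) [Field k] : HD n k ≃ₗ[k] Sym n k := LinearEquiv.refl k (Sym n k)

lemma family_mul (P Q : HD n k) : family n k (P * Q) = leftMul (family n k P) (family n k Q) := rfl

lemma family_one : family n k 1 = Finsupp.single 0 1 := rfl

/-- A power series, as an element of the ring. -/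
def ser (c : MvPowerSeries (Fin n) k) : HD n k := (family n k).symm (Finsupp.single 0 c)

/-- The variable `h`. -/
def h : HD n k := (family n k).symm (Finsupp.single (0, 1) 1)

/-- The derivation `∂ᵢ`. -/
def d (i : Fin n) : HD n k := (family n k).symm (Finsupp.single (Finsupp.single i 1, 0) 1)

/-- The defining relation `∂ᵢ c - c ∂ᵢ = (∂c/∂xᵢ) h`. -/
lemma d_mul_ser (i : Fin n) (c : MvPowerSeries (Fin n) k) :
    (d i * ser c : HD n k) - ser c * d i = ser (MvPowerSeries.pderiv k i c) * h := by
  apply (family n k).injective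
  simp only [map_sub, family_mul, d, ser, h, LinearEquiv.apply_symm_apply, leftMul_single,
    monOp_d, monOp_zero, mul_one, Module.End.mul_apply, dOp_single, serOp_single, map_add,
    one_mul, zero_add, add_sub_cancel_left]

/-- The product of two monomials `∂^β h^m`. -/
lemma monomial_mul (m m' : (Fin n →₀ ℕ) × ℕ) :
    ((family n k).symm (Finsupp.single m 1) * (family n k).symm (Finsupp.single m' 1) : HD n k) =
      (family n k).symm (Finsupp.single (m + m') 1) := by
  apply (family n k).injective
  simp only [family_mul, LinearEquiv.apply_symm_apply, leftMul_single, Module.End.mul_apply,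
    monOp_single, serOp_single, mul_one]

/-- The product of a power series and a monomial `∂^β h^m`. -/
lemma ser_mul_monomial (c : MvPowerSeries (Fin n) k) (m : (Fin n →₀ ℕ) × ℕ) :
    (ser c * (family n k).symm (Finsupp.single m 1) : HD n k) = (family n k).symm (Finsupp.single m c) := by
  apply (family n k).injective
  simp only [family_mul, ser, LinearEquiv.apply_symm_apply, leftMul_single, Module.End.mul_apply,
    monOp_single, serOp_single, mul_one, zero_add]

/-- The exponents `(α, β, m)` of the terms `x^α ∂^β h^m`. -/
abbrev Exps (n : ℕ) : Type := ((Fin n →₀ ℕ) × (Fin n →₀ ℕ)) × ℕ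

/-- The coefficient of `x^α ∂^β h^m` in `P`. -/
def coef (P : HD n k) (a : Exps n) : k :=
  MvPowerSeries.coeff a.1.1 (family n k P (a.1.2, a.2))

/-- The sum of the terms of `P` with exponents satisfying `p`. -/
def terms (p : Exps n → Prop) (P : HD n k) : HD n k :=
  (family n k).symm <| Finsupp.onFinset (family n k P).support
    (open Classical in fun m => fun a => if p ((a, m.1), m.2) then coef P ((a, m.1), m.2) else 0)
    (by
      intro m hm
      rw [Finsupp.mem_support_iff]
      intro h0
      apply hm
      funext a
      have : coef P ((a, m.1), m.2) = 0 := by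
        simp only [coef]
        rw [h0]; simp
      simp only [this, ite_self]
      rfl)

open Classical in
lemma coef_terms (p : Exps n → Prop) (P : HD n k) (a : Exps n) :
    coef (terms p P) a = if p a then coef P a else 0 := by
  simp only [terms]
  rw [coef, LinearEquiv.apply_symm_apply]
  rfl

/-- The local weight vectors `w = (u, v)`, with `uᵢ ≤ 0` and `uᵢ + vᵢ ≥ 0` for all `i`; here
`u = w ∘ inl` and `v = w ∘ inr`. -/
def Wloc (n : ℕ) : Set (Fin n ⊕ Fin n → ℝ) :=
  {w | ∀ i, w (Sum.inl i) ≤ 0 ∧ 0 ≤ w (Sum.inl i) + w (Sum.inr i)}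

/-- The exponent `(α, β)`, as a point of `ℝ²ⁿ`. -/
def pt (b : (Fin n →₀ ℕ) × (Fin n →₀ ℕ)) : Fin n ⊕ Fin n → ℝ :=
  Sum.elim (fun i => (b.1 i : ℝ)) fun i => (b.2 i : ℝ)

/-- The weight `w · (α, β)`. -/
def wt (w : Fin n ⊕ Fin n → ℝ) (b : (Fin n →₀ ℕ) × (Fin n →₀ ℕ)) : ℝ := w ⬝ᵥ pt b

/-- An admissible order on the exponents `(α, β)`: a monomial order with `xᵢ ≺ 1 ≺ xᵢ ξᵢ`. -/
structure IsAdmissibleOrder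
    (lt : (Fin n →₀ ℕ) × (Fin n →₀ ℕ) → (Fin n →₀ ℕ) × (Fin n →₀ ℕ) → Prop) : Prop
    extends IsMonomialOrder lt where
  x_lt_one : ∀ i, lt (Finsupp.single i 1, 0) 0
  one_lt_x_xi : ∀ i, lt 0 (Finsupp.single i 1, Finsupp.single i 1)

/-- The degree `|β| + m` of the term `x^α ∂^β h^m`. -/
def degree (a : Exps n) : ℕ := a.1.2.degree + a.2

/-- The order `≺ʰ`: first by the degree `|β| + m`, and then by `≺` on `(α, β)`. -/
def ltH (lt : (Fin n →₀ ℕ) × (Fin n →₀ ℕ) → (Fin n →₀ ℕ) × (Fin n →₀ ℕ) → Prop)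
    (a b : Exps n) : Prop :=
  degree a < degree b ∨ (degree a = degree b ∧ lt a.1 b.1)

/-- `I` is a homogeneous left ideal: it is generated by elements all of whose terms have the same
degree. -/
def IsHomogeneousIdeal (I : Ideal (HD n k)) : Prop :=
  ∃ S : Set (HD n k), (∀ P ∈ S, ∃ e, ∀ a, coef P a ≠ 0 → degree a = e) ∧ I = Ideal.span S

/-- The initial form `in_w(P)`: the sum of the terms of `P` of maximal weight (the weight of `h`
being `0`), as a representative of the class of `P` in the graded ring. -/
def initialForm (w : Fin n ⊕ Fin n → ℝ) (P : HD n k) : HD n k :=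
  terms (fun a => ∀ b, coef P b ≠ 0 → wt w b.1 ≤ wt w a.1) P

/-- The sum of the terms of `P` of weight `e`. -/
def component (w : Fin n ⊕ Fin n → ℝ) (e : ℝ) (P : HD n k) : HD n k :=
  terms (fun a => wt w a.1 = e) P

/-- The underlying space of the graded ring `gr^w = ⨁_e F_e / F_{<e}` of the filtration by the
`w`-order: each class in `F_e / F_{<e}` is represented by its unique element whose terms have
weight `e`. -/
def gr (k : Type*) [Field k] (w : Fin n ⊕ Fin n → ℝ) : Submodule k (HD n k) :=
  Submodule.span k {P | ∃ e, component w e P = P}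

/-- The product of the graded ring `gr^w`: the product of the classes of `P ∈ F_p` and `Q ∈ F_q` is
the class of `P * Q` in `F_{p+q} / F_{<p+q}`. (The sum is finite for `P`, `Q` in `gr^w`.) -/
def grMul (w : Fin n ⊕ Fin n → ℝ) (P Q : HD n k) : HD n k :=
  ∑ᶠ e : ℝ × ℝ, component w (e.1 + e.2) (component w e.1 P * component w e.2 Q)

/-- The graded rings `gr^w` and `gr^{w'}` are equal: same elements, and same product. -/
def SameGr (k : Type*) [Field k] (w w' : Fin n ⊕ Fin n → ℝ) : Prop :=
  gr k w = gr k w' ∧ ∀ P ∈ gr k w, ∀ Q ∈ gr k w, grMul w P Q = grMul w' P Q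

/-- The initial ideal `in_w(I)`: the left ideal of `gr^w` generated by the initial forms of the
elements of `I`. -/
def initialIdeal (w : Fin n ⊕ Fin n → ℝ) (I : Ideal (HD n k)) : Submodule k (HD n k) :=
  sInf {J | (∀ P ∈ I, initialForm w P ∈ J) ∧ ∀ A ∈ gr k w, ∀ B ∈ J, grMul w A B ∈ J}

/-- The Gröbner cone `C_I[w]`: the local weights `w'` with `gr^{w'} = gr^w` and
`in_{w'}(I) = in_w(I)`. -/
def groebnerCone (I : Ideal (HD n k)) (w : Fin n ⊕ Fin n → ℝ) : Set (Fin n ⊕ Fin n → ℝ) :=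
  {w' | w' ∈ Wloc n ∧ SameGr k w w' ∧ initialIdeal w I = initialIdeal w' I}

/-- The Newton polyhedron `conv(π(supp(g)) + {z ∈ ℤ²ⁿ | w · z ≤ 0 for all local weights w})`, where
`π(α, β, m) = (α, β)`. -/
def newton (g : HD n k) : Set (Fin n ⊕ Fin n → ℝ) :=
  convexHull ℝ {x | ∃ (a : Exps n) (z : Fin n ⊕ Fin n → ℤ), coef g a ≠ 0 ∧
    (∀ w ∈ Wloc n, w ⬝ᵥ (fun i => (z i : ℝ)) ≤ 0) ∧ x = pt a.1 + fun i => (z i : ℝ)}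

end HD

end LocalGroebner

end

/-! Both rings consist of formal combinations of exponents with a row-finite product. `CoefRing`
records this together with an additive degree (zero for power series, |β| + m for operators) that is
bounded on every support, and the theory of Gröbner cones is developed once, for `CoefRing`.

A local weight is nonpositive on exponents of degree zero, and a term of a product never weighs more
than the factors together. By Dickson's lemma each support contains finitely many exponents from
which the others arise by adding exponents of degree zero (`exists_finite_basis`), so maximal
weights are attained although supports are infinite. Dickson's lemma also makes the orders in use
well-founded upwards inside one degree. Division with remainder is therefore an exact recursion on
coefficients, without limits (`IsBase.division`), and it yields the unique reduced standard basis G.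

The core is `IsLocalWeight.inSpan_eq_iff`: for weights u, u' with the same graded product, in_u(I) =
in_{u'}(I) exactly when in_u(g) = in_{u'}(g) for all g in G. If the ideals agree, in_u(g) -
in_{u'}(g) lies in in_u(I) and misses the leading exponent of g. The other exponents of g avoid
Exp(I), whereas a nonzero element of in_u(I) has an exponent in Exp(I), so the difference is zero.
Conversely, dividing f in I by G with control of the weights writes in_u(f) through the in_u(g) =
in_{u'}(g). The leading exponents of G are the same for u', so the argument is symmetric.

The condition gr^u = gr^{u'} says that u and u' vanish on the same generators γ_j of the cone dual
to U (`SameZeros`). Geometric series in x_i detect u_i = 0, and the product ∂_i x_i = x_i ∂_i + h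
detects u_i + v_i = 0.

On the polyhedral side, the u-face of New(g) is the hull of the sums of an exponent of in_u(g) and a
dual vector killed by u, so it encodes in_u(g) and the vanishing γ_j together. Faces of a Minkowski
sum agree exactly when the faces of all summands do (`face_sum_eq_iff`), and the Gröbner cone is the
normal cone (`WeightSpace.normalCone_eq`). Finite bases of the supports finally reduce the
conditions to signs on finitely many integral vectors, which gives a relatively open rational cone.
-/

noncomputable section

namespace LocalGroebner

/-! ### Faces of convex hulls and of Minkowski sums; cones given by sign conditions. -/

section Convex

variable {ι : Type*} [Fintype ι]

/-- The points of `T` where the linear form `u` is maximal on `T`. -/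
def maxPoints (u : ι → ℝ) (T : Set (ι → ℝ)) : Set (ι → ℝ) :=
  {x | x ∈ T ∧ ∀ y ∈ T, u ⬝ᵥ y ≤ u ⬝ᵥ x}

lemma dotProduct_le_of_mem_convexHull {u : ι → ℝ} {T : Set (ι → ℝ)} {m : ℝ}
    (h : ∀ y ∈ T, u ⬝ᵥ y ≤ m) {y : ι → ℝ} (hy : y ∈ convexHull ℝ T) : u ⬝ᵥ y ≤ m := by
  have hc : Convex ℝ {x : ι → ℝ | u ⬝ᵥ x ≤ m} := by
    intro x hx y hy a b ha hb hab
    simp only [Set.mem_ofPred_eq, dotProduct_add, dotProduct_smul, smul_eq_mul] at *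
    calc _ ≤ a * m + b * m := by gcongr
      _ = m := by rw [← add_mul, hab, one_mul]
  exact convexHull_min (t := {x | u ⬝ᵥ x ≤ m}) h hc hy

lemma mem_face_convexHull {u : ι → ℝ} {T : Set (ι → ℝ)} {x : ι → ℝ} (hx : x ∈ T) :
    x ∈ face u (convexHull ℝ T) ↔ x ∈ maxPoints u T :=
  ⟨fun h => ⟨hx, fun y hy => h.2 y (subset_convexHull ℝ T hy)⟩,
    fun h => ⟨subset_convexHull ℝ T hx, fun _ hy => dotProduct_le_of_mem_convexHull h.2 hy⟩⟩

/-- The points strictly below the maximal value, together with the hull of the maximal points, form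
a convex set: a proper convex combination involving a point strictly below stays strictly below.
This set contains `T`, hence its hull, and a point of the face cannot be strictly below. -/
lemma face_convexHull {u : ι → ℝ} {T : Set (ι → ℝ)} (hT : (maxPoints u T).Nonempty) :
    face u (convexHull ℝ T) = convexHull ℝ (maxPoints u T) := by
  obtain ⟨t, ht⟩ := hT
  apply Set.Subset.antisymm
  · have hc : Convex ℝ {x : ι → ℝ | u ⬝ᵥ x < u ⬝ᵥ t ∨
        (u ⬝ᵥ x = u ⬝ᵥ t ∧ x ∈ convexHull ℝ (maxPoints u T))} := by
      rw [convex_iff_pairwise_pos]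
      intro x hx y hy _ a b ha hb hab
      have hle : ∀ z, (u ⬝ᵥ z < u ⬝ᵥ t ∨ (u ⬝ᵥ z = u ⬝ᵥ t ∧ z ∈ convexHull ℝ (maxPoints u T))) →
          u ⬝ᵥ z ≤ u ⬝ᵥ t := fun z hz => hz.elim le_of_lt fun h => h.1.le
      have hx' := hle x hx
      have hy' := hle y hy
      simp only [Set.mem_ofPred_eq, dotProduct_add, dotProduct_smul, smul_eq_mul] at *
      have hbt : u ⬝ᵥ t = a * u ⬝ᵥ t + b * u ⬝ᵥ t := by rw [← add_mul, hab, one_mul]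
      rcases hx with hx | hx
      · left
        rw [hbt]
        exact add_lt_add_of_lt_of_le (mul_lt_mul_of_pos_left hx ha)
          (mul_le_mul_of_nonneg_left hy' hb.le)
      rcases hy with hy | hy
      · left
        rw [hbt]
        exact add_lt_add_of_le_of_lt (mul_le_mul_of_nonneg_left hx' ha.le)
          (mul_lt_mul_of_pos_left hy hb)
      · right
        exact ⟨by rw [hx.1, hy.1, ← hbt], convex_convexHull ℝ _ hx.2 hy.2 ha.le hb.le hab⟩
    have hsub : convexHull ℝ T ⊆ _ := convexHull_min (fun x hx => by
      rcases (ht.2 x hx).lt_or_eq with h | h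
      · exact Or.inl h
      · exact Or.inr ⟨h, subset_convexHull ℝ _ ⟨hx, fun y hy => h ▸ ht.2 y hy⟩⟩) hc
    intro x hx
    rcases hsub hx.1 with h | h
    · exact absurd (hx.2 t (subset_convexHull ℝ T ht.1)) (not_le.2 h)
    · exact h.2
  · intro x hx
    refine ⟨convexHull_mono (fun y hy => hy.1) hx, fun y hy => ?_⟩
    have h1 : u ⬝ᵥ y ≤ u ⬝ᵥ t := dotProduct_le_of_mem_convexHull ht.2 hy
    have h2 : (-u) ⬝ᵥ x ≤ (-u) ⬝ᵥ t := dotProduct_le_of_mem_convexHull (fun z hz => by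
      simpa using hz.2 t ht.1) hx
    simp only [neg_dotProduct, neg_le_neg_iff] at h2
    exact h1.trans h2

lemma face_congr_of_maxPoints {u u' : ι → ℝ} {T : Set (ι → ℝ)} (hT : (maxPoints u T).Nonempty)
    (h : maxPoints u T = maxPoints u' T) :
    face u (convexHull ℝ T) = face u' (convexHull ℝ T) := by
  rw [face_convexHull hT, face_convexHull (h ▸ hT), h]

/-- If one summand were not maximal, replacing it alone by a better point would increase the value
of the sum. -/
lemma sum_mem_face {κ : Type*} {G : Finset κ} {Q : κ → Set (ι → ℝ)} {u : ι → ℝ}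
    (hne : ∀ g ∈ G, (face u (Q g)).Nonempty) {x : κ → ι → ℝ} (hx : ∀ g ∈ G, x g ∈ Q g) :
    ∑ g ∈ G, x g ∈ face u (∑ g ∈ G, Q g) ↔ ∀ g ∈ G, x g ∈ face u (Q g) := by
  classical
  choose! t ht using hne
  have key : ∀ y : κ → ι → ℝ, u ⬝ᵥ ∑ g ∈ G, y g = ∑ g ∈ G, u ⬝ᵥ y g := fun y => by
    simp [dotProduct_sum]
  constructor
  · intro h g hg
    refine ⟨hx g hg, fun y hy => ?_⟩
    by_contra hlt
    push Not at hlt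
    have := h.2 (∑ i ∈ G, Function.update x g y i) (Set.mem_finsetSum _ _ _ |>.2
      ⟨Function.update x g y, fun {i} hi => by
        by_cases hig : i = g
        · subst hig; simpa using hy
        · simpa [Function.update_of_ne hig] using hx i hi, rfl⟩)
    rw [key, key] at this
    refine absurd this (not_le.2 (Finset.sum_lt_sum (fun i hi => ?_) ⟨g, hg, by simpa using hlt⟩))
    by_cases hig : i = g
    · subst hig; simpa using hlt.le
    · simp [Function.update_of_ne hig]
  · intro h
    refine ⟨Set.mem_finsetSum _ _ _ |>.2 ⟨x, fun {i} hi => hx i hi, rfl⟩, fun y hy => ?_⟩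
    obtain ⟨z, hz, rfl⟩ := Set.mem_finsetSum _ _ _ |>.1 hy
    rw [key, key]
    exact Finset.sum_le_sum fun i hi => (h i hi).2 _ (hz hi)

/-- To recover one summand, a point of its face is completed by maximal points of the other
summands. The sum then lies in the common face, and `sum_mem_face` for the other weight returns each
summand to its own face. -/
lemma face_sum_eq_iff {κ : Type*} {G : Finset κ} {Q : κ → Set (ι → ℝ)} {u u' : ι → ℝ}
    (hne : ∀ g ∈ G, (face u (Q g)).Nonempty) (hne' : ∀ g ∈ G, (face u' (Q g)).Nonempty) :
    face u' (∑ g ∈ G, Q g) = face u (∑ g ∈ G, Q g) ↔ ∀ g ∈ G, face u' (Q g) = face u (Q g) := by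
  classical
  have aux : ∀ u u' : ι → ℝ, (∀ g ∈ G, (face u (Q g)).Nonempty) →
      (∀ g ∈ G, (face u' (Q g)).Nonempty) → face u' (∑ g ∈ G, Q g) = face u (∑ g ∈ G, Q g) →
      ∀ g ∈ G, face u' (Q g) ⊆ face u (Q g) := by
    intro u u' hne hne' h g hg x hx
    choose! t ht using hne'
    have h1 : ∀ i ∈ G, Function.update t g x i ∈ face u' (Q i) := by
      intro i hi
      by_cases hig : i = g
      · subst hig; simpa using hx
      · simpa [Function.update_of_ne hig] using ht i hi
    have hQ : ∀ i ∈ G, Function.update t g x i ∈ Q i := fun i hi => (h1 i hi).1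
    have h2 := (sum_mem_face (fun i hi => ⟨_, h1 i hi⟩) hQ).2 h1
    rw [h, sum_mem_face hne hQ] at h2
    simpa using h2 g hg
  constructor
  · exact fun h g hg => (aux u u' hne hne' h g hg).antisymm (aux u' u hne' hne h.symm g hg)
  · intro h
    ext x
    constructor
    · rintro ⟨hx, hm⟩
      obtain ⟨z, hz, rfl⟩ := Set.mem_finsetSum _ _ _ |>.1 hx
      have := (sum_mem_face hne' fun i hi => hz hi).1 ⟨hx, hm⟩
      exact (sum_mem_face hne fun i hi => hz hi).2 fun g hg => h g hg ▸ this g hg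
    · rintro ⟨hx, hm⟩
      obtain ⟨z, hz, rfl⟩ := Set.mem_finsetSum _ _ _ |>.1 hx
      have := (sum_mem_face hne fun i hi => hz hi).1 ⟨hx, hm⟩
      exact (sum_mem_face hne' fun i hi => hz hi).2 fun g hg => (h g hg).symm ▸ this g hg

/-- The weights having the same sign as `w` on each of finitely many integral vectors, all of them
nonpositive on `w`, form a relatively open rational cone. -/
lemma isRelOpenRationalCone_of_signs (V : Finset (ι → ℤ)) (w : ι → ℝ)
    (hw : ∀ b ∈ V, w ⬝ᵥ (fun i => (b i : ℝ)) ≤ 0) :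
    IsRelOpenRationalCone {w' : ι → ℝ | ∀ b ∈ V,
      (w ⬝ᵥ (fun i => (b i : ℝ)) = 0 → w' ⬝ᵥ (fun i => (b i : ℝ)) = 0) ∧
      (w ⬝ᵥ (fun i => (b i : ℝ)) < 0 → w' ⬝ᵥ (fun i => (b i : ℝ)) < 0)} := by
  classical
  set C := {w' : ι → ℝ | ∀ b ∈ V,
      (w ⬝ᵥ (fun i => (b i : ℝ)) = 0 → w' ⬝ᵥ (fun i => (b i : ℝ)) = 0) ∧
      (w ⬝ᵥ (fun i => (b i : ℝ)) < 0 → w' ⬝ᵥ (fun i => (b i : ℝ)) < 0)} with hC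
  have hcont : ∀ v : ι → ℝ, Continuous fun x : ι → ℝ => x ⬝ᵥ v := fun v =>
    Continuous.dotProduct continuous_id continuous_const
  refine ⟨?_, ?_, ?_⟩
  · rw [convex_iff_pairwise_pos]
    intro x hx y hy _ a b ha hb hab v hv
    simp only [add_dotProduct, smul_dotProduct, smul_eq_mul]
    refine ⟨fun h => by rw [(hx v hv).1 h, (hy v hv).1 h]; simp, fun h => ?_⟩
    have h1 := mul_neg_of_pos_of_neg ha ((hx v hv).2 h)
    have h2 := mul_neg_of_pos_of_neg hb ((hy v hv).2 h)
    linarith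
  · apply Set.Subset.antisymm intrinsicInterior_subset
    -- The equations cut out a subspace containing the affine span, so inside that span only the
    -- finitely many strict inequalities remain, and these are open conditions.
    let L : Submodule ℝ (ι → ℝ) :=
      { carrier := {x | ∀ b ∈ V, w ⬝ᵥ (fun i => (b i : ℝ)) = 0 → x ⬝ᵥ (fun i => (b i : ℝ)) = 0}
        zero_mem' := fun b _ _ => by simp
        add_mem' := fun {x y} hx hy b hb h => by rw [add_dotProduct, hx b hb h, hy b hb h, add_zero]
        smul_mem' := fun r x hx b hb h => by rw [smul_dotProduct, hx b hb h, smul_zero] }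
    have hspan : affineSpan ℝ C ≤ L.toAffineSubspace :=
      affineSpan_le.2 fun x hx b hb h => (hx b hb).1 h
    have hopen : IsOpen {x : ι → ℝ | ∀ b ∈ V, w ⬝ᵥ (fun i => (b i : ℝ)) < 0 →
        x ⬝ᵥ (fun i => (b i : ℝ)) < 0} := by
      have : {x : ι → ℝ | ∀ b ∈ V, w ⬝ᵥ (fun i => (b i : ℝ)) < 0 → x ⬝ᵥ (fun i => (b i : ℝ)) < 0} =
          ⋂ b ∈ V, {x : ι → ℝ | w ⬝ᵥ (fun i => (b i : ℝ)) < 0 → x ⬝ᵥ (fun i => (b i : ℝ)) < 0} := by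
        ext x; simp
      rw [this]
      refine isOpen_biInter_finset fun b _ => ?_
      by_cases h : w ⬝ᵥ (fun i => (b i : ℝ)) < 0
      · simp only [h, true_imp_iff]
        exact isOpen_lt (hcont _) continuous_const
      · simp only [h, false_imp_iff, Set.ofPred_true, isOpen_univ]
    have hpre : ((↑) ⁻¹' C : Set (affineSpan ℝ C)) = (↑) ⁻¹' {x : ι → ℝ | ∀ b ∈ V,
        w ⬝ᵥ (fun i => (b i : ℝ)) < 0 → x ⬝ᵥ (fun i => (b i : ℝ)) < 0} := by
      ext ⟨x, hx⟩
      exact ⟨fun h b hb => (h b hb).2, fun h b hb => ⟨hspan hx b hb, h b hb⟩⟩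
    intro x hx
    refine mem_intrinsicInterior.2 ⟨⟨x, subset_affineSpan ℝ C hx⟩, ?_, rfl⟩
    rw [hpre, (hopen.preimage continuous_subtype_val).interior_eq, ← hpre]
    exact hx
  -- Each equation is encoded as two opposite inequalities.
  · refine ⟨V ∪ (V.filter fun b => w ⬝ᵥ (fun i => (b i : ℝ)) = 0).image (fun b => -b), ?_⟩
    have hdot : ∀ (b : ι → ℤ) (x : ι → ℝ), ∑ i, (b i : ℝ) * x i = x ⬝ᵥ (fun i => (b i : ℝ)) :=
      fun b x => Finset.sum_congr rfl fun i _ => mul_comm _ _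
    have hset : {x : ι → ℝ | ∀ b ∈ V ∪ (V.filter fun b =>
          w ⬝ᵥ (fun i => (b i : ℝ)) = 0).image (fun b => -b), ∑ i, (b i : ℝ) * x i ≤ 0} =
        {x : ι → ℝ | ∀ b ∈ V, x ⬝ᵥ (fun i => (b i : ℝ)) ≤ 0 ∧ (w ⬝ᵥ (fun i => (b i : ℝ)) = 0 →
          x ⬝ᵥ (fun i => (b i : ℝ)) = 0)} := by
      have hneg : ∀ (b : ι → ℤ) (x : ι → ℝ),
          x ⬝ᵥ (fun i => ((-b) i : ℝ)) = - (x ⬝ᵥ (fun i => (b i : ℝ))) := fun b x => by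
        rw [← dotProduct_neg]; congr 1; ext i; simp
      ext x
      simp only [Set.mem_ofPred_eq, hdot, Finset.mem_union, Finset.mem_image, Finset.mem_filter]
      constructor
      · intro h b hb
        refine ⟨h b (Or.inl hb), fun h0 => (h b (Or.inl hb)).antisymm ?_⟩
        have := h (-b) (Or.inr ⟨b, ⟨hb, h0⟩, rfl⟩)
        rw [hneg] at this
        linarith
      · rintro h b (hb | ⟨b, ⟨hb, h0⟩, rfl⟩)
        · exact (h b hb).1
        · rw [hneg, (h b hb).2 h0, neg_zero]
    rw [hset]
    apply Set.Subset.antisymm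
    · refine closure_minimal (fun x hx b hb => ?_) ?_
      · refine ⟨?_, (hx b hb).1⟩
        rcases (hw b hb).lt_or_eq with h | h
        · exact ((hx b hb).2 h).le
        · exact ((hx b hb).1 h).le
      · have : {x : ι → ℝ | ∀ b ∈ V, x ⬝ᵥ (fun i => (b i : ℝ)) ≤ 0 ∧
            (w ⬝ᵥ (fun i => (b i : ℝ)) = 0 → x ⬝ᵥ (fun i => (b i : ℝ)) = 0)} =
            ⋂ b ∈ V, ({x : ι → ℝ | x ⬝ᵥ (fun i => (b i : ℝ)) ≤ 0} ∩
              {x | w ⬝ᵥ (fun i => (b i : ℝ)) = 0 → x ⬝ᵥ (fun i => (b i : ℝ)) = 0}) := by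
          ext x; simp
        rw [this]
        refine isClosed_biInter fun b _ => (isClosed_le (hcont _) continuous_const).inter ?_
        by_cases h : w ⬝ᵥ (fun i => (b i : ℝ)) = 0
        · simp only [h, true_imp_iff]
          exact isClosed_eq (hcont _) continuous_const
        · simp only [h, false_imp_iff, Set.ofPred_true, isClosed_univ]
    · intro x hx
      -- Points of the closed cone are approached from the cone itself by adding small positive
      -- multiples of `w`, which is strictly negative on every vector carrying a strict condition.
      have hlim : Filter.Tendsto (fun t : ℝ => x + t • w) (nhdsWithin 0 (Set.Ioi 0)) (nhds x) := by
        have : Continuous fun t : ℝ => x + t • w := by fun_prop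
        simpa using (this.tendsto 0).mono_left nhdsWithin_le_nhds
      refine mem_closure_of_tendsto hlim ?_
      filter_upwards [self_mem_nhdsWithin] with t ht b hb
      simp only [add_dotProduct, smul_dotProduct, smul_eq_mul]
      refine ⟨fun h => by rw [(hx b hb).2 h, h]; simp, fun h => ?_⟩
      have := mul_neg_of_pos_of_neg (Set.mem_Ioi.1 ht) h
      linarith [(hx b hb).1]

end Convex

/-! ### Rings of formal combinations of exponents. -/

/-- A ring `R` of formal `k`-combinations of exponents in `M` with supports of bounded degree, whose
product is given by row-finite structure constants `K a x b`, the coefficient at `b` of the product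
of the monomials with exponents `a` and `x`. -/
structure CoefRing (k R M : Type*) [Field k] [Ring R] [Module k R] [AddCommMonoid M] [IsCancelAdd M] where
  coef : R → M → k
  deg : M → ℕ
  K : M → M → M → k
  S : M → Finset (M × M)
  coef_add : ∀ f g a, coef (f + g) a = coef f a + coef g a
  coef_smul : ∀ (r : k) f a, coef (r • f) a = r * coef f a
  smul_mul : ∀ (r : k) (f g : R), (r • f) * g = r • (f * g)
  ext : ∀ f g, (∀ a, coef f a = coef g a) → f = g
  bound : ∀ f, ∃ D, ∀ a, coef f a ≠ 0 → deg a ≤ D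
  exists_coef : ∀ c : M → k, (∃ D, ∀ a, c a ≠ 0 → deg a ≤ D) → ∃ f, ∀ a, coef f a = c a
  coef_mul : ∀ f g b, coef (f * g) b = ∑ p ∈ S b, K p.1 p.2 b * (coef f p.1 * coef g p.2)
  mem_S : ∀ a x b, K a x b ≠ 0 → (a, x) ∈ S b
  K_add : ∀ a b, K a b (a + b) = 1
  deg_add : ∀ a b, deg (a + b) = deg a + deg b
  deg_K : ∀ a x b, K a x b ≠ 0 → deg b = deg a + deg x
  pos : ∀ a b : M, a + b = 0 → b = 0
  wqo : ∀ s : ℕ → M, ∃ i j, i < j ∧ ∃ d, s j = s i + d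

namespace CoefRing

variable {k R M : Type*} [Field k] [Ring R] [Module k R] [AddCommMonoid M] [IsCancelAdd M]
  (A : CoefRing k R M)

/-- The coefficient at `a`, as a linear form. -/
def coefHom (a : M) : R →ₗ[k] k where
  toFun f := A.coef f a
  map_add' f g := A.coef_add f g a
  map_smul' r f := A.coef_smul r f a

lemma coef_zero (a : M) : A.coef 0 a = 0 := map_zero (A.coefHom a)

lemma coef_sub (f g : R) (a : M) : A.coef (f - g) a = A.coef f a - A.coef g a :=
  map_sub (A.coefHom a) f g

lemma coef_sum {κ : Type*} (s : Finset κ) (f : κ → R) (a : M) :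
    A.coef (∑ i ∈ s, f i) a = ∑ i ∈ s, A.coef (f i) a := map_sum (A.coefHom a) f s

lemma eq_zero {f : R} (h : ∀ a, A.coef f a = 0) : f = 0 :=
  A.ext _ _ fun a => by rw [h, A.coef_zero]

lemma exists_coef_ne_zero {f : R} (h : f ≠ 0) : ∃ a, A.coef f a ≠ 0 := by
  by_contra! h'
  exact h (A.eq_zero h')

lemma smul_mem (A : CoefRing k R M) (I : Ideal R) (r : k) {f : R} (hf : f ∈ I) : r • f ∈ I := by
  have := I.mul_mem_left (r • 1) hf
  rwa [A.smul_mul, one_mul] at this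

lemma deg_zero : A.deg 0 = 0 := by simpa using A.deg_add 0 0

open Classical in
/-- The element with coefficients `c` (zero if the degrees are unbounded). -/
def ofFun (c : M → k) : R :=
  if h : ∃ D, ∀ a, c a ≠ 0 → A.deg a ≤ D then (A.exists_coef c h).choose else 0

lemma coef_ofFun {c : M → k} (h : ∃ D, ∀ a, c a ≠ 0 → A.deg a ≤ D) (a : M) :
    A.coef (A.ofFun c) a = c a := by
  rw [ofFun, dif_pos h]
  exact (A.exists_coef c h).choose_spec a

open Classical in
/-- The sum of the terms of `f` with exponents satisfying `p`. -/
def terms (p : M → Prop) (f : R) : R := A.ofFun fun a => if p a then A.coef f a else 0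

open Classical in
lemma coef_terms (p : M → Prop) (f : R) (a : M) :
    A.coef (A.terms p f) a = if p a then A.coef f a else 0 := by
  refine A.coef_ofFun ?_ a
  obtain ⟨D, hD⟩ := A.bound f
  exact ⟨D, fun a ha => hD a fun h => ha (by simp [h])⟩

lemma coef_terms_of {p : M → Prop} {a : M} (h : p a) (f : R) :
    A.coef (A.terms p f) a = A.coef f a := by rw [coef_terms, if_pos h]

lemma coef_terms_of_not {p : M → Prop} {a : M} (h : ¬p a) (f : R) :
    A.coef (A.terms p f) a = 0 := by rw [coef_terms, if_neg h]

lemma coef_terms_ne {p : M → Prop} {a : M} {f : R} :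
    A.coef (A.terms p f) a ≠ 0 ↔ p a ∧ A.coef f a ≠ 0 := by
  classical
  rw [coef_terms]; split_ifs with h <;> simp [h]

lemma terms_add (p : M → Prop) (f g : R) : A.terms p (f + g) = A.terms p f + A.terms p g := by
  refine A.ext _ _ fun a => ?_
  by_cases h : p a
  · simp only [A.coef_add, A.coef_terms_of h]
  · simp only [A.coef_add, A.coef_terms_of_not h, add_zero]

lemma terms_smul (p : M → Prop) (r : k) (f : R) : A.terms p (r • f) = r • A.terms p f := by
  refine A.ext _ _ fun a => ?_
  by_cases h : p a
  · simp only [A.coef_smul, A.coef_terms_of h]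
  · simp only [A.coef_smul, A.coef_terms_of_not h, mul_zero]

lemma terms_zero (p : M → Prop) : A.terms p 0 = 0 := by
  simpa using A.terms_smul p 0 0

lemma terms_sum (p : M → Prop) {κ : Type*} (s : Finset κ) (f : κ → R) :
    A.terms p (∑ i ∈ s, f i) = ∑ i ∈ s, A.terms p (f i) := by
  classical
  induction s using Finset.induction_on with
  | empty => simp [A.terms_zero]
  | insert i s hi ih => rw [Finset.sum_insert hi, Finset.sum_insert hi, terms_add, ih]

/-- The homogeneous part of degree `D`. -/
def degPart (D : ℕ) (f : R) : R := A.terms (fun a => A.deg a = D) f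

/-- `b` is the sum of `a` and an exponent of degree zero. -/
def Dvd₀ (a b : M) : Prop := ∃ d, A.deg d = 0 ∧ b = a + d

/-- Dickson's lemma: otherwise there is an infinite sequence in which no term divides a later one.
The complementary exponent automatically has degree zero, since both exponents have degree `D`. -/
lemma exists_finite_basis_deg (T : Set M) (D : ℕ) (hT : ∀ a ∈ T, A.deg a = D) :
    ∃ T₀ : Finset M, (∀ a ∈ T₀, a ∈ T) ∧ ∀ a ∈ T, ∃ a₀ ∈ T₀, A.Dvd₀ a₀ a := by
  by_contra! h
  obtain ⟨s, hs, hr⟩ := exists_seq_of_forall_finset_exists (· ∈ T) (fun x y => ¬A.Dvd₀ x y)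
    fun s hs => by
      obtain ⟨a, ha, h'⟩ := h s hs
      exact ⟨a, ha, h'⟩
  obtain ⟨i, j, hij, d, hd⟩ := A.wqo s
  refine hr i j hij ⟨d, ?_, hd⟩
  have := A.deg_add (s i) d
  rw [← hd, hT _ (hs i), hT _ (hs j)] at this
  omega

lemma exists_finite_basis (T : Set M) (D : ℕ) (hT : ∀ a ∈ T, A.deg a ≤ D) :
    ∃ T₀ : Finset M, (∀ a ∈ T₀, a ∈ T) ∧ ∀ a ∈ T, ∃ a₀ ∈ T₀, A.Dvd₀ a₀ a := by
  classical
  choose B hB hB' using fun D' => A.exists_finite_basis_deg {a | a ∈ T ∧ A.deg a = D'} D'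
    fun a ha => ha.2
  refine ⟨(Finset.range (D + 1)).biUnion B, fun a ha => ?_, fun a ha => ?_⟩
  · obtain ⟨D', -, h⟩ := Finset.mem_biUnion.1 ha
    exact (hB D' a h).1
  · obtain ⟨a₀, h₀, h⟩ := hB' (A.deg a) a ⟨ha, rfl⟩
    exact ⟨a₀, Finset.mem_biUnion.2 ⟨_, Finset.mem_range.2 (Nat.lt_succ_of_le (hT a ha)), h₀⟩, h⟩

/-! ### Local weights -/

/-- A weight which products do not increase, and nonpositive in degree zero. -/
structure IsLocalWeight (φ : M → ℝ) : Prop where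
  add : ∀ a b, φ (a + b) = φ a + φ b
  K : ∀ a x b, A.K a x b ≠ 0 → φ b ≤ φ a + φ x
  neg : ∀ d, A.deg d = 0 → φ d ≤ 0

/-- Two weights vanish on the same exponents of degree zero, and are additive for the same terms of
products. -/
structure SameWeight (φ φ' : M → ℝ) : Prop where
  zero : ∀ d, A.deg d = 0 → (φ d = 0 ↔ φ' d = 0)
  K : ∀ a x b, A.K a x b ≠ 0 → (φ b = φ a + φ x ↔ φ' b = φ' a + φ' x)

lemma SameWeight.symm {φ φ' : M → ℝ} (h : A.SameWeight φ φ') : A.SameWeight φ' φ :=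
  ⟨fun d hd => (h.zero d hd).symm, fun a x b hK => (h.K a x b hK).symm⟩

variable {A}

/-- `a` has maximal weight in the support of `f`. -/
def IsTop (A : CoefRing k R M) (φ : M → ℝ) (f : R) (a : M) : Prop :=
  ∀ b, A.coef f b ≠ 0 → φ b ≤ φ a

/-- The maximum over a finite basis of the support is the maximum over the support, because adding
an exponent of degree zero cannot raise the weight. -/
lemma IsLocalWeight.exists_top {φ : M → ℝ} (hφ : A.IsLocalWeight φ) {f : R} (hf : f ≠ 0) :
    ∃ a, A.coef f a ≠ 0 ∧ A.IsTop φ f a := by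
  obtain ⟨D, hD⟩ := A.bound f
  obtain ⟨T, hT, hT'⟩ := A.exists_finite_basis {a | A.coef f a ≠ 0} D hD
  obtain ⟨b, hb⟩ := A.exists_coef_ne_zero hf
  obtain ⟨b₀, hb₀, -⟩ := hT' b hb
  obtain ⟨a, ha, hmax⟩ := T.exists_max_image φ ⟨b₀, hb₀⟩
  refine ⟨a, hT a ha, fun c hc => ?_⟩
  obtain ⟨c₀, hc₀, d, hd, rfl⟩ := hT' c hc
  rw [hφ.add]
  linarith [hmax c₀ hc₀, hφ.neg d hd]

variable (A) in
/-- The initial form. -/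
def init (φ : M → ℝ) (f : R) : R := A.terms (A.IsTop φ f) f

variable (A) in
/-- The component of weight `e`. -/
def comp (φ : M → ℝ) (e : ℝ) (f : R) : R := A.terms (fun a => φ a = e) f

lemma init_eq_comp {φ : M → ℝ} {f : R} {a : M} (ha : A.coef f a ≠ 0) (ht : A.IsTop φ f a) :
    A.init φ f = A.comp φ (φ a) f := by
  refine A.ext _ _ fun b => ?_
  by_cases hb : A.coef f b = 0
  · simp [init, comp, coef_terms, hb]
  have : A.IsTop φ f b ↔ φ b = φ a :=
    ⟨fun h => (ht b hb).antisymm (h a ha), fun h c hc => h ▸ ht c hc⟩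
  simp [init, comp, coef_terms, this]

lemma init_zero (φ : M → ℝ) : A.init φ (0 : R) = 0 := A.terms_zero _

lemma IsLocalWeight.init_ne_zero {φ : M → ℝ} (hφ : A.IsLocalWeight φ) {f : R} (hf : f ≠ 0) :
    A.init φ f ≠ 0 := by
  obtain ⟨a, ha, ht⟩ := hφ.exists_top hf
  intro h
  apply ha
  rw [← A.coef_terms_of (p := A.IsTop φ f) ht f]
  exact (congrArg (A.coef · a) h).trans (A.coef_zero a)

variable (A) in
/-- All terms of `f` have weight at most `e`. -/
def WtLE (φ : M → ℝ) (f : R) (e : ℝ) : Prop := ∀ a, A.coef f a ≠ 0 → φ a ≤ e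

variable (A) in
/-- All terms of `f` have weight `e`. -/
def IsHom (φ : M → ℝ) (f : R) (e : ℝ) : Prop := ∀ a, A.coef f a ≠ 0 → φ a = e

lemma comp_isHom (φ : M → ℝ) (e : ℝ) (f : R) : A.IsHom φ (A.comp φ e f) e :=
  fun _ ha => (A.coef_terms_ne.1 ha).1

lemma comp_eq_self {φ : M → ℝ} {e : ℝ} {f : R} (h : A.IsHom φ f e) : A.comp φ e f = f := by
  refine A.ext _ _ fun a => ?_
  by_cases ha : A.coef f a = 0
  · simp [comp, coef_terms, ha]
  · simp [comp, coef_terms, h a ha]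

lemma comp_eq_zero_or_init {φ : M → ℝ} {f : R} {e : ℝ} (h : A.WtLE φ f e) :
    A.comp φ e f = 0 ∨ A.comp φ e f = A.init φ f := by
  by_cases hz : A.comp φ e f = 0
  · exact Or.inl hz
  · obtain ⟨a, ha⟩ := A.exists_coef_ne_zero hz
    obtain ⟨h1, h2⟩ := A.coef_terms_ne.1 ha
    right
    subst h1
    exact (init_eq_comp h2 h).symm

/-! ### The graded product and the span of the initial forms -/

variable (A) in
open Classical in
/-- The product of the graded ring. -/
def grMul (φ : M → ℝ) (f g : R) : R := A.ofFun fun b => ∑ p ∈ A.S b,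
  if φ b = φ p.1 + φ p.2 then A.K p.1 p.2 b * (A.coef f p.1 * A.coef g p.2) else 0

open Classical in
lemma coef_grMul (φ : M → ℝ) (f g : R) (b : M) :
    A.coef (A.grMul φ f g) b = ∑ p ∈ A.S b,
      if φ b = φ p.1 + φ p.2 then A.K p.1 p.2 b * (A.coef f p.1 * A.coef g p.2) else 0 := by
  refine A.coef_ofFun ?_ b
  obtain ⟨D, hD⟩ := A.bound f
  obtain ⟨E, hE⟩ := A.bound g
  refine ⟨D + E, fun a ha => ?_⟩
  obtain ⟨p, -, hp⟩ := Finset.exists_ne_zero_of_sum_ne_zero ha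
  have h : A.K p.1 p.2 a * (A.coef f p.1 * A.coef g p.2) ≠ 0 := fun h => hp (by simp [h])
  rw [A.deg_K _ _ _ (left_ne_zero_of_mul h)]
  exact add_le_add (hD _ (left_ne_zero_of_mul (right_ne_zero_of_mul h)))
    (hE _ (right_ne_zero_of_mul (right_ne_zero_of_mul h)))

lemma grMul_add_left (φ : M → ℝ) (f f' g : R) :
    A.grMul φ (f + f') g = A.grMul φ f g + A.grMul φ f' g := by
  refine A.ext _ _ fun b => ?_
  rw [A.coef_add, coef_grMul, coef_grMul, coef_grMul, ← Finset.sum_add_distrib]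
  refine Finset.sum_congr rfl fun p _ => ?_
  split_ifs
  · rw [A.coef_add]; ring
  · rw [add_zero]

lemma grMul_add_right (φ : M → ℝ) (f g g' : R) :
    A.grMul φ f (g + g') = A.grMul φ f g + A.grMul φ f g' := by
  refine A.ext _ _ fun b => ?_
  rw [A.coef_add, coef_grMul, coef_grMul, coef_grMul, ← Finset.sum_add_distrib]
  refine Finset.sum_congr rfl fun p _ => ?_
  split_ifs
  · rw [A.coef_add]; ring
  · rw [add_zero]

lemma grMul_smul_right (φ : M → ℝ) (r : k) (f g : R) :
    A.grMul φ f (r • g) = r • A.grMul φ f g := by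
  refine A.ext _ _ fun b => ?_
  rw [A.coef_smul, coef_grMul, coef_grMul, Finset.mul_sum]
  refine Finset.sum_congr rfl fun p _ => ?_
  split_ifs
  · rw [A.coef_smul]; ring
  · rw [mul_zero]

lemma grMul_zero_right (φ : M → ℝ) (f : R) : A.grMul φ f 0 = 0 := by
  simpa using grMul_smul_right (A := A) φ 0 f 0

lemma grMul_zero_left (φ : M → ℝ) (f : R) : A.grMul φ 0 f = 0 := by
  simpa using grMul_add_left (A := A) φ 0 0 f

lemma grMul_sum_left (φ : M → ℝ) {κ : Type*} (s : Finset κ) (f : κ → R) (g : R) :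
    A.grMul φ (∑ i ∈ s, f i) g = ∑ i ∈ s, A.grMul φ (f i) g := by
  classical
  induction s using Finset.induction_on with
  | empty => simp [grMul_zero_left]
  | insert i s hi ih => rw [Finset.sum_insert hi, Finset.sum_insert hi, grMul_add_left, ih]

lemma grMul_sum_right (φ : M → ℝ) {κ : Type*} (s : Finset κ) (f : R) (g : κ → R) :
    A.grMul φ f (∑ i ∈ s, g i) = ∑ i ∈ s, A.grMul φ f (g i) := by
  classical
  induction s using Finset.induction_on with
  | empty => simp [grMul_zero_right]
  | insert i s hi ih => rw [Finset.sum_insert hi, Finset.sum_insert hi, grMul_add_right, ih]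

lemma SameWeight.grMul_eq {φ φ' : M → ℝ} (h : A.SameWeight φ φ') (f g : R) :
    A.grMul φ f g = A.grMul φ' f g := by
  refine A.ext _ _ fun b => ?_
  rw [coef_grMul, coef_grMul]
  refine Finset.sum_congr rfl fun p _ => ?_
  by_cases hK : A.K p.1 p.2 b = 0
  · simp [hK]
  · simp only [h.K _ _ _ hK]

/-- The top component of a product is the graded product of the top components. -/
lemma IsLocalWeight.comp_mul {φ : M → ℝ} (hφ : A.IsLocalWeight φ) {f g : R} {d e : ℝ}
    (hf : A.WtLE φ f d) (hg : A.WtLE φ g e) :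
    A.comp φ (d + e) (f * g) = A.grMul φ (A.comp φ d f) (A.comp φ e g) := by
  classical
  refine A.ext _ _ fun b => ?_
  have hsum : ∀ (p : Prop) [Decidable p] (F : M × M → k),
      (if p then ∑ x ∈ A.S b, F x else 0) = ∑ x ∈ A.S b, if p then F x else 0 := by
    intro p _ F
    split_ifs <;> simp
  rw [coef_grMul, comp, coef_terms, A.coef_mul, hsum]
  refine Finset.sum_congr rfl fun p _ => ?_
  simp only [comp, coef_terms]
  by_cases hK : A.K p.1 p.2 b = 0
  · simp [hK]
  by_cases h1 : A.coef f p.1 = 0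
  · simp [h1]
  by_cases h2 : A.coef g p.2 = 0
  · simp [h2]
  have i1 := hf _ h1
  have i2 := hg _ h2
  have i3 := hφ.K _ _ _ hK
  -- The weights satisfy φ b ≤ φ p.1 + φ p.2 ≤ d + e, so a term reaches d + e only if both factors
  -- are of top weight and no weight is lost in the product.
  by_cases hb : φ b = d + e
  · have e1 : φ p.1 = d := by linarith
    have e2 : φ p.2 = e := by linarith
    simp [hb, e1, e2]
  · by_cases e1 : φ p.1 = d
    · by_cases e2 : φ p.2 = e
      · simp [hb, e1, e2]
      · simp [hb, e2]
    · simp [hb, e1]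

lemma IsHom.wtLE {φ : M → ℝ} {f : R} {e : ℝ} (h : A.IsHom φ f e) : A.WtLE φ f e :=
  fun a ha => (h a ha).le

lemma IsLocalWeight.wtLE_mul {φ : M → ℝ} (hφ : A.IsLocalWeight φ) {f g : R} {d e : ℝ}
    (hf : A.WtLE φ f d) (hg : A.WtLE φ g e) : A.WtLE φ (f * g) (d + e) := by
  intro b hb
  rw [A.coef_mul] at hb
  obtain ⟨p, -, hp⟩ := Finset.exists_ne_zero_of_sum_ne_zero hb
  have h1 := hφ.K _ _ _ (left_ne_zero_of_mul hp)
  have h2 := hf _ (left_ne_zero_of_mul (right_ne_zero_of_mul hp))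
  have h3 := hg _ (right_ne_zero_of_mul (right_ne_zero_of_mul hp))
  linarith

variable (A) in
/-- The `k`-span of the initial forms of the elements of `I`. -/
def inSpan (φ : M → ℝ) (I : Ideal R) : Submodule k R := Submodule.span k (A.init φ '' I)

lemma comp_mem_inSpan {φ : M → ℝ} {I : Ideal R} {f : R} {e : ℝ} (hf : f ∈ I)
    (h : A.WtLE φ f e) : A.comp φ e f ∈ A.inSpan φ I := by
  rcases comp_eq_zero_or_init h with h | h
  · rw [h]; exact zero_mem _
  · rw [h]; exact Submodule.subset_span ⟨f, hf, rfl⟩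

/-- The graded product of a homogeneous `f` with the initial form of `p` is the top component of `f
* p`, which is zero or an initial form of an element of `I`. Thus the `k`-span of the initial forms
is already stable under the graded ring. -/
lemma IsLocalWeight.grMul_mem_of_isHom {φ : M → ℝ} (hφ : A.IsLocalWeight φ) {I : Ideal R} {f g : R}
    {e : ℝ} (hf : A.IsHom φ f e) (hg : g ∈ A.inSpan φ I) : A.grMul φ f g ∈ A.inSpan φ I := by
  induction hg using Submodule.span_induction with
  | mem x hx =>
    obtain ⟨p, hp, rfl⟩ := hx
    by_cases h0 : p = 0
    · rw [h0, init_zero, grMul_zero_right]; exact zero_mem _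
    obtain ⟨a, ha, ht⟩ := hφ.exists_top h0
    have := hφ.comp_mul hf.wtLE ht
    rw [comp_eq_self hf, ← init_eq_comp ha ht] at this
    rw [← this]
    exact comp_mem_inSpan (I.mul_mem_left _ hp) (hφ.wtLE_mul hf.wtLE ht)
  | zero => rw [grMul_zero_right]; exact zero_mem _
  | add x y _ _ hx hy => rw [grMul_add_right]; exact add_mem hx hy
  | smul r x _ hx => rw [grMul_smul_right]; exact Submodule.smul_mem _ r hx

variable (A) in
/-- The terms of `f` have finitely many weights. -/
def FinWt (φ : M → ℝ) (f : R) : Prop := ∃ s : Finset ℝ, ∀ a, A.coef f a ≠ 0 → φ a ∈ s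

lemma sum_comp {φ : M → ℝ} {f : R} {s : Finset ℝ} (hs : ∀ a, A.coef f a ≠ 0 → φ a ∈ s) :
    ∑ e ∈ s, A.comp φ e f = f := by
  classical
  refine A.ext _ _ fun a => ?_
  rw [A.coef_sum]
  simp only [comp, coef_terms]
  by_cases ha : A.coef f a = 0
  · simp [ha]
  · rw [Finset.sum_ite_eq, if_pos (hs a ha)]

lemma IsLocalWeight.grMul_mem {φ : M → ℝ} (hφ : A.IsLocalWeight φ) {I : Ideal R} {f g : R}
    (hf : A.FinWt φ f) (hg : g ∈ A.inSpan φ I) : A.grMul φ f g ∈ A.inSpan φ I := by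
  obtain ⟨s, hs⟩ := hf
  rw [← sum_comp hs, grMul_sum_left]
  exact sum_mem fun e _ => hφ.grMul_mem_of_isHom (comp_isHom φ e f) hg

/-- In a `φ`-homogeneous element, each exponent differs from a member of a finite basis of the
support by some `d` of degree zero with `φ d = 0`. Then `φ' d = 0` too, so only the weights of the
basis occur. -/
lemma SameWeight.finWt {φ φ' : M → ℝ} (hφ : A.IsLocalWeight φ) (hφ' : A.IsLocalWeight φ')
    (h : A.SameWeight φ φ') {f : R} {e : ℝ} (hf : A.IsHom φ f e) : A.FinWt φ' f := by
  classical
  obtain ⟨D, hD⟩ := A.bound f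
  obtain ⟨T, hT, hT'⟩ := A.exists_finite_basis {a | A.coef f a ≠ 0} D hD
  refine ⟨T.image φ', fun a ha => ?_⟩
  obtain ⟨a₀, h₀, d, hd, rfl⟩ := hT' a ha
  have h1 := hf _ ha
  rw [hφ.add, hf _ (hT a₀ h₀), add_eq_left, h.zero d hd] at h1
  rw [hφ'.add, h1, add_zero]
  exact Finset.mem_image_of_mem φ' h₀

/-! ### Orders and division -/

variable (A) in
/-- A monomial order on the exponents of each degree which decreases along multiplication by
exponents of degree zero, and for which products have the expected leading exponents. -/
structure IsBase (lt : M → M → Prop) : Prop where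
  irrefl : ∀ a, ¬lt a a
  trans : ∀ a b c, lt a b → lt b c → lt a c
  tri : ∀ a b, A.deg a = A.deg b → lt a b ∨ a = b ∨ lt b a
  add : ∀ d a b, lt a b → lt (d + a) (d + b)
  K : ∀ a x b, A.K a x b ≠ 0 → b = a + x ∨ lt b (a + x)
  neg : ∀ d, A.deg d = 0 → d ≠ 0 → lt d 0

variable (A) in
/-- The order comparing the degree, then the weight `φ`, then `lt`. -/
def ord (φ : M → ℝ) (lt : M → M → Prop) (a b : M) : Prop :=
  A.deg a < A.deg b ∨ (A.deg a = A.deg b ∧ refine φ lt a b)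

variable (A) in
/-- A base order comparing degrees first. -/
structure IsAdm (lt : M → M → Prop) : Prop extends A.IsBase lt where
  first : ∀ a b, A.deg a < A.deg b → lt a b

/-- Products remain compatible with the refined order because a weight can only drop in a product;
when it does not drop, the base order decides. -/
lemma IsBase.ord {lt : M → M → Prop} (hlt : A.IsBase lt) {φ : M → ℝ} (hφ : A.IsLocalWeight φ) :
    A.IsAdm (A.ord φ lt) where
  irrefl a h := by
    rcases h with h | ⟨-, h | ⟨-, h⟩⟩
    · exact lt_irrefl _ h
    · exact lt_irrefl _ h
    · exact hlt.irrefl _ h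
  trans a b c h1 h2 := by
    rcases h1 with h1 | ⟨e1, h1⟩
    · rcases h2 with h2 | ⟨e2, -⟩
      · exact Or.inl (h1.trans h2)
      · exact Or.inl (e2 ▸ h1)
    · rcases h2 with h2 | ⟨e2, h2⟩
      · exact Or.inl (e1 ▸ h2)
      · refine Or.inr ⟨e1.trans e2, ?_⟩
        rcases h1 with h1 | ⟨f1, h1⟩
        · rcases h2 with h2 | ⟨f2, -⟩
          · exact Or.inl (h1.trans h2)
          · exact Or.inl (f2 ▸ h1)
        · rcases h2 with h2 | ⟨f2, h2⟩
          · exact Or.inl (f1 ▸ h2)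
          · exact Or.inr ⟨f1.trans f2, hlt.trans _ _ _ h1 h2⟩
  tri a b hab := by
    rcases lt_trichotomy (φ a) (φ b) with h | h | h
    · exact Or.inl (Or.inr ⟨hab, Or.inl h⟩)
    · rcases hlt.tri a b hab with h' | h' | h'
      · exact Or.inl (Or.inr ⟨hab, Or.inr ⟨h, h'⟩⟩)
      · exact Or.inr (Or.inl h')
      · exact Or.inr (Or.inr (Or.inr ⟨hab.symm, Or.inr ⟨h.symm, h'⟩⟩))
    · exact Or.inr (Or.inr (Or.inr ⟨hab.symm, Or.inl h⟩))
  add d a b h := by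
    simp only [CoefRing.ord, refine, A.deg_add, hφ.add, add_lt_add_iff_left, add_right_inj] at h ⊢
    exact h.imp_right (And.imp_right (Or.imp_right (And.imp_right (hlt.add d a b))))
  K a x b h := by
    rcases hlt.K a x b h with h' | h'
    · exact Or.inl h'
    · refine Or.inr (Or.inr ⟨by rw [A.deg_add, A.deg_K _ _ _ h], ?_⟩)
      rcases (hφ.K a x b h).lt_or_eq with h1 | h1
      · exact Or.inl (by rwa [hφ.add])
      · exact Or.inr ⟨by rwa [hφ.add], h'⟩
  neg d hd h0 := by
    have hz : φ 0 = 0 := by simpa using hφ.add 0 0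
    refine Or.inr ⟨by rw [hd, A.deg_zero], ?_⟩
    rcases (hφ.neg d hd).lt_or_eq with h1 | h1
    · exact Or.inl (by rwa [hz])
    · exact Or.inr ⟨by rw [h1, hz], hlt.neg d hd h0⟩
  first a b h := Or.inl h

/-- The relation along which division proceeds is well-founded. -/
lemma IsBase.wellFounded {lt : M → M → Prop} (hlt : A.IsBase lt) :
    WellFounded fun a b => A.deg a = A.deg b ∧ lt b a := by
  have : IsStrictOrder M fun a b => A.deg a = A.deg b ∧ lt b a :=
    { irrefl := fun a h => hlt.irrefl a h.2
      trans := fun a b c h1 h2 => ⟨h1.1.trans h2.1, hlt.trans _ _ _ h2.2 h1.2⟩ }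
  rw [RelEmbedding.wellFounded_iff_isEmpty]
  refine ⟨fun s => ?_⟩
  -- An infinite descending chain would increase for `lt` within one degree. Dickson's lemma finds a
  -- later term that is an earlier one plus an exponent of degree zero, and this one is not larger
  -- for `lt`.
  obtain ⟨i, j, hij, d, hd⟩ := A.wqo s
  have h := s.map_rel_iff.2 (show j > i from hij)
  have hdeg : A.deg d = 0 := by
    have := A.deg_add (s i) d
    rw [← hd] at this
    have := h.1
    omega
  rcases eq_or_ne d 0 with rfl | h0
  · rw [hd, add_zero] at h
    exact hlt.irrefl _ h.2
  · have := hlt.add (s i) d 0 (hlt.neg d hdeg h0)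
    rw [add_zero, ← hd] at this
    exact hlt.irrefl _ (hlt.trans _ _ _ h.2 this)

/-- Among the exponents of maximal degree, which exists since degrees are bounded on a support, a
minimal element for the well-founded reversed order is the leading exponent. -/
lemma IsAdm.exists_lead {lt : M → M → Prop} (hlt : A.IsAdm lt) {f : R} (hf : f ≠ 0) :
    ∃ e, IsLeadingExp A.coef lt f e := by
  obtain ⟨b, hb⟩ := A.exists_coef_ne_zero hf
  obtain ⟨D, hD⟩ := A.bound f
  have hbdd : BddAbove {m | ∃ a, A.coef f a ≠ 0 ∧ A.deg a = m} :=
    ⟨D, by rintro m ⟨a, ha, rfl⟩; exact hD a ha⟩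
  obtain ⟨a, ha, hm⟩ := Nat.sSup_mem (s := {m | ∃ a, A.coef f a ≠ 0 ∧ A.deg a = m}) ⟨_, b, hb, rfl⟩ hbdd
  obtain ⟨e, ⟨he, hed⟩, hmin⟩ := hlt.wellFounded.has_min
    {c | A.coef f c ≠ 0 ∧ A.deg c = A.deg a} ⟨a, ha, rfl⟩
  refine ⟨e, he, fun c hc hce => ?_⟩
  have hle : A.deg c ≤ A.deg e := by
    rw [hed, hm]; exact le_csSup hbdd ⟨c, hc, rfl⟩
  rcases hle.lt_or_eq with h | h
  · exact hlt.first _ _ h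
  · rcases hlt.tri c e h with h' | h' | h'
    · exact h'
    · exact absurd h' hce
    · exact absurd ⟨h, h'⟩ (hmin c ⟨hc, h.trans hed⟩)

lemma IsBase.lead_unique {lt : M → M → Prop} (hlt : A.IsBase lt) {f : R} {e e' : M}
    (h : IsLeadingExp A.coef lt f e) (h' : IsLeadingExp A.coef lt f e') : e = e' := by
  by_contra hne
  exact hlt.irrefl _ (hlt.trans _ _ _ (h.2 e' h'.1 (Ne.symm hne)) (h'.2 e h.1 hne))

end CoefRing

/-- A triangular system of linear equations along a well-founded relation is solvable. -/
lemma exists_solution_of_wellFounded {k N : Type*} [Field k] {r : N → N → Prop} (hr : WellFounded r) (E : Set N)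
    (L : N → N → k) (T : N → Finset N) (hT : ∀ b' b, L b' b ≠ 0 → b' ∈ T b)
    (hone : ∀ b ∈ E, L b b = 1) (htri : ∀ b' b, L b' b ≠ 0 → b' = b ∨ r b' b) (f : N → k) :
    ∃ c : N → k, (∀ b ∈ E, f b = ∑ b' ∈ T b, c b' * L b' b) ∧
      ∀ p : N → Prop, (∀ a, f a ≠ 0 → p a) → (∀ b' b, p b' → L b' b ≠ 0 → r b' b → p b) →
        ∀ b, c b ≠ 0 → p b := by
  classical
  -- Forward substitution: the diagonal entry is 1 and the other nonzero entries of row `b` sit at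
  -- indices preceding `b`, where the solution is already known. Outside `E` there is no equation
  -- and the value is set to zero.
  set c : N → k := hr.fix fun b ih => if b ∈ E then
    f b - ∑ b' ∈ T b, if h : r b' b then ih b' h * L b' b else 0 else 0 with hc
  have hc' : ∀ b, c b = if b ∈ E then f b - ∑ b' ∈ T b, if r b' b then c b' * L b' b else 0
      else 0 := fun b => by
    rw [hc, hr.fix_eq]
    simp only [dite_eq_ite]
  refine ⟨c, fun b hb => ?_, fun p hf hp b => ?_⟩
  · have h1 : ∀ b' ∈ T b, c b' * L b' b =
        (if r b' b then c b' * L b' b else 0) + if b' = b then c b else 0 := by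
      intro b' _
      by_cases h : b' = b
      · subst h
        have : ¬ r b' b' := fun h => (hr.irrefl.irrefl _ h)
        rw [if_neg this, if_pos rfl, hone _ hb, zero_add, mul_one]
      · rw [if_neg h, add_zero]
        split_ifs with h2
        · rfl
        · have : L b' b = 0 := by
            by_contra h3
            exact (htri b' b h3).elim h h2
          rw [this, mul_zero]
    have hbT : b ∈ T b := hT b b (by rw [hone b hb]; exact one_ne_zero)
    rw [Finset.sum_congr rfl h1, Finset.sum_add_distrib, Finset.sum_ite_eq', if_pos hbT]
    have h2 := hc' b
    rw [if_pos hb] at h2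
    rw [h2]
    ring
  · induction b using hr.induction with
    | _ b ih =>
    intro hb
    rw [hc' b] at hb
    by_cases hbE : b ∈ E
    swap
    · simp [hbE] at hb
    rw [if_pos hbE] at hb
    by_cases hfb : f b = 0
    · rw [hfb, zero_sub, neg_ne_zero] at hb
      obtain ⟨b', -, h⟩ := Finset.exists_ne_zero_of_sum_ne_zero hb
      by_cases hrb : r b' b
      · rw [if_pos hrb] at h
        exact hp b' b (ih b' hrb (left_ne_zero_of_mul h)) (right_ne_zero_of_mul h) hrb
      · simp [hrb] at h
    · exact hf b hfb

namespace CoefRing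

variable {k R M : Type*} [Field k] [Ring R] [Module k R] [AddCommMonoid M] [IsCancelAdd M]
  {A : CoefRing k R M}

variable (A) in
open Classical in
/-- The monomial with exponent `d`. -/
def mon (d : M) : R := A.ofFun fun a => if a = d then 1 else 0

open Classical in
lemma coef_mon (d a : M) : A.coef (A.mon d) a = if a = d then 1 else 0 :=
  A.coef_ofFun ⟨A.deg d, fun b hb => by
    by_cases h : b = d
    · rw [h]
    · simp [h] at hb⟩ a

open Classical in
lemma coef_mon_mul (d : M) (f : R) (b : M) : A.coef (A.mon d * f) b =
    ∑ p ∈ A.S b, if p.1 = d then A.K p.1 p.2 b * A.coef f p.2 else 0 := by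
  rw [A.coef_mul]
  refine Finset.sum_congr rfl fun p _ => ?_
  rw [coef_mon]
  split_ifs <;> simp

lemma exists_of_coef_mon_mul_ne_zero {d : M} {f : R} {b : M} (h : A.coef (A.mon d * f) b ≠ 0) :
    ∃ x, (d, x) ∈ A.S b ∧ A.K d x b ≠ 0 ∧ A.coef f x ≠ 0 := by
  classical
  rw [coef_mon_mul] at h
  obtain ⟨⟨a, x⟩, hp, hne⟩ := Finset.exists_ne_zero_of_sum_ne_zero h
  dsimp only at hne
  by_cases had : a = d
  · subst had
    rw [if_pos rfl] at hne
    exact ⟨x, hp, left_ne_zero_of_mul hne, right_ne_zero_of_mul hne⟩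
  · simp [had] at hne

/-- Any exponent `x ≠ e` of `f` contributes only at exponents not above `d + x`, which is strictly
below `d + e`. -/
lemma IsBase.coef_mon_mul_lead {lt : M → M → Prop} (hlt : A.IsBase lt) {f : R} {e : M}
    (he : IsLeadingExp A.coef lt f e) (d : M) :
    A.coef (A.mon d * f) (d + e) = A.coef f e := by
  classical
  rw [coef_mon_mul, Finset.sum_eq_single (d, e)]
  · rw [if_pos rfl, A.K_add, one_mul]
  · rintro ⟨a, x⟩ - hne
    dsimp only
    split_ifs with had
    swap
    · rfl
    subst had
    have hxe : x ≠ e := fun h => hne (by rw [h])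
    by_contra h0
    have h1 := hlt.add a _ _ (he.2 x (right_ne_zero_of_mul h0) hxe)
    rcases hlt.K _ _ _ (left_ne_zero_of_mul h0) with h | h
    · exact hxe (add_left_cancel h).symm
    · exact hlt.irrefl _ (hlt.trans _ _ _ h h1)
  · intro h
    exact absurd (A.mem_S d e (d + e) (by rw [A.K_add]; exact one_ne_zero)) h

lemma IsBase.mon_mul_lt {lt : M → M → Prop} (hlt : A.IsBase lt) {f : R} {e : M}
    (he : IsLeadingExp A.coef lt f e) {d b : M} (hb : A.coef (A.mon d * f) b ≠ 0) :
    b = d + e ∨ lt b (d + e) := by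
  obtain ⟨x, -, hK, hx⟩ := exists_of_coef_mon_mul_ne_zero hb
  by_cases hxe : x = e
  · subst hxe; exact hlt.K _ _ _ hK
  · have h1 := hlt.add d _ _ (he.2 x hx hxe)
    rcases hlt.K _ _ _ hK with h | h
    · exact Or.inr (h ▸ h1)
    · exact Or.inr (hlt.trans _ _ _ h h1)

lemma IsBase.lead_mon_mul {lt : M → M → Prop} (hlt : A.IsBase lt) {f : R} {e : M}
    (he : IsLeadingExp A.coef lt f e) (d : M) : IsLeadingExp A.coef lt (A.mon d * f) (d + e) :=
  ⟨by rw [hlt.coef_mon_mul_lead he]; exact he.1,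
    fun _ ha hne => (hlt.mon_mul_lt he ha).resolve_left hne⟩

/-- Division with remainder by homogeneous elements `g i` with leading exponents `e i`. The property
`p` controls the exponents of the products of the quotients with the divisors. -/
theorem IsBase.division {lt : M → M → Prop} (hlt : A.IsBase lt) {κ : Type*} [Nonempty κ]
    (s : Finset κ) (g : κ → R) (e : κ → M) (hlead : ∀ i ∈ s, IsLeadingExp A.coef lt (g i) (e i))
    (hone : ∀ i ∈ s, A.coef (g i) (e i) = 1)
    (hhom : ∀ i ∈ s, ∀ a, A.coef (g i) a ≠ 0 → A.deg a = A.deg (e i)) (f : R) :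
    ∃ q : κ → R, (∀ i ∈ s, ∀ d, A.coef (f - ∑ j ∈ s, q j * g j) (e i + d) = 0) ∧
      ∀ p : M → Prop, (∀ a, A.coef f a ≠ 0 → p a) →
        (∀ b' b, p b' → A.deg b' = A.deg b → lt b b' → p b) →
        ∀ i ∈ s, ∀ d, A.coef (q i) d ≠ 0 → p (e i + d) := by
  classical
  set E : Set M := {b | ∃ i ∈ s, ∃ d, b = e i + d} with hE
  have hch : ∀ b, b ∈ E → ∃ gd : κ × M, gd.1 ∈ s ∧ b = e gd.1 + gd.2 := by
    rintro b ⟨i, hi, d, rfl⟩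
    exact ⟨(i, d), hi, rfl⟩
  -- Each exponent in `E` is assigned one divisor and one cofactor. The multiples of divisors so
  -- obtained form a triangular system with unit diagonal, whose unknowns are the coefficients of
  -- the quotients.
  choose! gd hgd hgd' using hch
  set L : M → M → k := fun b' b =>
    if b' ∈ E then A.coef (A.mon (gd b').2 * g (gd b').1) b else 0 with hL
  -- Row `b` is finite because only the finitely many pairs in `A.S b` can contribute to the
  -- coefficient at `b` of a product.
  set T : M → Finset M := fun b =>
    (s ×ˢ (A.S b)).image fun x => e x.1 + x.2.1 with hT
  have hTE : ∀ b, ∀ b' ∈ T b, b' ∈ E := by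
    intro b b' hb'
    obtain ⟨⟨i, p⟩, hx, rfl⟩ := Finset.mem_image.1 hb'
    exact ⟨i, (Finset.mem_product.1 hx).1, p.1, rfl⟩
  have hLT : ∀ b' b, L b' b ≠ 0 → b' ∈ T b := by
    intro b' b h
    by_cases hb' : b' ∈ E
    · simp only [hL, if_pos hb'] at h
      obtain ⟨x, hx, -⟩ := exists_of_coef_mon_mul_ne_zero h
      exact Finset.mem_image.2 ⟨((gd b').1, ((gd b').2, x)),
        Finset.mem_product.2 ⟨hgd b' hb', hx⟩, (hgd' b' hb').symm⟩
    · simp [hL, hb'] at h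
  have hL1 : ∀ b ∈ E, L b b = 1 := by
    intro b hb
    have h1 := hlt.coef_mon_mul_lead (hlead _ (hgd b hb)) (gd b).2
    rw [hone _ (hgd b hb), add_comm, ← hgd' b hb] at h1
    simp only [hL, if_pos hb, h1]
  have hLr : ∀ b' b, L b' b ≠ 0 → b' = b ∨ (A.deg b' = A.deg b ∧ lt b b') := by
    intro b' b h
    by_cases hb' : b' ∈ E
    · simp only [hL, if_pos hb'] at h
      rcases hlt.mon_mul_lt (hlead _ (hgd b' hb')) h with h1 | h1
      · left; rw [h1, add_comm, ← hgd' b' hb']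
      · right
        rw [add_comm, ← hgd' b' hb'] at h1
        refine ⟨?_, h1⟩
        obtain ⟨x, -, hK, hx⟩ := exists_of_coef_mon_mul_ne_zero h
        rw [A.deg_K _ _ _ hK, hhom _ (hgd b' hb') x hx, add_comm, ← A.deg_add, ← hgd' b' hb']
    · simp [hL, hb'] at h
  obtain ⟨c, hc, hcp⟩ := exists_solution_of_wellFounded hlt.wellFounded E L T hLT hL1 hLr (A.coef f)
  have hcp' : ∀ p : M → Prop, (∀ a, A.coef f a ≠ 0 → p a) →
        (∀ b' b, p b' → A.deg b' = A.deg b → lt b b' → p b) → ∀ b, c b ≠ 0 → p b :=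
    fun p h1 h2 => hcp p h1 fun b' b hb' _ hr => h2 b' b hb' hr.1 hr.2
  -- The unknown at `b` becomes the coefficient of the quotient of the divisor assigned to `b`, at
  -- the corresponding cofactor.
  set q : κ → R := fun i => A.ofFun fun d => if (gd (e i + d)).1 = i then c (e i + d) else 0 with hq
  have hqc : ∀ i d, A.coef (q i) d = if (gd (e i + d)).1 = i then c (e i + d) else 0 := by
    intro i d
    refine A.coef_ofFun ?_ d
    obtain ⟨D, hD⟩ := A.bound f
    refine ⟨D, fun a ha => ?_⟩
    have h1 : c (e i + a) ≠ 0 := fun h => ha (by simp [h])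
    have h2 := hcp' (fun b => A.deg b ≤ D) hD (fun b' b h1 h2 _ => h2 ▸ h1) _ h1
    rw [A.deg_add] at h2
    omega
  refine ⟨q, fun i hi d => ?_, fun p h1 h2 i hi d hd => ?_⟩
  · have hb : e i + d ∈ E := ⟨i, hi, d, rfl⟩
    generalize e i + d = b at hb
    rw [A.coef_sub, A.coef_sum, hc b hb, sub_eq_zero]
    -- Expanding the matrix entries over all divisors and all pairs in `A.S b` allows the sum over
    -- `b'` to be carried out last, leaving the coefficient of the sum of the products.
    have hL2 : ∀ b' ∈ T b, c b' * L b' b = ∑ i ∈ s, ∑ p ∈ A.S b,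
        if b' = e i + p.1 then (if (gd (e i + p.1)).1 = i then
          c (e i + p.1) * (A.K p.1 p.2 b * A.coef (g i) p.2) else 0) else 0 := by
      intro b' hb'
      have hb'E := hTE b b' hb'
      rw [Finset.sum_eq_single (gd b').1]
      · simp only [hL, if_pos hb'E, coef_mon_mul, Finset.mul_sum]
        refine Finset.sum_congr rfl fun p _ => ?_
        have hiff : b' = e (gd b').1 + p.1 ↔ p.1 = (gd b').2 := by
          nth_rw 1 [hgd' b' hb'E]
          rw [add_right_inj, eq_comm]
        by_cases hp : p.1 = (gd b').2
        · rw [if_pos hp, if_pos (hiff.2 hp), ← hiff.2 hp, if_pos rfl]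
        · rw [if_neg hp, if_neg (fun h => hp (hiff.1 h)), mul_zero]
      · intro j _ hj
        refine Finset.sum_eq_zero fun p _ => ?_
        split_ifs with h3 h4
        · exact absurd (h3 ▸ h4).symm hj
        · rfl
        · rfl
      · exact fun h => absurd (hgd b' hb'E) h
    rw [Finset.sum_congr rfl hL2, Finset.sum_comm]
    refine Finset.sum_congr rfl fun j hj => ?_
    rw [A.coef_mul, Finset.sum_comm]
    refine Finset.sum_congr rfl fun p hp => ?_
    rw [Finset.sum_ite_eq', if_pos, hqc]
    · split_ifs
      · ring
      · simp
    · exact Finset.mem_image.2 ⟨(j, p), Finset.mem_product.2 ⟨hj, hp⟩, rfl⟩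
  · refine hcp' p h1 h2 _ fun h => hd ?_
    rw [hqc, h, ite_self]

/-! ### Reduced standard bases -/

variable (A) in
/-- The ideal contains the homogeneous parts of its elements. -/
def IsHomIdeal (I : Ideal R) : Prop := ∀ f ∈ I, ∀ D, A.degPart D f ∈ I

/-- Dickson's lemma gives a finite generating set, and discarding its non-minimal members leaves one
that still generates. -/
lemma exists_minimal_basis (A : CoefRing k R M) (T : Set M) : ∃ T₀ : Finset M, (∀ a ∈ T₀, a ∈ T) ∧
    (∀ a ∈ T, ∃ a₀ ∈ T₀, ∃ d, a = a₀ + d) ∧ ∀ a ∈ T₀, ∀ a' ∈ T, ∀ d, a = a' + d → a = a' := by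
  classical
  have hfin : ∃ T₁ : Finset M, (∀ a ∈ T₁, a ∈ T) ∧ ∀ a ∈ T, ∃ a₀ ∈ T₁, ∃ d, a = a₀ + d := by
    by_contra! h
    obtain ⟨s, hs, hr⟩ := exists_seq_of_forall_finset_exists (· ∈ T) (fun x y => ∀ d, y ≠ x + d)
      fun s hs => by
        obtain ⟨a, ha, h'⟩ := h s hs
        exact ⟨a, ha, h'⟩
    obtain ⟨i, j, hij, d, hd⟩ := A.wqo s
    exact hr i j hij d hd
  -- Proper divisibility is a strict order because no nonzero exponent has an additive inverse.
  have hwf : WellFounded fun a b : M => ∃ d, d ≠ 0 ∧ b = a + d := by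
    have : IsStrictOrder M fun a b : M => ∃ d, d ≠ 0 ∧ b = a + d :=
      { irrefl := fun a ⟨d, hd, h⟩ => hd (by simpa using h)
        trans := fun a b c ⟨d, hd, h⟩ ⟨d', hd', h'⟩ =>
          ⟨d + d', fun h0 => hd' (A.pos _ _ h0), by rw [h', h, add_assoc]⟩ }
    rw [RelEmbedding.wellFounded_iff_isEmpty]
    refine ⟨fun s => ?_⟩
    obtain ⟨i, j, hij, d, hd⟩ := A.wqo s
    obtain ⟨d', hd', h⟩ := s.map_rel_iff.2 (show j > i from hij)
    rw [hd, add_assoc] at h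
    exact hd' (A.pos d d' (by simpa using h))
  obtain ⟨T₁, h1, h2⟩ := hfin
  refine ⟨T₁.filter fun a => ∀ a' ∈ T, ∀ d, a = a' + d → a = a', fun a ha =>
    h1 a (Finset.mem_filter.1 ha).1, fun a ha => ?_, fun a ha => (Finset.mem_filter.1 ha).2⟩
  obtain ⟨m, ⟨hm, d, rfl⟩, hmin⟩ := hwf.has_min {c | c ∈ T ∧ ∃ d, a = c + d} ⟨a, ha, 0, by simp⟩
  have hm' : ∀ a' ∈ T, ∀ d, m = a' + d → m = a' := by
    intro a' ha' d' h
    by_contra hne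
    refine hmin a' ⟨ha', d' + d, by rw [h, add_assoc]⟩ ⟨d', fun h0 => hne ?_, h⟩
    rw [h, h0, add_zero]
  -- A minimal exponent equals the generator dividing it, so it already belongs to `T₁`.
  obtain ⟨a₁, ha₁, d', h⟩ := h2 m hm
  have := hm' a₁ (h1 a₁ ha₁) d' h
  exact ⟨m, Finset.mem_filter.2 ⟨this ▸ ha₁, hm'⟩, d, rfl⟩

lemma IsBase.add_mem_leadingExps {lt : M → M → Prop} (hlt : A.IsBase lt) {I : Ideal R} {e : M}
    (he : e ∈ leadingExps A.coef lt (I : Set R)) (d : M) :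
    e + d ∈ leadingExps A.coef lt (I : Set R) := by
  obtain ⟨f, hf, hfe⟩ := he
  exact ⟨_, I.mul_mem_left (A.mon d) hf, add_comm d e ▸ hlt.lead_mon_mul hfe d⟩

/-- The part of `f` in the degree of `e`, rescaled, has the same leading exponent. Homogeneous
divisors are what `IsBase.division` requires. -/
lemma exists_homogeneous_lead {lt : M → M → Prop} {I : Ideal R}
    (hI : A.IsHomIdeal I) {e : M} (he : e ∈ leadingExps A.coef lt (I : Set R)) :
    ∃ f ∈ I, IsLeadingExp A.coef lt f e ∧ A.coef f e = 1 ∧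
      ∀ a, A.coef f a ≠ 0 → A.deg a = A.deg e := by
  obtain ⟨f, hf, hfe⟩ := he
  have hc : ∀ a, A.coef ((A.coef f e)⁻¹ • A.degPart (A.deg e) f) a ≠ 0 →
      A.deg a = A.deg e ∧ A.coef f a ≠ 0 := by
    intro a ha
    rw [A.coef_smul] at ha
    exact A.coef_terms_ne.1 (right_ne_zero_of_mul ha)
  have h1 : A.coef ((A.coef f e)⁻¹ • A.degPart (A.deg e) f) e = 1 := by
    rw [A.coef_smul, degPart, A.coef_terms_of (p := fun a => A.deg a = A.deg e) rfl, inv_mul_cancel₀ hfe.1]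
  exact ⟨_, A.smul_mem I _ (hI f hf _), ⟨by rw [h1]; exact one_ne_zero,
    fun a ha => hfe.2 a (hc a ha).2⟩, h1, fun a ha => (hc a ha).1⟩

lemma IsAdm.eq_zero_of_notMem {lt : M → M → Prop} (hlt : A.IsAdm lt) {I : Ideal R} {f : R}
    (hf : f ∈ I) (h : ∀ a, A.coef f a ≠ 0 → a ∉ leadingExps A.coef lt (I : Set R)) : f = 0 := by
  by_contra h0
  obtain ⟨e, he⟩ := hlt.exists_lead h0
  exact h e he.1 ⟨f, hf, he⟩

/-- For each minimal leading exponent `m`, the monomial at `m` is divided by homogeneous elements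
realising the minimal leading exponents. Monomial minus remainder lies in `I`, and on Exp(I) it
agrees with the monomial; this is the reduced element. -/
lemma IsAdm.exists_reduced {lt : M → M → Prop} (hlt : A.IsAdm lt) {I : Ideal R}
    (hI : A.IsHomIdeal I) : ∃ G, IsReducedStandardBasis A.coef lt (I : Set R) G := by
  classical
  obtain ⟨T, hT, hTb, hTm⟩ := A.exists_minimal_basis (leadingExps A.coef lt (I : Set R))
  choose! F hF hFl hF1 hFd using fun e he => exists_homogeneous_lead (A := A) (lt := lt) hI (e := e) he
  have hdiv : ∀ m ∈ T, ∃ g ∈ I, A.coef g m = 1 ∧ ∀ a, A.coef g a ≠ 0 → a ≠ m →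
      a ∉ leadingExps A.coef lt (I : Set R) := by
    intro m hm
    obtain ⟨q, hq, -⟩ := hlt.division T F id (fun i hi => hFl i (hT i hi))
      (fun i hi => hF1 i (hT i hi)) (fun i hi => hFd i (hT i hi)) (A.mon m)
    have hq' : ∀ a ∈ leadingExps A.coef lt (I : Set R),
        A.coef (∑ j ∈ T, q j * F j) a = A.coef (A.mon m) a := by
      intro a ha
      obtain ⟨a₀, h₀, d, rfl⟩ := hTb a ha
      have := hq a₀ h₀ d
      rw [A.coef_sub, sub_eq_zero] at this
      exact this.symm
    refine ⟨∑ j ∈ T, q j * F j, I.sum_mem fun j hj => I.mul_mem_left _ (hF j (hT j hj)), ?_, ?_⟩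
    · rw [hq' m (hT m hm), coef_mon, if_pos rfl]
    · intro a ha hne hmem
      rw [hq' a hmem, coef_mon, if_neg hne] at ha
      exact ha rfl
  choose! g hgI hg1 hgr using hdiv
  -- The leading exponent of an element of `I` lies in Exp(I), and `m` is the only exponent of `g m`
  -- there.
  have hgl : ∀ m ∈ T, IsLeadingExp A.coef lt (g m) m := by
    intro m hm
    have hne : g m ≠ 0 := by
      intro h
      have := hg1 m hm
      rw [h, A.coef_zero] at this
      exact zero_ne_one this
    obtain ⟨e, he⟩ := hlt.exists_lead hne
    by_cases hem : e = m
    · exact hem ▸ he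
    · exact absurd ⟨g m, hgI m hm, he⟩ (hgr m hm e he.1 hem)
  refine ⟨T.image g, ?_, ?_, ?_, ?_⟩
  · intro x hx
    obtain ⟨m, hm, rfl⟩ := Finset.mem_image.1 hx
    exact hgI m hm
  · ext a
    constructor
    · intro ha
      obtain ⟨m, hm, d, rfl⟩ := hTb a ha
      exact ⟨g m, Finset.mem_image_of_mem _ hm, m, hgl m hm, d, rfl⟩
    · rintro ⟨x, hx, e, he, d, rfl⟩
      obtain ⟨m, hm, rfl⟩ := Finset.mem_image.1 hx
      exact hlt.add_mem_leadingExps ⟨_, hgI m hm, he⟩ d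
  · intro x hx x' hx' e e' he he' ⟨d, hd⟩
    obtain ⟨m, hm, rfl⟩ := Finset.mem_image.1 hx
    obtain ⟨m', hm', rfl⟩ := Finset.mem_image.1 hx'
    rw [hlt.lead_unique he (hgl m hm), hlt.lead_unique he' (hgl m' hm')] at hd
    rw [hTm m hm m' (hT m' hm') d hd]
  · intro x hx
    obtain ⟨m, hm, rfl⟩ := Finset.mem_image.1 hx
    exact ⟨m, hgl m hm, hg1 m hm, hgr m hm⟩

lemma IsAdm.reduced_subset {lt : M → M → Prop} (hlt : A.IsAdm lt) {I : Ideal R} {G G' : Finset R}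
    (h : IsReducedStandardBasis A.coef lt (I : Set R) G)
    (h' : IsReducedStandardBasis A.coef lt (I : Set R) G') : G ⊆ G' := by
  intro g hg
  obtain ⟨e, he, he1, her⟩ := h.unitary_reduced g hg
  have hmem : e ∈ leadingExps A.coef lt (I : Set R) := ⟨g, h.subset g hg, he⟩
  rw [h'.standard] at hmem
  obtain ⟨g', hg', e', he', d', rfl⟩ := hmem
  have hmem' : e' ∈ leadingExps A.coef lt (I : Set R) := ⟨g', h'.subset g' hg', he'⟩
  rw [h.standard] at hmem'
  obtain ⟨g₂, hg₂, e₂, he₂, d₂, rfl⟩ := hmem'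
  -- Passing from `G` to `G'` and back gives an element of `G` whose leading exponent divides that
  -- of `g`. By minimality it is `g`, so both cofactors vanish and `g`, `g'` have the same leading
  -- exponent.
  have h2 := h.minimal g hg g₂ hg₂ _ _ he he₂ ⟨d₂ + d', by rw [add_assoc]⟩
  subst h2
  have h3 := hlt.lead_unique he he₂
  rw [add_assoc, add_eq_left] at h3
  have h4 := A.pos _ _ h3
  subst h4
  rw [add_zero] at h3 he he1 her
  subst h3
  rw [add_zero] at he he1 her he'
  obtain ⟨e'', he'', he1', her'⟩ := h'.unitary_reduced g' hg'
  have h5 := hlt.lead_unique he'' he'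
  subst h5
  -- The leading terms cancel, and all remaining exponents of `g` and `g'` avoid Exp(I); an element
  -- of `I` with this property is zero.
  have : g - g' = 0 := by
    refine hlt.eq_zero_of_notMem (I := I) (I.sub_mem (h.subset g hg) (h'.subset g' hg')) ?_
    intro a ha
    rw [A.coef_sub] at ha
    have hae : a ≠ e'' := by
      rintro rfl
      rw [he1, he1', sub_self] at ha
      exact ha rfl
    by_cases hga : A.coef g a = 0
    · refine her' a (fun h0 => ha ?_) hae
      rw [hga, h0, sub_self]
    · exact her a hga hae
  rw [sub_eq_zero.1 this]
  exact hg'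

lemma IsAdm.exists_unique_reduced {lt : M → M → Prop} (hlt : A.IsAdm lt) {I : Ideal R}
    (hI : A.IsHomIdeal I) : ∃ G, ∀ G', IsReducedStandardBasis A.coef lt (I : Set R) G' ↔ G' = G := by
  obtain ⟨G, hG⟩ := hlt.exists_reduced hI
  exact ⟨G, fun G' => ⟨fun h => (hlt.reduced_subset h hG).antisymm (hlt.reduced_subset hG h),
    fun h => h ▸ hG⟩⟩

/-- The elements of a reduced standard basis are homogeneous. -/
lemma IsAdm.homogeneous_of_reduced {lt : M → M → Prop} (hlt : A.IsAdm lt) {I : Ideal R}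
    (hI : A.IsHomIdeal I) {G : Finset R} (hG : IsReducedStandardBasis A.coef lt (I : Set R) G)
    {g : R} (hg : g ∈ G) {e : M} (he : IsLeadingExp A.coef lt g e) {a : M}
    (ha : A.coef g a ≠ 0) : A.deg a = A.deg e := by
  by_contra hne
  obtain ⟨e', he', -, her⟩ := hG.unitary_reduced g hg
  obtain rfl := hlt.lead_unique he he'
  -- This part lies in `I` and misses the leading exponent, so none of its exponents is in Exp(I).
  have hz : A.degPart (A.deg a) g = 0 := by
    refine hlt.eq_zero_of_notMem (hI g (hG.subset g hg) _) fun b hb => ?_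
    obtain ⟨h1, h2⟩ := A.coef_terms_ne.1 hb
    refine her b h2 ?_
    rintro rfl
    exact hne h1.symm
  have := A.coef_terms_of (p := fun b => A.deg b = A.deg a) rfl g
  rw [← degPart, hz, A.coef_zero] at this
  exact ha this.symm

/-! ### Comparison of the initial ideals for two weights -/

/-- Dividing `f ∈ I` by `G` leaves no remainder, and no product `q g * g` exceeds the top weight of
`f`. Taking top components expresses the initial form of `f` by graded products with the initial
forms of the elements of `G`, and both the products and these forms are common to `φ` and `φ'`. -/
lemma IsLocalWeight.inSpan_le {φ φ' : M → ℝ} (hφ : A.IsLocalWeight φ) (hφ' : A.IsLocalWeight φ')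
    (hs : A.SameWeight φ φ') {lt : M → M → Prop} (hlt : A.IsBase lt)
    {I : Ideal R} {G : Finset R} (e : R → M) (hGI : ∀ g ∈ G, g ∈ I)
    (hlead : ∀ g ∈ G, IsLeadingExp A.coef (A.ord φ lt) g (e g))
    (hone : ∀ g ∈ G, A.coef g (e g) = 1)
    (hhom : ∀ g ∈ G, ∀ a, A.coef g a ≠ 0 → A.deg a = A.deg (e g))
    (hrem : ∀ f ∈ I, (∀ g ∈ G, ∀ d, A.coef f (e g + d) = 0) → f = 0)
    (hin : ∀ g ∈ G, A.init φ g = A.init φ' g) : A.inSpan φ I ≤ A.inSpan φ' I := by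
  refine Submodule.span_le.2 ?_
  rintro _ ⟨f, hf, rfl⟩
  by_cases h0 : f = 0
  · rw [h0, init_zero]; exact zero_mem _
  obtain ⟨t, ht, htop⟩ := hφ.exists_top h0
  have htopg : ∀ g ∈ G, A.IsTop φ g (e g) := by
    intro g hg b hb
    by_cases hbe : b = e g
    · rw [hbe]
    · rcases (hlead g hg).2 b hb hbe with h | ⟨-, h | ⟨h, -⟩⟩
      · exact absurd (hhom g hg b hb) h.ne
      · exact h.le
      · exact h.le
  obtain ⟨q, hq, hqp⟩ := (hlt.ord hφ).division G id e hlead hone hhom f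
  have hfq : f = ∑ g ∈ G, q g * g := by
    rw [← sub_eq_zero]
    exact hrem _ (I.sub_mem hf (I.sum_mem fun g hg => I.mul_mem_left _ (hGI g hg))) hq
  have hqw : ∀ g ∈ G, A.WtLE φ (q g) (φ t - φ (e g)) := by
    intro g hg d hd
    -- The bound on weights passes through the division, since each step moves down for `A.ord φ lt`
    -- inside one degree.
    have := hqp (fun b => φ b ≤ φ t) htop (fun b' b h1 h2 h3 => by
      rcases h3 with h | ⟨-, h | ⟨h, -⟩⟩
      · omega
      · exact h.le.trans h1
      · exact h.le.trans h1) g hg d hd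
    rw [hφ.add] at this
    linarith
  rw [SetLike.mem_coe, init_eq_comp ht htop, hfq, comp, terms_sum]
  refine sum_mem fun g hg => ?_
  have hg0 : A.coef g (e g) ≠ 0 := by rw [hone g hg]; exact one_ne_zero
  have h1 := hφ.comp_mul (hqw g hg) (htopg g hg)
  rw [sub_add_cancel, ← init_eq_comp hg0 (htopg g hg), hs.grMul_eq, hin g hg] at h1
  rw [← comp, h1]
  exact hφ'.grMul_mem (hs.finWt hφ hφ' (comp_isHom φ _ _))
    (Submodule.subset_span ⟨g, hGI g hg, rfl⟩)

/-- The components of the elements of the initial ideal come from elements of the ideal. -/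
lemma IsLocalWeight.exists_comp_eq {φ : M → ℝ} (hφ : A.IsLocalWeight φ) {I : Ideal R} {F : R}
    (hF : F ∈ A.inSpan φ I) (d : ℝ) :
    ∃ f ∈ I, A.WtLE φ f d ∧ A.comp φ d F = A.comp φ d f := by
  have hzero : A.WtLE φ (0 : R) d := fun a ha => absurd (A.coef_zero a) ha
  induction hF using Submodule.span_induction with
  | mem x hx =>
    obtain ⟨f, hf, rfl⟩ := hx
    by_cases hf0 : f = 0
    · exact ⟨0, I.zero_mem, hzero, by rw [hf0, init_zero]⟩
    obtain ⟨t, ht, htop⟩ := hφ.exists_top hf0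
    by_cases hd : φ t = d
    · subst hd
      exact ⟨f, hf, htop, by rw [init_eq_comp ht htop, comp_eq_self (comp_isHom φ _ f)]⟩
    · refine ⟨0, I.zero_mem, hzero, ?_⟩
      rw [init_eq_comp ht htop]
      refine A.ext _ _ fun a => ?_
      by_cases ha : φ a = d
      · rw [comp, A.coef_terms_of ha, comp, A.coef_terms_of_not (fun h => hd (by rw [← h, ha])),
          comp, A.terms_zero, A.coef_zero]
      · rw [comp, A.coef_terms_of_not ha, comp, A.coef_terms_of_not ha]
  | zero => exact ⟨0, I.zero_mem, hzero, rfl⟩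
  | add x y _ _ hx hy =>
    obtain ⟨f, hf, hfd, hfx⟩ := hx
    obtain ⟨g, hg, hgd, hgy⟩ := hy
    refine ⟨f + g, I.add_mem hf hg, fun a ha => ?_, ?_⟩
    · by_cases h : A.coef f a = 0
      · rw [A.coef_add, h, zero_add] at ha
        exact hgd a ha
      · exact hfd a h
    · simp only [comp] at *
      rw [A.terms_add, A.terms_add, hfx, hgy]
  | smul r x _ hx =>
    obtain ⟨f, hf, hfd, hfx⟩ := hx
    refine ⟨r • f, A.smul_mem I r hf, fun a ha => ?_, ?_⟩
    · rw [A.coef_smul] at ha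
      exact hfd a (right_ne_zero_of_mul ha)
    · simp only [comp] at *
      rw [A.terms_smul, A.terms_smul, hfx]

/-- Every nonzero element of the initial ideal has a leading exponent of `I` in its support. -/
lemma IsLocalWeight.exists_mem_leadingExps {φ : M → ℝ} (hφ : A.IsLocalWeight φ)
    {lt : M → M → Prop} (hlt : A.IsBase lt) {I : Ideal R} (hI : A.IsHomIdeal I) {F : R}
    (hF : F ∈ A.inSpan φ I) (h0 : F ≠ 0) :
    ∃ e, A.coef F e ≠ 0 ∧ e ∈ leadingExps A.coef (A.ord φ lt) (I : Set R) := by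
  obtain ⟨a, ha⟩ := A.exists_coef_ne_zero h0
  obtain ⟨f, hf, hfd, hfF⟩ := hφ.exists_comp_eq hF (φ a)
  have hco : ∀ b, φ b = φ a → A.coef f b = A.coef F b := fun b hb => by
    have := congrArg (A.coef · b) hfF
    simp only [comp] at this
    rwa [A.coef_terms_of hb, A.coef_terms_of hb, eq_comm] at this
  -- The order compares degrees first, so the leading exponent of `f` itself might have another
  -- degree and a smaller weight. Inside the degree of `a` this cannot happen.
  set f' := A.degPart (A.deg a) f with hf'
  have hf'a : A.coef f' a ≠ 0 := by
    rw [hf', degPart, A.coef_terms_of (p := fun b => A.deg b = A.deg a) rfl, hco a rfl]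
    exact ha
  have hf'0 : f' ≠ 0 := by
    intro h
    rw [h, A.coef_zero] at hf'a
    exact hf'a rfl
  obtain ⟨e, he⟩ := (hlt.ord hφ).exists_lead hf'0
  obtain ⟨hed, hef⟩ := A.coef_terms_ne.1 he.1
  have hea : φ e = φ a := by
    refine (hfd e hef).antisymm ?_
    by_cases hae : a = e
    · rw [hae]
    · rcases he.2 a hf'a hae with h | ⟨-, h | ⟨h, -⟩⟩
      · exact absurd hed h.ne'
      · exact h.le
      · exact h.le
  exact ⟨e, by rw [← hco e hea]; exact hef, f', hI f hf _, he⟩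

/-- The initial ideals for two weights agree if and only if the initial forms of the elements of the
reduced standard basis do. -/
theorem IsLocalWeight.inSpan_eq_iff {φ φ' : M → ℝ} (hφ : A.IsLocalWeight φ)
    (hφ' : A.IsLocalWeight φ') (hs : A.SameWeight φ φ') {lt : M → M → Prop} (hlt : A.IsBase lt)
    {I : Ideal R} (hI : A.IsHomIdeal I) {G : Finset R}
    (hG : IsReducedStandardBasis A.coef (A.ord φ lt) (I : Set R) G) :
    A.inSpan φ I = A.inSpan φ' I ↔ ∀ g ∈ G, A.init φ g = A.init φ' g := by
  have hadm := hlt.ord hφ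
  choose! e hlead hone hred using hG.unitary_reduced
  have hhom : ∀ g ∈ G, ∀ a, A.coef g a ≠ 0 → A.deg a = A.deg (e g) :=
    fun g hg a ha => hadm.homogeneous_of_reduced hI hG hg (hlead g hg) ha
  have htop : ∀ g ∈ G, A.IsTop φ g (e g) := by
    intro g hg b hb
    by_cases hbe : b = e g
    · rw [hbe]
    · rcases (hlead g hg).2 b hb hbe with h | ⟨-, h | ⟨h, -⟩⟩
      · exact absurd (hhom g hg b hb) h.ne
      · exact h.le
      · exact h.le
  constructor
  · intro heq g hg
    have hg0 : g ≠ 0 := by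
      rintro rfl
      have := hone 0 hg
      rw [A.coef_zero] at this
      exact zero_ne_one this
    -- Such an `F` has an exponent in Exp(I), and the only exponent of `g` in Exp(I) is `e g`.
    have hunique : ∀ F ∈ A.inSpan φ I, (∀ a, A.coef F a ≠ 0 → A.coef g a ≠ 0) → F ≠ 0 →
        A.coef F (e g) ≠ 0 := by
      intro F hF hsub h0
      obtain ⟨b, hb, hbI⟩ := hφ.exists_mem_leadingExps hlt hI hF h0
      by_cases hbe : b = e g
      · exact hbe ▸ hb
      · exact absurd hbI (hred g hg b (hsub b hb) hbe)
    have hmem : A.init φ g ∈ A.inSpan φ I := Submodule.subset_span ⟨g, hG.subset g hg, rfl⟩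
    have hmem' : A.init φ' g ∈ A.inSpan φ I := by
      rw [heq]; exact Submodule.subset_span ⟨g, hG.subset g hg, rfl⟩
    have hsub : ∀ (ψ : M → ℝ) a, A.coef (A.init ψ g) a ≠ 0 → A.coef g a ≠ 0 :=
      fun ψ a ha => (A.coef_terms_ne.1 ha).2
    have h1 : A.coef (A.init φ g) (e g) = A.coef g (e g) := A.coef_terms_of (htop g hg) g
    have h2 : A.coef (A.init φ' g) (e g) = A.coef g (e g) :=
      A.coef_terms_of (A.coef_terms_ne.1 (hunique _ hmem' (hsub φ') (hφ'.init_ne_zero hg0))).1 g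
    by_contra hne
    -- Both initial forms contain the leading term of `g`, so their difference has coefficient zero
    -- at `e g`.
    refine hunique (A.init φ g - A.init φ' g) (sub_mem hmem hmem') (fun a ha hga => ha ?_)
      (sub_ne_zero.2 hne) ?_
    · have h3 : ∀ ψ, A.coef (A.init ψ g) a = 0 := fun ψ => by
        by_contra h
        exact hsub ψ a h hga
      rw [A.coef_sub, h3, h3, sub_self]
    · rw [A.coef_sub, h1, h2, sub_self]
  · intro hin
    -- This criterion mentions the exponents `e g` but no order, so it serves for both inclusions.
    have hrem : ∀ f ∈ I, (∀ g ∈ G, ∀ d, A.coef f (e g + d) = 0) → f = 0 := by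
      intro f hf h
      refine hadm.eq_zero_of_notMem hf fun a ha hmem => ?_
      rw [hG.standard] at hmem
      obtain ⟨g, hg, e', he', d, rfl⟩ := hmem
      rw [hadm.lead_unique he' (hlead g hg)] at ha
      exact ha (h g hg d)
    -- Exponents tied with `e g` for `φ'` are also tied for `φ`, because the initial forms agree;
    -- for both orders the tie is then broken by the same `lt`.
    have hlead' : ∀ g ∈ G, IsLeadingExp A.coef (A.ord φ' lt) g (e g) := by
      intro g hg
      refine ⟨(hlead g hg).1, fun a ha hne => Or.inr ⟨hhom g hg a ha, ?_⟩⟩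
      have htop' : A.IsTop φ' g (e g) := by
        have h1 : A.coef (A.init φ g) (e g) = A.coef g (e g) := A.coef_terms_of (htop g hg) g
        rw [hin g hg] at h1
        exact (A.coef_terms_ne.1 (h1.trans_ne (hlead g hg).1)).1
      by_cases hat : A.IsTop φ' g a
      · have hat' : A.IsTop φ g a := by
          have h1 : A.coef (A.init φ' g) a = A.coef g a := A.coef_terms_of hat g
          rw [← hin g hg] at h1
          exact (A.coef_terms_ne.1 (h1.trans_ne ha)).1
        have e1 := (htop g hg a ha).antisymm (hat' _ (hlead g hg).1)
        have e2 := (htop' a ha).antisymm (hat _ (hlead g hg).1)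
        rcases (hlead g hg).2 a ha hne with h | ⟨-, h | ⟨-, h⟩⟩
        · exact absurd (hhom g hg a ha) h.ne
        · exact absurd e1 h.ne
        · exact Or.inr ⟨e2, h⟩
      · left
        unfold IsTop at hat
        push Not at hat
        obtain ⟨b, hb, hab⟩ := hat
        exact hab.trans_le (htop' b hb)
    exact (hφ.inSpan_le hφ' hs hlt e hG.subset hlead hone hhom hrem hin).antisymm
      (hφ'.inSpan_le hφ hs.symm hlt e hG.subset hlead' hone hhom hrem
        fun g hg => (hin g hg).symm)

end CoefRing

/-! ### Newton polyhedra, normal cones and initial forms. -/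

namespace CoefRing

variable {k R M : Type*} [Field k] [Ring R] [Module k R] [AddCommMonoid M] [IsCancelAdd M]
  {A : CoefRing k R M}

lemma init_eq_init_iff {φ φ' : M → ℝ} {f : R} :
    A.init φ f = A.init φ' f ↔ ∀ a, A.coef f a ≠ 0 → (A.IsTop φ f a ↔ A.IsTop φ' f a) := by
  classical
  constructor
  · intro h a ha
    have key : ∀ ψ : M → ℝ, A.IsTop ψ f a ↔ A.coef (A.init ψ f) a ≠ 0 := fun ψ =>
      ⟨fun h => A.coef_terms_ne.2 ⟨h, ha⟩, fun h => (A.coef_terms_ne.1 h).1⟩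
    rw [key, key, h]
  · intro h
    refine A.ext _ _ fun a => ?_
    by_cases ha : A.coef f a = 0
    · simp [init, coef_terms, ha]
    · simp only [init, coef_terms]
      exact if_congr (h a ha) rfl rfl

variable {ι κ : Type*} [Fintype ι]

variable (A) in
/-- An embedding of the exponents into `ℤ^ι`, with the cone of weights `W` dual to the cone generated
by the integral vectors `γ j`, which contains a set `N` of translations. -/
structure WeightSpace (pt : M → ι → ℝ) (N : Set (ι → ℝ)) (W : Set (ι → ℝ)) [Fintype κ]
    (γ : κ → ι → ℤ) : Prop where
  pt_add : ∀ a b, pt (a + b) = pt a + pt b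
  pt_int : ∃ z : M → ι → ℤ, ∀ a, pt a = fun i => (z a i : ℝ)
  zero_mem : 0 ∈ N
  pt_mem : ∀ d, A.deg d = 0 → pt d ∈ N
  pt_K : ∀ a x b, A.K a x b ≠ 0 → ∃ z ∈ N, pt b = pt a + pt x + z
  mem_W : ∀ w, w ∈ W ↔ ∀ j, w ⬝ᵥ (fun i => (γ j i : ℝ)) ≤ 0
  γ_mem : ∀ j, (fun i => (γ j i : ℝ)) ∈ N
  N_eq : ∀ z ∈ N, ∃ c : κ → ℝ, (∀ j, 0 ≤ c j) ∧ z = ∑ j, c j • fun i => (γ j i : ℝ)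

/-- The two weights vanish on the same generators. -/
def SameZeros (γ : κ → ι → ℤ) (w w' : ι → ℝ) : Prop :=
  ∀ j, w ⬝ᵥ (fun i => (γ j i : ℝ)) = 0 ↔ w' ⬝ᵥ (fun i => (γ j i : ℝ)) = 0

lemma SameZeros.symm {γ : κ → ι → ℤ} {w w' : ι → ℝ} (h : SameZeros γ w w') : SameZeros γ w' w :=
  fun j => (h j).symm

/-- The generators of the Newton polyhedron of `g`. -/
def newtonPoints (A : CoefRing k R M) (pt : M → ι → ℝ) (N : Set (ι → ℝ)) (g : R) :
    Set (ι → ℝ) :=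
  {x | ∃ a, ∃ z ∈ N, A.coef g a ≠ 0 ∧ x = pt a + z}

lemma isTop_iff {pt : M → ι → ℝ} {w : ι → ℝ} {g : R} {e : M}
    (he : A.coef g e ≠ 0) (ht : A.IsTop (fun a => w ⬝ᵥ pt a) g e) {z : M → ι → ℤ}
    (hz : ∀ a, pt a = fun i => (z a i : ℝ)) {c : M} (hc : A.coef g c ≠ 0) :
    w ⬝ᵥ (fun i => ((z c - z e) i : ℝ)) ≤ 0 ∧
      (w ⬝ᵥ (fun i => ((z c - z e) i : ℝ)) = 0 ↔ A.IsTop (fun a => w ⬝ᵥ pt a) g c) := by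
  have hd : (fun i => ((z c - z e) i : ℝ)) = pt c - pt e := by
    rw [hz, hz]; ext i; simp
  rw [hd, dotProduct_sub]
  have h1 := ht c hc
  dsimp only at h1
  refine ⟨by linarith, fun h b hb => ?_, fun h => ?_⟩
  · have h2 := ht b hb
    dsimp only at h2 ⊢
    linarith
  · have h2 := h e he
    dsimp only at h2
    linarith

namespace WeightSpace

variable [Fintype κ] {pt : M → ι → ℝ} {N W : Set (ι → ℝ)} {γ : κ → ι → ℤ}

lemma dotProduct_nonpos (H : A.WeightSpace pt N W γ) {w z : ι → ℝ} (hw : w ∈ W) (hz : z ∈ N) :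
    w ⬝ᵥ z ≤ 0 := by
  obtain ⟨c, hc, rfl⟩ := H.N_eq z hz
  rw [dotProduct_sum]
  refine Finset.sum_nonpos fun j _ => ?_
  rw [dotProduct_smul, smul_eq_mul]
  exact mul_nonpos_of_nonneg_of_nonpos (hc j) ((H.mem_W w).1 hw j)

/-- A nonnegative combination of generators, on each of which `w` is nonpositive, vanishes only if
every term does. Hence only the set of generators killed by `w` matters. -/
lemma dotProduct_eq_zero (H : A.WeightSpace pt N W γ) {w w' z : ι → ℝ} (hw : w ∈ W)
    (hs : SameZeros γ w w') (hz : z ∈ N) (h0 : w ⬝ᵥ z = 0) : w' ⬝ᵥ z = 0 := by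
  obtain ⟨c, hc, rfl⟩ := H.N_eq z hz
  simp only [dotProduct_sum, dotProduct_smul, smul_eq_mul] at h0 ⊢
  rw [Finset.sum_eq_zero_iff_of_nonpos] at h0
  · refine Finset.sum_eq_zero fun j hj => ?_
    rcases mul_eq_zero.1 (h0 j hj) with h | h
    · rw [h, zero_mul]
    · rw [(hs j).1 h, mul_zero]
  · exact fun j _ => mul_nonpos_of_nonneg_of_nonpos (hc j) ((H.mem_W w).1 hw j)

lemma isLocalWeight (H : A.WeightSpace pt N W γ) {w : ι → ℝ} (hw : w ∈ W) :
    A.IsLocalWeight fun a => w ⬝ᵥ pt a where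
  add a b := by rw [H.pt_add, dotProduct_add]
  K a x b h := by
    obtain ⟨z, hz, hb⟩ := H.pt_K a x b h
    rw [hb, dotProduct_add, dotProduct_add]
    linarith [H.dotProduct_nonpos hw hz]
  neg d hd := H.dotProduct_nonpos hw (H.pt_mem d hd)

lemma sameWeight (H : A.WeightSpace pt N W γ) {w w' : ι → ℝ} (hw : w ∈ W) (hw' : w' ∈ W)
    (hs : SameZeros γ w w') : A.SameWeight (fun a => w ⬝ᵥ pt a) fun a => w' ⬝ᵥ pt a where
  zero d hd := ⟨H.dotProduct_eq_zero hw hs (H.pt_mem d hd),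
    H.dotProduct_eq_zero hw' hs.symm (H.pt_mem d hd)⟩
  K a x b h := by
    obtain ⟨z, hz, hb⟩ := H.pt_K a x b h
    simp only [hb, dotProduct_add, add_eq_left]
    exact ⟨H.dotProduct_eq_zero hw hs hz, H.dotProduct_eq_zero hw' hs.symm hz⟩

/-- The exponent and the translation can be maximised separately: the weight of a translation is at
most zero, and zero is attained since `0 ∈ N`. -/
lemma mem_maxPoints (H : A.WeightSpace pt N W γ) {w z : ι → ℝ} (hw : w ∈ W) {g : R} {a : M}
    (ha : A.coef g a ≠ 0) (hz : z ∈ N) :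
    pt a + z ∈ maxPoints w (A.newtonPoints pt N g) ↔
      A.IsTop (fun a => w ⬝ᵥ pt a) g a ∧ w ⬝ᵥ z = 0 := by
  constructor
  · rintro ⟨-, h⟩
    have hz0 := H.dotProduct_nonpos hw hz
    constructor
    · intro b hb
      have := h (pt b + 0) ⟨b, 0, H.zero_mem, hb, rfl⟩
      rw [dotProduct_add, dotProduct_add, dotProduct_zero] at this
      linarith
    · have := h (pt a + 0) ⟨a, 0, H.zero_mem, ha, rfl⟩
      rw [dotProduct_add, dotProduct_add, dotProduct_zero] at this
      linarith
  · rintro ⟨h, h0⟩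
    refine ⟨⟨a, z, hz, ha, rfl⟩, ?_⟩
    rintro _ ⟨b, z', hz', hb, rfl⟩
    rw [dotProduct_add, dotProduct_add, h0]
    have := h b hb
    have := H.dotProduct_nonpos hw hz'
    dsimp only at *
    linarith

lemma maxPoints_nonempty (H : A.WeightSpace pt N W γ) {w : ι → ℝ} (hw : w ∈ W) {g : R}
    (hg : g ≠ 0) : (maxPoints w (A.newtonPoints pt N g)).Nonempty := by
  obtain ⟨a, ha, ht⟩ := (H.isLocalWeight hw).exists_top hg
  exact ⟨_, (H.mem_maxPoints hw ha H.zero_mem).2 ⟨ht, dotProduct_zero w⟩⟩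

/-- The normal cone of a face of the Newton polyhedron of `G`, in terms of initial forms. -/
theorem normalCone_eq (H : A.WeightSpace pt N W γ) {w : ι → ℝ} (hw : w ∈ W) {G : Finset R}
    (hG : G.Nonempty) (hG0 : ∀ g ∈ G, g ≠ 0) :
    normalCone W (∑ g ∈ G, convexHull ℝ (A.newtonPoints pt N g))
      (face w (∑ g ∈ G, convexHull ℝ (A.newtonPoints pt N g))) =
    {w' | w' ∈ W ∧ SameZeros γ w w' ∧
      ∀ g ∈ G, A.init (fun a => w ⬝ᵥ pt a) g = A.init (fun a => w' ⬝ᵥ pt a) g} := by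
  ext w'
  refine and_congr_right fun hw' => ?_
  have hne : ∀ u ∈ W, ∀ g ∈ G, (face u (convexHull ℝ (A.newtonPoints pt N g))).Nonempty := by
    intro u hu g hg
    obtain ⟨x, hx⟩ := H.maxPoints_nonempty hu (hG0 g hg)
    exact ⟨x, (mem_face_convexHull hx.1).2 hx⟩
  rw [face_sum_eq_iff (hne w hw) (hne w' hw')]
  constructor
  · intro h
    have hmax : ∀ g ∈ G, maxPoints w (A.newtonPoints pt N g) =
        maxPoints w' (A.newtonPoints pt N g) := by
      intro g hg
      ext x
      constructor
      · intro hx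
        rwa [← mem_face_convexHull hx.1, h g hg, mem_face_convexHull hx.1]
      · intro hx
        rwa [← mem_face_convexHull hx.1, ← h g hg, mem_face_convexHull hx.1]
    constructor
    -- Translating a top exponent by `γ j` gives a maximal point exactly when the weight vanishes on
    -- `γ j`, so the face determines these zeros. A nonempty `G` is essential: an empty Minkowski
    -- sum is a point and sees no `γ j`.
    · obtain ⟨g, hg⟩ := hG
      obtain ⟨a, ha, ht⟩ := (H.isLocalWeight hw).exists_top (hG0 g hg)
      intro j
      have h1 := H.mem_maxPoints hw ha (H.γ_mem j)
      have ht' := (H.mem_maxPoints hw ha H.zero_mem).2 ⟨ht, dotProduct_zero w⟩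
      rw [hmax g hg] at h1 ht'
      rw [H.mem_maxPoints hw' ha H.zero_mem] at ht'
      rw [H.mem_maxPoints hw' ha (H.γ_mem j)] at h1
      exact ⟨fun h0 => (h1.2 ⟨ht, h0⟩).2, fun h0 => (h1.1 ⟨ht'.1, h0⟩).2⟩
    · intro g hg
      refine init_eq_init_iff.2 fun a ha => ?_
      have h1 := H.mem_maxPoints hw ha H.zero_mem
      rw [hmax g hg, H.mem_maxPoints hw' ha H.zero_mem, dotProduct_zero, dotProduct_zero] at h1
      simpa using h1.symm
  · rintro ⟨hs, hin⟩ g hg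
    refine (face_congr_of_maxPoints (H.maxPoints_nonempty hw (hG0 g hg)) ?_).symm
    have hiff := init_eq_init_iff.1 (hin g hg)
    ext x
    constructor
    · intro hx
      obtain ⟨a, z, hz, ha, rfl⟩ := hx.1
      rw [H.mem_maxPoints hw ha hz] at hx
      exact (H.mem_maxPoints hw' ha hz).2
        ⟨(hiff a ha).1 hx.1, H.dotProduct_eq_zero hw hs hz hx.2⟩
    · intro hx
      obtain ⟨a, z, hz, ha, rfl⟩ := hx.1
      rw [H.mem_maxPoints hw' ha hz] at hx
      exact (H.mem_maxPoints hw ha hz).2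
        ⟨(hiff a ha).2 hx.1, H.dotProduct_eq_zero hw' hs.symm hz hx.2⟩

/-- The weights with the same initial forms on a finite set form a relatively open rational cone. -/
theorem isRelOpenRationalCone (H : A.WeightSpace pt N W γ) {w : ι → ℝ} (hw : w ∈ W) {G : Finset R}
    (hG0 : ∀ g ∈ G, g ≠ 0) : IsRelOpenRationalCone
    {w' | w' ∈ W ∧ SameZeros γ w w' ∧
      ∀ g ∈ G, A.init (fun a => w ⬝ᵥ pt a) g = A.init (fun a => w' ⬝ᵥ pt a) g} := by
  classical
  obtain ⟨z, hz⟩ := H.pt_int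
  choose! e he het using fun g hg => (H.isLocalWeight hw).exists_top (hG0 g hg)
  choose D hD using A.bound
  -- Top and non-top exponents need separate finite bases, since adding an exponent of degree zero
  -- can turn a top exponent into a non-top one.
  choose F₁ hF₁ hF₁' using fun g => A.exists_finite_basis
    {a | A.coef g a ≠ 0 ∧ A.IsTop (fun a => w ⬝ᵥ pt a) g a} (D g) fun a ha => hD g a ha.1
  choose F₂ hF₂ hF₂' using fun g => A.exists_finite_basis
    {a | A.coef g a ≠ 0 ∧ ¬A.IsTop (fun a => w ⬝ᵥ pt a) g a} (D g) fun a ha => hD g a ha.1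
  have hF : ∀ g, ∀ c ∈ F₁ g ∪ F₂ g, A.coef g c ≠ 0 := by
    intro g c hc
    rcases Finset.mem_union.1 hc with h | h
    · exact (hF₁ g c h).1
    · exact (hF₂ g c h).1
  -- The signs on the `γ j` encode the weight space and the common zeros; the signs on the
  -- differences to the fixed top exponent `e g` encode the initial form of `g`.
  set V : Finset (ι → ℤ) := Finset.univ.image γ ∪
    G.biUnion fun g => (F₁ g ∪ F₂ g).image fun c => z c - z (e g) with hV
  have hγV : ∀ j, γ j ∈ V := fun j =>
    Finset.mem_union_left _ (Finset.mem_image_of_mem γ (Finset.mem_univ j))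
  have hcV : ∀ g ∈ G, ∀ c ∈ F₁ g ∪ F₂ g, z c - z (e g) ∈ V := fun g hg c hc =>
    Finset.mem_union_right _ (Finset.mem_biUnion.2 ⟨g, hg, Finset.mem_image_of_mem _ hc⟩)
  have hVc : ∀ b ∈ V, (∃ j, b = γ j) ∨ ∃ g ∈ G, ∃ c, A.coef g c ≠ 0 ∧ b = z c - z (e g) := by
    intro b hb
    rcases Finset.mem_union.1 hb with h | h
    · obtain ⟨j, -, rfl⟩ := Finset.mem_image.1 h
      exact Or.inl ⟨j, rfl⟩
    · obtain ⟨g, hg, h⟩ := Finset.mem_biUnion.1 h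
      obtain ⟨c, hc, rfl⟩ := Finset.mem_image.1 h
      exact Or.inr ⟨g, hg, c, hF g c hc, rfl⟩
  have hneg : ∀ b ∈ V, w ⬝ᵥ (fun i => (b i : ℝ)) ≤ 0 := by
    intro b hb
    rcases hVc b hb with ⟨j, rfl⟩ | ⟨g, hg, c, hc, rfl⟩
    · exact (H.mem_W w).1 hw j
    · exact (isTop_iff (he g hg) (het g hg) hz hc).1
  convert isRelOpenRationalCone_of_signs V w hneg using 1
  ext w'
  constructor
  · rintro ⟨hw', hs, hin⟩ b hb
    rcases hVc b hb with ⟨j, rfl⟩ | ⟨g, hg, c, hc, rfl⟩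
    · exact ⟨(hs j).1, fun h => ((H.mem_W w').1 hw' j).lt_of_ne fun h0 => h.ne ((hs j).2 h0)⟩
    · have hiff := init_eq_init_iff.1 (hin g hg)
      have het' := (hiff _ (he g hg)).1 (het g hg)
      have h1 := isTop_iff (he g hg) (het g hg) hz hc
      have h2 := isTop_iff (he g hg) het' hz hc
      exact ⟨fun h => h2.2.2 ((hiff c hc).1 (h1.2.1 h)),
        fun h => h2.1.lt_of_ne fun h0 => h.ne (h1.2.2 ((hiff c hc).2 (h2.2.1 h0)))⟩
  · intro h
    have hw' : w' ∈ W := (H.mem_W w').2 fun j => by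
      rcases ((H.mem_W w).1 hw j).lt_or_eq with h0 | h0
      · exact ((h _ (hγV j)).2 h0).le
      · exact ((h _ (hγV j)).1 h0).le
    have hs : SameZeros γ w w' := fun j => ⟨(h _ (hγV j)).1, fun h0 => by
      rcases ((H.mem_W w).1 hw j).lt_or_eq with h1 | h1
      · exact absurd h0 ((h _ (hγV j)).2 h1).ne
      · exact h1⟩
    refine ⟨hw', hs, fun g hg => init_eq_init_iff.2 ?_⟩
    have hsub : ∀ c, w' ⬝ᵥ (fun i => ((z c - z (e g)) i : ℝ)) = w' ⬝ᵥ pt c - w' ⬝ᵥ pt (e g) := by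
      intro c
      rw [← dotProduct_sub]
      congr 1
      rw [hz, hz]; ext i; simp
    -- A top exponent is a top basis exponent `c` plus some `d` of degree zero with `w`-weight zero.
    -- Then `d` also has `w'`-weight zero, and the condition at `c` suffices.
    have h1 : ∀ a, A.coef g a ≠ 0 → A.IsTop (fun a => w ⬝ᵥ pt a) g a →
        w' ⬝ᵥ pt a = w' ⬝ᵥ pt (e g) := by
      intro a ha hat
      obtain ⟨c, hc, d, hd, rfl⟩ := hF₁' g a ⟨ha, hat⟩
      obtain ⟨hc1, hc2⟩ := hF₁ g c hc
      have h3 : w ⬝ᵥ pt d = 0 := by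
        have := hat c hc1
        have := hc2 _ ha
        simp only [H.pt_add, dotProduct_add] at *
        linarith
      have h4 := (h _ (hcV g hg c (Finset.mem_union_left _ hc))).1
        ((isTop_iff (he g hg) (het g hg) hz hc1).2.2 hc2)
      rw [hsub] at h4
      rw [H.pt_add, dotProduct_add, H.dotProduct_eq_zero hw hs (H.pt_mem d hd) h3]
      linarith
    have h2 : ∀ a, A.coef g a ≠ 0 → ¬A.IsTop (fun a => w ⬝ᵥ pt a) g a →
        w' ⬝ᵥ pt a < w' ⬝ᵥ pt (e g) := by
      intro a ha hat
      obtain ⟨c, hc, d, hd, rfl⟩ := hF₂' g a ⟨ha, hat⟩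
      obtain ⟨hc1, hc2⟩ := hF₂ g c hc
      have h3 := isTop_iff (he g hg) (het g hg) hz hc1
      have h4 := (h _ (hcV g hg c (Finset.mem_union_right _ hc))).2
        (h3.1.lt_of_ne fun h0 => hc2 (h3.2.1 h0))
      rw [hsub] at h4
      rw [H.pt_add, dotProduct_add]
      linarith [H.dotProduct_nonpos hw' (H.pt_mem d hd)]
    have hle : ∀ a, A.coef g a ≠ 0 → w' ⬝ᵥ pt a ≤ w' ⬝ᵥ pt (e g) := fun a ha => by
      by_cases hat : A.IsTop (fun a => w ⬝ᵥ pt a) g a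
      · exact (h1 a ha hat).le
      · exact (h2 a ha hat).le
    intro a ha
    constructor
    · intro hat b hb
      dsimp only
      rw [h1 a ha hat]
      exact hle b hb
    · intro hat
      by_contra hat'
      exact absurd (hat _ (he g hg)) (not_le.2 (h2 a ha hat'))

end WeightSpace

end CoefRing

/-! ### Elements with finitely many weights. -/

namespace CoefRing

variable {k R M : Type*} [Field k] [Ring R] [Module k R] [AddCommMonoid M] [IsCancelAdd M]
  {A : CoefRing k R M}

/-- A direction of weight zero for `φ` only gives an infinite sum of multiples which is homogeneous
for `φ` only. -/
lemma exists_isHom_not_finWt {φ φ' : M → ℝ} (hφ : A.IsLocalWeight φ) (hφ' : A.IsLocalWeight φ')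
    {d : M} (hd : A.deg d = 0) (h : φ d = 0) (h' : φ' d ≠ 0) :
    ∃ f : R, A.IsHom φ f 0 ∧ ¬A.FinWt φ' f := by
  classical
  have hdeg : ∀ m : ℕ, A.deg (m • d) = 0 := by
    intro m
    induction m with
    | zero => rw [zero_smul, A.deg_zero]
    | succ m ih => rw [succ_nsmul, A.deg_add, ih, hd]
  have hwt : ∀ ψ : M → ℝ, A.IsLocalWeight ψ → ∀ m : ℕ, ψ (m • d) = m * ψ d := by
    intro ψ hψ m
    induction m with
    | zero => simpa using hψ.add 0 0
    | succ m ih => rw [succ_nsmul, hψ.add, ih]; push_cast; ring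
  have hc : ∀ a, A.coef (A.ofFun fun a => if ∃ m : ℕ, a = m • d then (1 : k) else 0) a =
      if ∃ m : ℕ, a = m • d then (1 : k) else 0 := by
    refine A.coef_ofFun ⟨0, fun a ha => ?_⟩
    by_cases hm : ∃ m : ℕ, a = m • d
    · obtain ⟨m, rfl⟩ := hm
      exact (hdeg m).le
    · simp [hm] at ha
  refine ⟨A.ofFun fun a => if ∃ m : ℕ, a = m • d then (1 : k) else 0, fun a ha => ?_, ?_⟩
  · rw [hc] at ha
    by_cases hm : ∃ m : ℕ, a = m • d
    · obtain ⟨m, rfl⟩ := hm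
      rw [hwt φ hφ, h, mul_zero]
    · simp [hm] at ha
  · rintro ⟨s, hs⟩
    have hinj : Function.Injective fun m : ℕ => φ' (m • d) := by
      intro m m' hmm
      simp only [hwt φ' hφ'] at hmm
      exact_mod_cast mul_right_cancel₀ h' hmm
    refine Set.infinite_of_injective_forall_mem hinj (s := (s : Set ℝ)) (fun m => ?_)
      s.finite_toSet
    refine hs _ ?_
    rw [hc, if_pos ⟨m, rfl⟩]
    exact one_ne_zero

lemma FinWt.add {φ : M → ℝ} {f g : R} (hf : A.FinWt φ f) (hg : A.FinWt φ g) :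
    A.FinWt φ (f + g) := by
  classical
  obtain ⟨s, hs⟩ := hf
  obtain ⟨t, ht⟩ := hg
  refine ⟨s ∪ t, fun a ha => ?_⟩
  by_cases h : A.coef f a = 0
  · rw [A.coef_add, h, zero_add] at ha
    exact Finset.mem_union_right _ (ht a ha)
  · exact Finset.mem_union_left _ (hs a h)

lemma FinWt.smul {φ : M → ℝ} (r : k) {f : R} (hf : A.FinWt φ f) : A.FinWt φ (r • f) := by
  obtain ⟨s, hs⟩ := hf
  refine ⟨s, fun a ha => hs a ?_⟩
  rw [A.coef_smul] at ha
  exact right_ne_zero_of_mul ha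

lemma IsHom.finWt {φ : M → ℝ} {f : R} {e : ℝ} (h : A.IsHom φ f e) : A.FinWt φ f :=
  ⟨{e}, fun a ha => Finset.mem_singleton.2 (h a ha)⟩

lemma IsLocalWeight.init_isHom {φ : M → ℝ} (hφ : A.IsLocalWeight φ) (f : R) :
    ∃ e, A.IsHom φ (A.init φ f) e := by
  by_cases hf : f = 0
  · exact ⟨0, fun a ha => absurd (by rw [hf, init_zero, A.coef_zero]) ha⟩
  · obtain ⟨a, ha, ht⟩ := hφ.exists_top hf
    exact ⟨φ a, by rw [init_eq_comp ha ht]; exact comp_isHom φ _ f⟩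

end CoefRing

/-! ### Power series as an instance of the general theory. -/

namespace Comm

variable {n : ℕ} {k : Type*} [Field k]

variable (n k) in
open Classical in
/-- Formal power series, as a ring of combinations of exponents. -/
def coefRing : CoefRing k (MvPowerSeries (Fin n) k) (Fin n →₀ ℕ) where
  coef := coef
  -- With the zero degree all supports are bounded, every ideal is homogeneous, and every exponent
  -- counts as one of degree zero.
  deg _ := 0
  K a x b := if a + x = b then 1 else 0
  S b := Finset.HasAntidiagonal.antidiagonal b
  coef_add f g a := map_add (MvPowerSeries.coeff a) f g
  coef_smul r f a := map_smul (MvPowerSeries.coeff a) r f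
  smul_mul r f g := smul_mul_assoc r f g
  ext f g h := MvPowerSeries.ext h
  bound f := ⟨0, fun _ _ => le_rfl⟩
  exists_coef c _ := ⟨c, fun _ => rfl⟩
  coef_mul f g b := by
    rw [coef, MvPowerSeries.coeff_mul]
    refine Finset.sum_congr rfl fun p hp => ?_
    rw [if_pos (Finset.HasAntidiagonal.mem_antidiagonal.1 hp), one_mul]
    rfl
  mem_S a x b h := by
    rw [Finset.HasAntidiagonal.mem_antidiagonal]
    by_contra h'
    simp [h'] at h
  K_add a b := if_pos rfl
  deg_add _ _ := rfl
  deg_K _ _ _ _ := rfl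
  pos a b h := (add_eq_zero.1 h).2
  wqo s := by
    obtain ⟨i, j, hij, h⟩ := wellQuasiOrdered_le s
    exact ⟨i, j, hij, s j - s i, (add_tsub_cancel_of_le h).symm⟩

lemma coefRing_K {a x b : Fin n →₀ ℕ} (h : (coefRing n k).K a x b ≠ 0) : b = a + x := by
  by_contra h'
  exact h (if_neg (Ne.symm h'))

lemma isBase {lt : (Fin n →₀ ℕ) → (Fin n →₀ ℕ) → Prop} (h : IsLocalOrder lt) :
    (coefRing n k).IsBase lt where
  irrefl := h.strictTotal.irrefl
  trans := h.strictTotal.trans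
  tri a b _ := by
    by_cases hab : lt a b
    · exact Or.inl hab
    · by_cases hba : lt b a
      · exact Or.inr (Or.inr hba)
      · exact Or.inr (Or.inl (h.strictTotal.trichotomous a b hab hba))
  add := h.add_left
  K _ _ _ hK := Or.inl (coefRing_K hK)
  neg d _ hd := h.lt_zero d hd

lemma ord_eq (φ : (Fin n →₀ ℕ) → ℝ) (lt : (Fin n →₀ ℕ) → (Fin n →₀ ℕ) → Prop) :
    (coefRing n k).ord φ lt = refine φ lt := by
  funext a b
  simp [CoefRing.ord, coefRing]

lemma isHomIdeal (I : Ideal (MvPowerSeries (Fin n) k)) : (coefRing n k).IsHomIdeal I := by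
  intro f hf D
  rcases eq_or_ne D 0 with rfl | hD
  · convert hf
    exact (coefRing n k).ext _ _ fun a => (coefRing n k).coef_terms_of (p := fun _ => 0 = 0) rfl f
  · convert I.zero_mem
    refine (coefRing n k).eq_zero fun a => (coefRing n k).coef_terms_of_not ?_ f
    exact hD.symm

/-- The generators of the cone dual to the local weights. -/
def generators (n : ℕ) (j : Fin n) : Fin n → ℤ := Pi.single j 1

lemma dotProduct_generators (w : Fin n → ℝ) (j : Fin n) :
    w ⬝ᵥ (fun i => (generators n j i : ℝ)) = w j := by
  simp [dotProduct, generators, Pi.single_apply]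

lemma pt_add (a b : Fin n →₀ ℕ) : pt (a + b) = pt a + pt b := by
  ext i; simp [pt]

lemma pt_zero : pt (0 : Fin n →₀ ℕ) = 0 := by
  ext i; simp [pt]

lemma pt_single (j : Fin n) : pt (Finsupp.single j 1) = fun i => (generators n j i : ℝ) := by
  ext i
  by_cases h : i = j
  · subst h; simp [pt, generators]
  · simp [pt, generators, Finsupp.single_eq_of_ne h, h]

variable (n k) in
lemma weightSpace :
    (coefRing n k).WeightSpace pt (Set.range (pt (n := n))) (Uloc n) (generators n) where
  pt_add := pt_add
  pt_int := ⟨fun a i => (a i : ℤ), fun a => by ext i; simp [pt]⟩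
  zero_mem := ⟨0, pt_zero⟩
  pt_mem d _ := ⟨d, rfl⟩
  pt_K a x b h := ⟨0, ⟨0, pt_zero⟩, by rw [coefRing_K h, pt_add, add_zero]⟩
  mem_W w := by simp only [dotProduct_generators]; rfl
  γ_mem j := ⟨_, pt_single j⟩
  N_eq := by
    rintro _ ⟨b, rfl⟩
    refine ⟨fun j => (b j : ℝ), fun j => Nat.cast_nonneg _, ?_⟩
    ext i
    simp [pt, generators, Finset.sum_apply, Pi.single_apply]

lemma initialForm_eq (u : Fin n → ℝ) (f : MvPowerSeries (Fin n) k) :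
    initialForm u f = (coefRing n k).init (wt u) f := by
  refine (coefRing n k).ext _ _ fun a => ?_
  rw [CoefRing.init, CoefRing.coef_terms]
  rfl

lemma isLocalWeight {u : Fin n → ℝ} (hu : u ∈ Uloc n) : (coefRing n k).IsLocalWeight (wt u) :=
  (weightSpace n k).isLocalWeight hu

lemma finWt_of_mem_gr {u : Fin n → ℝ} (hu : u ∈ Uloc n) {f : MvPowerSeries (Fin n) k}
    (hf : f ∈ gr k u) : (coefRing n k).FinWt (wt u) f := by
  classical
  have hφ := isLocalWeight (k := k) hu
  induction hf using Algebra.adjoin_induction with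
  | mem x hx =>
    obtain ⟨e, he⟩ := hx
    exact CoefRing.IsHom.finWt (e := e) he
  | algebraMap r =>
    refine ⟨{0}, fun a ha => Finset.mem_singleton.2 ?_⟩
    by_cases h : a = 0
    · subst h; simpa using hφ.add 0 0
    · refine absurd ?_ ha
      change MvPowerSeries.coeff a (algebraMap k (MvPowerSeries (Fin n) k) r) = 0
      rw [MvPowerSeries.algebraMap_apply, MvPowerSeries.coeff_C, if_neg h]
  | add x y _ _ hx hy => exact hx.add hy
  | mul x y _ _ hx hy =>
    obtain ⟨s, hs⟩ := hx
    obtain ⟨t, ht⟩ := hy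
    refine ⟨Finset.image₂ (· + ·) s t, fun a ha => ?_⟩
    rw [(coefRing n k).coef_mul] at ha
    obtain ⟨p, -, hp⟩ := Finset.exists_ne_zero_of_sum_ne_zero ha
    rw [coefRing_K (left_ne_zero_of_mul hp), hφ.add]
    exact Finset.mem_image₂_of_mem (hs _ (left_ne_zero_of_mul (right_ne_zero_of_mul hp)))
      (ht _ (right_ne_zero_of_mul (right_ne_zero_of_mul hp)))

lemma mem_gr_iff {u : Fin n → ℝ} (hu : u ∈ Uloc n) {f : MvPowerSeries (Fin n) k} :
    f ∈ gr k u ↔ (coefRing n k).FinWt (wt u) f := by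
  refine ⟨finWt_of_mem_gr hu, fun ⟨s, hs⟩ => ?_⟩
  rw [← CoefRing.sum_comp hs]
  exact sum_mem fun e _ => Algebra.subset_adjoin ⟨e, CoefRing.comp_isHom (A := coefRing n k) _ e f⟩

/-- If `u j = 0` and `u' j ≠ 0`, the geometric series in `x_j` is homogeneous for `u` but has
infinitely many `u'`-weights. So the underlying set of the graded ring determines which coordinates
vanish. -/
lemma gr_eq_iff {u u' : Fin n → ℝ} (hu : u ∈ Uloc n) (hu' : u' ∈ Uloc n) :
    gr k u = gr k u' ↔ CoefRing.SameZeros (generators n) u u' := by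
  have hwt : ∀ (w : Fin n → ℝ) j, wt w (Finsupp.single j 1) = w j := fun w j => by
    rw [wt, pt_single, dotProduct_generators]
  constructor
  · have key : ∀ u ∈ Uloc n, ∀ u' ∈ Uloc n, gr k u = gr k u' → ∀ j, u j = 0 → u' j = 0 := by
      intro u hu u' hu' h j hj
      by_contra hj'
      obtain ⟨f, hf, hf'⟩ := CoefRing.exists_isHom_not_finWt (isLocalWeight (k := k) hu)
        (isLocalWeight hu') (d := Finsupp.single j 1) rfl (by rw [hwt, hj]) (by rwa [hwt])
      exact hf' ((mem_gr_iff hu').1 (h ▸ (mem_gr_iff hu).2 hf.finWt))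
    intro h j
    rw [dotProduct_generators, dotProduct_generators]
    exact ⟨key u hu u' hu' h j, key u' hu' u hu h.symm j⟩
  · have key : ∀ u ∈ Uloc n, ∀ u' ∈ Uloc n, CoefRing.SameZeros (generators n) u u' →
        gr k u ≤ gr k u' := by
      intro u hu u' hu' h
      refine Algebra.adjoin_le ?_
      rintro f ⟨e, he⟩
      exact (mem_gr_iff hu').2 (((weightSpace n k).sameWeight hu hu' h).finWt
        (isLocalWeight hu) (isLocalWeight hu') (e := e) he)
    exact fun h => (key u hu u' hu' h).antisymm (key u' hu' u hu h.symm)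

lemma grMul_eq_mul {u : Fin n → ℝ} (hu : u ∈ Uloc n) (f g : MvPowerSeries (Fin n) k) :
    (coefRing n k).grMul (wt u) f g = f * g := by
  refine (coefRing n k).ext _ _ fun b => ?_
  rw [CoefRing.coef_grMul, (coefRing n k).coef_mul]
  refine Finset.sum_congr rfl fun p _ => ?_
  by_cases hK : (coefRing n k).K p.1 p.2 b = 0
  · simp [hK]
  · rw [if_pos]
    rw [coefRing_K hK, (isLocalWeight (k := k) hu).add]

/-- The graded product is here the ordinary product, so the span of the initial forms is stable
under `gr k u` and equals the ideal they generate. -/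
lemma image_initialIdeal {u : Fin n → ℝ} (hu : u ∈ Uloc n) (I : Ideal (MvPowerSeries (Fin n) k)) :
    (Subtype.val '' (initialIdeal u I : Set (gr k u)) : Set (MvPowerSeries (Fin n) k)) =
      (coefRing n k).inSpan (wt u) I := by
  have hφ := isLocalWeight (k := k) hu
  apply Set.Subset.antisymm
  · rintro _ ⟨F, hF, rfl⟩
    induction hF using Submodule.span_induction with
    | mem x hx =>
      obtain ⟨f, hf, hx⟩ := hx
      rw [hx, initialForm_eq]
      exact Submodule.subset_span ⟨f, hf, rfl⟩
    | zero => exact zero_mem _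
    | add x y _ _ hx hy => exact add_mem hx hy
    | smul a x _ hx =>
      have := hφ.grMul_mem ((mem_gr_iff hu).1 a.2) hx
      rwa [grMul_eq_mul hu] at this
  · intro F hF
    induction hF using Submodule.span_induction with
    | mem x hx =>
      obtain ⟨f, hf, rfl⟩ := hx
      obtain ⟨e, he⟩ := hφ.init_isHom f
      exact ⟨⟨_, (mem_gr_iff hu).2 he.finWt⟩,
        Submodule.subset_span ⟨f, hf, (initialForm_eq u f).symm⟩, rfl⟩
    | zero => exact ⟨0, zero_mem _, rfl⟩
    | add x y _ _ hx hy =>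
      obtain ⟨x, hx, rfl⟩ := hx
      obtain ⟨y, hy, rfl⟩ := hy
      exact ⟨x + y, add_mem hx hy, rfl⟩
    | smul r x _ hx =>
      obtain ⟨x, hx, rfl⟩ := hx
      refine ⟨r • x, ?_, rfl⟩
      rw [Algebra.smul_def]
      exact Ideal.mul_mem_left _ _ hx

lemma groebnerCone_eq {u : Fin n → ℝ} (hu : u ∈ Uloc n) {I : Ideal (MvPowerSeries (Fin n) k)}
    {lt : (Fin n →₀ ℕ) → (Fin n →₀ ℕ) → Prop} (hlt : IsLocalOrder lt)
    {G : Finset (MvPowerSeries (Fin n) k)}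
    (hG : IsReducedStandardBasis coef (refine (wt u) lt) (I : Set _) G) :
    groebnerCone I u = {u' | u' ∈ Uloc n ∧ CoefRing.SameZeros (generators n) u u' ∧
      ∀ g ∈ G, (coefRing n k).init (wt u) g = (coefRing n k).init (wt u') g} := by
  ext u'
  refine and_congr_right fun hu' => ?_
  rw [gr_eq_iff hu hu']
  refine and_congr_right fun hs => ?_
  rw [image_initialIdeal hu, image_initialIdeal hu', SetLike.coe_set_eq]
  rw [← ord_eq (k := k)] at hG
  exact (isLocalWeight hu).inSpan_eq_iff (isLocalWeight hu') ((weightSpace n k).sameWeight hu hu' hs)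
    (isBase hlt) (isHomIdeal I) hG

lemma newton_eq (g : MvPowerSeries (Fin n) k) :
    newton g = convexHull ℝ ((coefRing n k).newtonPoints pt (Set.range pt) g) := by
  rw [newton]
  congr 1
  ext x
  constructor
  · rintro ⟨a, b, ha, rfl⟩
    exact ⟨a, _, ⟨b, rfl⟩, ha, rfl⟩
  · rintro ⟨a, _, ⟨b, rfl⟩, ha, rfl⟩
    exact ⟨a, b, ha, rfl⟩

-- The reversed lexicographic order. It supplies an auxiliary order for the claim on the shape of
-- the cone, where none is given.
variable (n) in
lemma exists_isLocalOrder : ∃ lt : (Fin n →₀ ℕ) → (Fin n →₀ ℕ) → Prop, IsLocalOrder lt := by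
  refine ⟨fun a b => toLex b < toLex a,
    { strictTotal :=
        { trichotomous := fun a b h1 h2 => toLex.injective (le_antisymm (not_lt.1 h1) (not_lt.1 h2))
          irrefl := fun a => lt_irrefl _
          trans := fun a b c h1 h2 => h2.trans h1 }
      add_left := fun d a b h => by rw [toLex_add, toLex_add]; exact add_lt_add_right h _
      lt_zero := fun a ha => ?_ }⟩
  exact bot_lt_iff_ne_bot.2 fun h => ha (toLex.injective h)

end Comm

lemma ne_zero_of_reduced {k R M : Type*} [Field k] [Ring R] [Module k R] [AddCommMonoid M] [IsCancelAdd M]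
    {A : CoefRing k R M} {lt : M → M → Prop} {J : Set R} {G : Finset R}
    (hG : IsReducedStandardBasis A.coef lt J G) {g : R} (hg : g ∈ G) : g ≠ 0 := by
  rintro rfl
  obtain ⟨e, -, h1, -⟩ := hG.unitary_reduced 0 hg
  rw [A.coef_zero] at h1
  exact zero_ne_one h1

lemma CoefRing.IsAdm.nonempty_of_reduced {k R M : Type*} [Field k] [Ring R] [Module k R]
    [AddCommMonoid M] [IsCancelAdd M] {A : CoefRing k R M} {lt : M → M → Prop} (hlt : A.IsAdm lt)
    {I : Ideal R} (hI : I ≠ ⊥) {G : Finset R}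
    (hG : IsReducedStandardBasis A.coef lt (I : Set R) G) : G.Nonempty := by
  obtain ⟨f, hf, hf0⟩ := Submodule.exists_mem_ne_zero_of_ne_bot hI
  obtain ⟨e, he⟩ := hlt.exists_lead hf0
  have : e ∈ leadingExps A.coef lt (I : Set R) := ⟨f, hf, he⟩
  rw [hG.standard] at this
  obtain ⟨g, hg, -⟩ := this
  exact ⟨g, hg⟩

/-! ### The two statements for power series. -/

namespace Comm

variable {n : ℕ} {k : Type*} [Field k]

theorem exists_reduced_groebnerCone_eq (I : Ideal (MvPowerSeries (Fin n) k)) {u : Fin n → ℝ}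
    (hu : u ∈ Uloc n) (hI : I ≠ ⊥) {lt : (Fin n →₀ ℕ) → (Fin n →₀ ℕ) → Prop}
    (hlt : IsLocalOrder lt) : ∃ G : Finset (MvPowerSeries (Fin n) k),
      (∀ G', IsReducedStandardBasis coef (refine (wt u) lt) (I : Set _) G' ↔ G' = G) ∧
      groebnerCone I u = normalCone (Uloc n) (∑ g ∈ G, newton g)
        (face u (∑ g ∈ G, newton g)) := by
  have hadm := (isBase (k := k) hlt).ord (isLocalWeight hu)
  obtain ⟨G, hG⟩ := hadm.exists_unique_reduced (isHomIdeal I)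
  have hG' := (hG G).2 rfl
  have hne := hadm.nonempty_of_reduced hI hG'
  rw [ord_eq] at hG
  refine ⟨G, hG, ?_⟩
  rw [groebnerCone_eq hu hlt ((hG G).2 rfl)]
  simp only [newton_eq]
  exact ((weightSpace n k).normalCone_eq hu hne fun g hg => ne_zero_of_reduced hG' hg).symm

/-- The zero ideal is covered as well: its reduced basis is empty, and only the zero pattern of `u`
is then prescribed. -/
theorem isRelOpenRationalCone_groebnerCone (I : Ideal (MvPowerSeries (Fin n) k)) {u : Fin n → ℝ}
    (hu : u ∈ Uloc n) : IsRelOpenRationalCone (groebnerCone I u) := by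
  obtain ⟨lt, hlt⟩ := exists_isLocalOrder n
  have hadm := (isBase (k := k) hlt).ord (isLocalWeight hu)
  obtain ⟨G, hG⟩ := hadm.exists_unique_reduced (isHomIdeal I)
  have hG' := (hG G).2 rfl
  rw [ord_eq] at hG
  rw [groebnerCone_eq hu hlt ((hG G).2 rfl)]
  exact (weightSpace n k).isRelOpenRationalCone hu fun g hg => ne_zero_of_reduced hG' hg

end Comm

/-! ### Matrices of left multiplication by the monomials in ∂ and h. -/

section Operators

variable {n : ℕ} {k : Type*} [Field k]

/-- The coefficient at the exponent `b`. -/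
def symCoef (b : HD.Exps n) : Sym n k →ₗ[k] k :=
  (MvPowerSeries.coeff b.1.1).comp (Finsupp.lapply (b.1.2, b.2))

lemma symCoef_apply (b : HD.Exps n) (Q : Sym n k) :
    symCoef b Q = MvPowerSeries.coeff b.1.1 (Q (b.1.2, b.2)) := rfl

open Classical in
lemma symCoef_single (b : HD.Exps n) (m : (Fin n →₀ ℕ) × ℕ) (c : MvPowerSeries (Fin n) k) :
    symCoef b (Finsupp.single m c) =
      if m = (b.1.2, b.2) then MvPowerSeries.coeff b.1.1 c else 0 := by
  rw [symCoef_apply, Finsupp.single_apply]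
  split_ifs <;> simp

/-- The operator `B` has a row-finite matrix of the same shape as the left multiplication by the
monomial `∂^m.1 h^m.2`. -/
def HasMatrix (B : Module.End k (Sym n k)) (m : (Fin n →₀ ℕ) × ℕ) : Prop :=
  ∃ (K : HD.Exps n → HD.Exps n → k) (S : HD.Exps n → Finset (HD.Exps n)),
    (∀ Q b, symCoef b (B Q) = ∑ x ∈ S b, K x b * symCoef x Q) ∧
    (∀ x b, K x b ≠ 0 → x ∈ S b ∧ ∃ γ : Fin n →₀ ℕ, b.1.1 + γ = x.1.1 ∧ b.1.2 + γ = m.1 + x.1.2 ∧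
      b.2 = m.2 + x.2 + γ.degree) ∧
    ∀ x : HD.Exps n, K x ((x.1.1, m.1 + x.1.2), m.2 + x.2) = 1

lemma hasMatrix_one : HasMatrix (1 : Module.End k (Sym n k)) 0 := by
  classical
  refine ⟨fun x b => if x = b then 1 else 0, fun b => {b}, fun Q b => by simp, fun x b h => ?_,
    fun x => by simp⟩
  have hxb : x = b := by by_contra h'; simp [h'] at h
  subst hxb
  exact ⟨by simp, 0, by simp⟩

/-- The exponent `γ` counts the derivatives that hit the power series: each removes one x and one ∂
and creates one h. These counts add under composition. -/
lemma HasMatrix.mul {B B' : Module.End k (Sym n k)} {m m' : (Fin n →₀ ℕ) × ℕ}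
    (h : HasMatrix B m) (h' : HasMatrix B' m') : HasMatrix (B * B') (m + m') := by
  classical
  obtain ⟨K, S, hf, hK, h1⟩ := h
  obtain ⟨K', S', hf', hK', h1'⟩ := h'
  refine ⟨fun x b => ∑ y ∈ S b, K y b * K' x y, fun b => (S b).biUnion S', ?_, ?_, ?_⟩
  · intro Q b
    simp only [Module.End.mul_apply, hf, hf', Finset.sum_mul]
    rw [Finset.sum_comm]
    refine Finset.sum_congr rfl fun y hy => ?_
    rw [Finset.mul_sum]
    refine Finset.sum_subset_zero_on_sdiff (Finset.subset_biUnion_of_mem S' hy) ?_ ?_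
    · intro x hx
      have : K' x y = 0 := by
        by_contra h0
        exact (Finset.mem_sdiff.1 hx).2 (hK' x y h0).1
      rw [this, mul_zero, zero_mul]
    · intro x _
      ring
  · intro x b hne
    obtain ⟨y, hy, hyne⟩ := Finset.exists_ne_zero_of_sum_ne_zero hne
    obtain ⟨-, γ, e1, e2, e3⟩ := hK y b (left_ne_zero_of_mul hyne)
    obtain ⟨hx, γ', e1', e2', e3'⟩ := hK' x y (right_ne_zero_of_mul hyne)
    refine ⟨Finset.mem_biUnion.2 ⟨y, hy, hx⟩, γ + γ', ?_, ?_, ?_⟩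
    · rw [← add_assoc, e1, e1']
    · rw [← add_assoc, e2, add_assoc, e2', Prod.fst_add, add_assoc]
    · rw [e3, e3', map_add, Prod.snd_add]; ring
  · intro x
    dsimp only
    set y : HD.Exps n := ((x.1.1, m'.1 + x.1.2), m'.2 + x.2) with hy
    have hb : ((x.1.1, (m + m').1 + x.1.2), (m + m').2 + x.2) =
        (((y.1.1, m.1 + y.1.2), m.2 + y.2) : HD.Exps n) := by
      simp [hy, add_assoc]
    -- At the leading exponent the total count `γ + γ'` is zero, so both counts are zero and only
    -- one intermediate exponent contributes.
    rw [hb, Finset.sum_eq_single y, h1, h1', one_mul]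
    · intro z _ hz
      by_contra hne
      obtain ⟨-, γ, e1, e2, e3⟩ := hK z _ (left_ne_zero_of_mul hne)
      obtain ⟨-, γ', e1', e2', e3'⟩ := hK' x z (right_ne_zero_of_mul hne)
      replace e1 : x.1.1 + γ = z.1.1 := e1
      dsimp only [hy] at e2 e3
      have hγ : γ + γ' = 0 := by
        rw [← e1, add_assoc] at e1'
        simpa using e1'
      obtain ⟨rfl, rfl⟩ := add_eq_zero.1 hγ
      apply hz
      simp only [add_zero, map_zero] at e1' e2' e3'
      rw [hy, ← e1', ← e2', ← e3']
    · intro h0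
      exact absurd (hK y _ (by rw [h1]; exact one_ne_zero)).1 h0

lemma hasMatrix_hOp : HasMatrix (hOp : Module.End k (Sym n k)) (0, 1) := by
  classical
  refine ⟨fun x b => if b = (x.1, x.2 + 1) then 1 else 0, fun b => {(b.1, b.2 - 1)}, fun Q b => ?_,
    fun x b h => ?_, fun x => ?_⟩
  · rw [Finset.sum_singleton]
    induction Q using Finsupp.induction_linear with
    | zero => simp
    | add P Q hP hQ => simp only [map_add, hP, hQ, mul_add]
    | single m a =>
      rw [hOp_single, symCoef_single, symCoef_single]
      obtain ⟨⟨α, β⟩, r⟩ := b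
      obtain ⟨μ, q⟩ := m
      rcases r with - | r <;> simp
  · have hb : b = (x.1, x.2 + 1) := by by_contra h'; simp [h'] at h
    subst hb
    exact ⟨by simp, 0, by simp [add_comm]⟩
  · simp [add_comm]

/-- The matrix of ∂_i x^α ∂^β h^m = x^α ∂^{β + e_i} h^m + α_i x^{α - e_i} ∂^β h^{m+1}. The factor
α_i appears as `b.1.1 i + 1` at the target exponent. -/
lemma hasMatrix_dOp (i : Fin n) :
    HasMatrix (dOp i : Module.End k (Sym n k)) (Finsupp.single i 1, 0) := by
  classical
  have hne1 : ∀ α : Fin n →₀ ℕ, α + Finsupp.single i 1 ≠ α := fun α h => by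
    have := DFunLike.congr_fun h i
    simp at this
  refine ⟨fun x b => if b = ((x.1.1, Finsupp.single i 1 + x.1.2), x.2) then 1 else
      if x.1.1 = b.1.1 + Finsupp.single i 1 ∧ b.1.2 = x.1.2 ∧ b.2 = x.2 + 1 then
        ((b.1.1 i : k) + 1) else 0,
    -- The two possible sources of `b`. If a truncated subtraction loses something, the
    -- corresponding matrix entry is zero.
    fun b => {((b.1.1, b.1.2 - Finsupp.single i 1), b.2),
      ((b.1.1 + Finsupp.single i 1, b.1.2), b.2 - 1)}, fun Q b => ?_, fun x b h => ?_, fun x => ?_⟩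
  · rw [Finset.sum_pair (fun h => hne1 b.1.1 (congrArg (fun x : HD.Exps n => x.1.1) h).symm)]
    induction Q using Finsupp.induction_linear with
    | zero => simp
    | add P Q hP hQ =>
      simp only [map_add, hP, hQ, mul_add]
      exact add_add_add_comm _ _ _ _
    | single m a =>
      obtain ⟨⟨α, β⟩, r⟩ := b
      obtain ⟨μ, q⟩ := m
      rw [dOp_single, map_add]
      simp only [symCoef_single, MvPowerSeries.coeff_pderiv]
      congr 1
      · by_cases hβ : β = Finsupp.single i 1 + (β - Finsupp.single i 1)
        · rw [if_pos (show ((α, β), r) = ((α, Finsupp.single i 1 + (β - Finsupp.single i 1)), r) by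
            rw [← hβ]), one_mul]
          refine if_congr ?_ rfl rfl
          simp only [Prod.mk_add_mk, Prod.mk.injEq, add_zero]
          refine and_congr_left fun _ => ⟨?_, fun h => ?_⟩
          · rintro rfl; simp
          · rw [h, add_comm, ← hβ]
        · rw [if_neg (fun h => hβ (congrArg (fun x : HD.Exps n => x.1.2) h)), if_neg, if_neg,
            zero_mul]
          · exact fun h => hne1 α h.1.symm
          · rintro h
            simp only [Prod.mk_add_mk, Prod.mk.injEq] at h
            apply hβ
            rw [← h.1]; simp [add_comm]
      · rw [if_neg (fun h => hne1 α (congrArg (fun x : HD.Exps n => x.1.1) h).symm)]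
        rcases r with - | r
        · simp
        · simp [mul_comm]
  · dsimp only at h
    split_ifs at h with h1 h2
    · subst h1
      exact ⟨by simp, 0, by simp⟩
    · obtain ⟨⟨α, β⟩, r⟩ := b
      obtain ⟨⟨α', β'⟩, r'⟩ := x
      dsimp only at h2
      obtain ⟨rfl, rfl, rfl⟩ := h2
      exact ⟨by simp, Finsupp.single i 1, by simp [add_comm]⟩
    · exact absurd rfl h
  · simp

lemma hasMatrix_monOp (m : (Fin n →₀ ℕ) × ℕ) :
    HasMatrix (monOp m : Module.End k (Sym n k)) m := by
  have hadd : ∀ m₁ m₂ : (Fin n →₀ ℕ) × ℕ, HasMatrix (monOp m₁ : Module.End k (Sym n k)) m₁ →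
      HasMatrix (monOp m₂ : Module.End k (Sym n k)) m₂ →
      HasMatrix (monOp (m₁ + m₂) : Module.End k (Sym n k)) (m₁ + m₂) := fun m₁ m₂ h₁ h₂ => by
    rw [monOp_add]; exact h₁.mul h₂
  have h0 : HasMatrix (monOp 0 : Module.End k (Sym n k)) 0 := by
    rw [monOp_zero]; exact hasMatrix_one
  have hb : ∀ b : Fin n →₀ ℕ, HasMatrix (monOp (b, 0) : Module.End k (Sym n k)) (b, 0) := by
    intro b
    induction b using Finsupp.induction_linear with
    | zero => exact h0
    | add f g hf hg => simpa using hadd _ _ hf hg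
    | single i r =>
      induction r with
      | zero => rw [Finsupp.single_zero]; exact h0
      | succ r ih =>
        have h := hadd _ (Finsupp.single i 1, 0) ih (by rw [monOp_d]; exact hasMatrix_dOp i)
        simpa [Finsupp.single_add] using h
  have hr : ∀ r : ℕ, HasMatrix (monOp ((0 : Fin n →₀ ℕ), r) : Module.End k (Sym n k)) (0, r) := by
    intro r
    induction r with
    | zero => exact h0
    | succ r ih =>
      have h := hadd _ (0, 1) ih (by rw [monOp_h]; exact hasMatrix_hOp)
      simpa using h
  simpa using hadd _ _ (hb m.1) (hr m.2)

end Operators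

/-! ### Structure constants of the ring of differential operators. -/

namespace HD

variable {n : ℕ} {k : Type*} [Field k]

variable (k) in
/-- The matrix of the left multiplication by `∂^m.1 h^m.2`. -/
def monMatrix (m : (Fin n →₀ ℕ) × ℕ) : Exps n → Exps n → k :=
  (hasMatrix_monOp (k := k) m).choose

variable (k) in
/-- Finite sets containing the supports of the rows of `monMatrix`. -/
def monRow (m : (Fin n →₀ ℕ) × ℕ) : Exps n → Finset (Exps n) :=
  (hasMatrix_monOp (k := k) m).choose_spec.choose

lemma symCoef_monOp (m : (Fin n →₀ ℕ) × ℕ) (Q : Sym n k) (b : Exps n) :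
    symCoef b (monOp m Q) = ∑ x ∈ monRow k m b, monMatrix k m x b * symCoef x Q :=
  (hasMatrix_monOp (k := k) m).choose_spec.choose_spec.1 Q b

lemma monMatrix_ne_zero {m : (Fin n →₀ ℕ) × ℕ} {x b : Exps n} (h : monMatrix k m x b ≠ 0) :
    x ∈ monRow k m b ∧ ∃ γ : Fin n →₀ ℕ, b.1.1 + γ = x.1.1 ∧ b.1.2 + γ = m.1 + x.1.2 ∧
      b.2 = m.2 + x.2 + γ.degree :=
  (hasMatrix_monOp (k := k) m).choose_spec.choose_spec.2.1 x b h

lemma monMatrix_lead (m : (Fin n →₀ ℕ) × ℕ) (x : Exps n) :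
    monMatrix k m x ((x.1.1, m.1 + x.1.2), m.2 + x.2) = 1 :=
  (hasMatrix_monOp (k := k) m).choose_spec.choose_spec.2.2 x

variable (k) in
open Classical in
/-- The coefficient at `b` of the product of the monomials with exponents `a` and `x`. -/
def structConst (a x b : Exps n) : k :=
  if a.1.1 ≤ b.1.1 then monMatrix k (a.1.2, a.2) x ((b.1.1 - a.1.1, b.1.2), b.2) else 0

/-- The shape of Leibniz' rule: besides the sum of the exponents, a product only contains exponents
lowered by `(γ, γ)`, with h raised by |γ|. The conditions u_i + v_i ≥ 0 and 1 ≺ x_i ξ_i are what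
makes these terms not exceed the leading one. -/
lemma structConst_ne_zero {a x b : Exps n} (h : structConst k a x b ≠ 0) :
    a.1.1 ≤ b.1.1 ∧ ∃ γ : Fin n →₀ ℕ, b.1.1 + γ = a.1.1 + x.1.1 ∧ b.1.2 + γ = a.1.2 + x.1.2 ∧
      b.2 = a.2 + x.2 + γ.degree := by
  rw [structConst] at h
  split_ifs at h with hle
  · obtain ⟨-, γ, e1, e2, e3⟩ := monMatrix_ne_zero h
    refine ⟨hle, γ, ?_, e2, e3⟩
    dsimp only at e1
    rw [← e1, ← add_assoc, add_tsub_cancel_of_le hle]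
  · exact absurd rfl h

lemma structConst_add (a b : Exps n) : structConst k a b (a + b) = 1 := by
  rw [structConst, if_pos (by simp)]
  convert monMatrix_lead (k := k) (a.1.2, a.2) b using 2
  simp

lemma degree_add (a b : Exps n) : degree (a + b) = degree a + degree b := by
  simp only [degree, Prod.fst_add, Prod.snd_add, map_add]
  ring

lemma degree_structConst {a x b : Exps n} (h : structConst k a x b ≠ 0) :
    degree b = degree a + degree x := by
  obtain ⟨-, γ, -, e2, e3⟩ := structConst_ne_zero h
  have := congrArg Finsupp.degree e2
  rw [map_add, map_add] at this
  simp only [degree, e3]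
  omega

lemma apply_le_degree (β : Fin n →₀ ℕ) (i : Fin n) : β i ≤ β.degree := by
  rw [Finsupp.degree_eq_sum]
  exact Finset.single_le_sum (fun _ _ => Nat.zero_le _) (Finset.mem_univ i)

variable (k) in
lemma finite_structConst (b : Exps n) :
    {p : Exps n × Exps n | structConst k p.1 p.2 b ≠ 0}.Finite := by
  -- The degrees of the factors add up to that of `b`, which bounds their exponents of ∂ and h and
  -- also `γ`. The exponents of x are then bounded by that of `b` plus `γ`.
  set c : Fin n →₀ ℕ := Finsupp.equivFunOnFinite.symm fun _ => degree b with hc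
  set B : Exps n := ((b.1.1 + c, c), degree b) with hB
  refine (Set.finite_Icc (0 : Exps n × Exps n) (B, B)).subset ?_
  rintro ⟨a, x⟩ h
  obtain ⟨hle, γ, e1, e2, e3⟩ := structConst_ne_zero h
  have hd := degree_structConst h
  dsimp only at hle e1 e2 e3 hd
  have hβ : ∀ y : Exps n, degree y ≤ degree b → y.1.2 ≤ c := fun y hy i => by
    have := apply_le_degree y.1.2 i
    simp only [degree, hc, Finsupp.equivFunOnFinite_symm_apply_apply] at hy ⊢
    omega
  have hγ : γ ≤ c := fun i => by
    have h1 := apply_le_degree a.1.2 i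
    have h2 := apply_le_degree x.1.2 i
    have h3 := DFunLike.congr_fun e2 i
    simp only [degree, hc, Finsupp.equivFunOnFinite_symm_apply_apply, Finsupp.add_apply] at hd h3 ⊢
    omega
  have hxα : x.1.1 ≤ b.1.1 + γ := by rw [e1]; exact le_add_self
  refine ⟨bot_le, ⟨⟨⟨hle.trans le_self_add, hβ a (by omega)⟩, ?_⟩,
    ⟨⟨hxα.trans (add_le_add_right hγ _), hβ x (by omega)⟩, ?_⟩⟩⟩
  · change a.2 ≤ degree b
    simp only [degree] at *
    omega
  · change x.2 ≤ degree b
    simp only [degree] at *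
    omega

lemma coef_mul (P Q : HD n k) (b : Exps n) :
    coef (P * Q) b = ∑ p ∈ (finite_structConst k b).toFinset,
      structConst k p.1 p.2 b * (coef P p.1 * coef Q p.2) := by
  classical
  change symCoef b (leftMul (family n k P) (family n k Q)) =
    ∑ p ∈ (finite_structConst k b).toFinset, structConst k p.1 p.2 b *
      (symCoef p.1 (family n k P) * symCoef p.2 (family n k Q))
  generalize family n k P = P
  generalize family n k Q = Q
  induction P using Finsupp.induction_linear with
  | zero => simp
  | add P P' hP hP' =>
    simp only [map_add, LinearMap.add_apply, hP, hP', add_mul, mul_add, Finset.sum_add_distrib]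
  | single m c =>
    have hl : symCoef b (leftMul (Finsupp.single m c) Q) =
        ∑ y ∈ (Finset.HasAntidiagonal.antidiagonal b.1.1).sigma
          (fun ij => monRow k m ((ij.2, b.1.2), b.2)), MvPowerSeries.coeff y.1.1 c *
            (monMatrix k m y.2 ((y.1.2, b.1.2), b.2) * symCoef y.2 Q) := by
      rw [leftMul_single, Module.End.mul_apply, Finset.sum_sigma, symCoef_apply]
      have : (serOp c (monOp m Q)) (b.1.2, b.2) = c * (monOp m Q) (b.1.2, b.2) := rfl
      rw [this, MvPowerSeries.coeff_mul]
      refine Finset.sum_congr rfl fun ij _ => ?_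
      dsimp only
      rw [← Finset.mul_sum, ← symCoef_monOp]
      rfl
    rw [hl]
    -- A splitting of the x-exponent of `b` between `c` and the remaining product corresponds to the
    -- choice of the x-exponent of the left factor.
    refine Finset.sum_bij_ne_zero (fun y _ _ => (((y.1.1, m.1), m.2), y.2)) ?_ ?_ ?_ ?_
    · rintro ⟨⟨i, j⟩, x⟩ hy hne
      rw [Set.Finite.mem_toFinset]
      have hij := Finset.HasAntidiagonal.mem_antidiagonal.1 (Finset.mem_sigma.1 hy).1
      dsimp only at hij hne ⊢
      change structConst k ((i, m.1), m.2) x b ≠ 0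
      rw [structConst, if_pos (by rw [← hij]; exact le_self_add)]
      dsimp only
      rw [← hij, add_tsub_cancel_left]
      exact left_ne_zero_of_mul (right_ne_zero_of_mul hne)
    · rintro ⟨⟨i, j⟩, x⟩ hy _ ⟨⟨i', j'⟩, x'⟩ hy' _ heq
      have hij := Finset.HasAntidiagonal.mem_antidiagonal.1 (Finset.mem_sigma.1 hy).1
      have hij' := Finset.HasAntidiagonal.mem_antidiagonal.1 (Finset.mem_sigma.1 hy').1
      simp only [Prod.mk.injEq, and_true] at heq hij hij'
      obtain ⟨rfl, rfl⟩ := heq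
      rw [← hij'] at hij
      rw [add_left_cancel hij]
    · rintro ⟨a, x⟩ hp hne
      have h1 : symCoef a (Finsupp.single m c) ≠ 0 :=
        left_ne_zero_of_mul (right_ne_zero_of_mul hne)
      rw [symCoef_single] at h1
      have hm : m = (a.1.2, a.2) := by by_contra h'; simp [h'] at h1
      subst hm
      rw [if_pos rfl] at h1
      have h2 : structConst k a x b ≠ 0 := left_ne_zero_of_mul hne
      obtain ⟨hle, -⟩ := structConst_ne_zero h2
      rw [structConst, if_pos hle] at h2
      refine ⟨⟨(a.1.1, b.1.1 - a.1.1), x⟩, Finset.mem_sigma.2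
        ⟨Finset.HasAntidiagonal.mem_antidiagonal.2 (add_tsub_cancel_of_le hle),
          (monMatrix_ne_zero h2).1⟩, ?_, rfl⟩
      exact mul_ne_zero h1 (mul_ne_zero h2 (right_ne_zero_of_mul (right_ne_zero_of_mul hne)))
    · rintro ⟨⟨i, j⟩, x⟩ hy hne
      have hij := Finset.HasAntidiagonal.mem_antidiagonal.1 (Finset.mem_sigma.1 hy).1
      dsimp only at hij ⊢
      rw [symCoef_single, if_pos rfl, structConst, if_pos (by rw [← hij]; exact le_self_add)]
      dsimp only
      have : b.1.1 - i = j := by rw [← hij, add_tsub_cancel_left]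
      rw [this]
      ring

variable (n k) in
/-- The homogenized differential operators, as a ring of combinations of exponents. -/
def coefRing : CoefRing k (HD n k) (Exps n) where
  coef := coef
  deg := degree
  K := structConst k
  S b := (finite_structConst k b).toFinset
  coef_add f g a := map_add (symCoef a) (family n k f) (family n k g)
  coef_smul r f a := map_smul (symCoef a) r (family n k f)
  smul_mul r f g := congrArg (fun B : Module.End k (Sym n k) => B (family n k g))
    (map_smul leftMul r (family n k f))
  ext f g h := (family n k).injective <| Finsupp.ext fun m => MvPowerSeries.ext fun a =>
    h ((a, m.1), m.2)
  bound f := by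
    refine ⟨(family n k f).support.sup fun m => m.1.degree + m.2, fun a ha => ?_⟩
    have hm : (a.1.2, a.2) ∈ (family n k f).support := by
      rw [Finsupp.mem_support_iff]
      intro h
      apply ha
      rw [coef, h, map_zero]
    exact Finset.le_sup (f := fun m : (Fin n →₀ ℕ) × ℕ => m.1.degree + m.2) hm
  exists_coef c hc := by
    classical
    obtain ⟨D, hD⟩ := hc
    have hfin : {m : (Fin n →₀ ℕ) × ℕ | m.1.degree + m.2 ≤ D}.Finite := by
      refine (Set.finite_Icc (0 : (Fin n →₀ ℕ) × ℕ)
        (Finsupp.equivFunOnFinite.symm fun _ => D, D)).subset ?_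
      rintro ⟨β, r⟩ h
      have h' : β.degree + r ≤ D := h
      refine ⟨bot_le, fun i => ?_, ?_⟩
      · have := apply_le_degree β i
        simp only [Finsupp.equivFunOnFinite_symm_apply_apply]
        omega
      · change r ≤ D
        omega
    refine ⟨(family n k).symm (Finsupp.onFinset hfin.toFinset
      (fun m => (fun α => c ((α, m.1), m.2) : MvPowerSeries (Fin n) k)) fun m hm => ?_),
      fun a => rfl⟩
    rw [Set.Finite.mem_toFinset]
    by_contra hlt
    apply hm
    funext α
    by_contra hne
    exact hlt (hD _ hne)
  coef_mul := coef_mul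
  mem_S a x b h := (Set.Finite.mem_toFinset _).2 h
  K_add := structConst_add
  deg_add := degree_add
  deg_K _ _ _ h := degree_structConst h
  pos a b h := (add_eq_zero.1 h).2
  wqo s := by
    obtain ⟨i, j, hij, h⟩ := wellQuasiOrdered_le s
    exact ⟨i, j, hij, s j - s i, (add_tsub_cancel_of_le h).symm⟩

end HD

/-! ### Left ideals generated by homogeneous elements. -/

namespace CoefRing

variable {k R M : Type*} [Field k] [Ring R] [Module k R] [AddCommMonoid M] [IsCancelAdd M]
  {A : CoefRing k R M}

lemma degPart_mul (D : ℕ) (f g : R) : A.degPart D (f * g) =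
    ∑ ij ∈ Finset.HasAntidiagonal.antidiagonal D, A.degPart ij.1 f * A.degPart ij.2 g := by
  classical
  refine A.ext _ _ fun b => ?_
  have hsum : ∀ (p : Prop) [Decidable p] (F : M × M → k),
      (if p then ∑ x ∈ A.S b, F x else 0) = ∑ x ∈ A.S b, if p then F x else 0 := by
    intro p _ F
    split_ifs <;> simp
  simp only [A.coef_sum, A.coef_mul, degPart, coef_terms, hsum]
  rw [Finset.sum_comm]
  refine Finset.sum_congr rfl fun p _ => ?_
  by_cases hK : A.K p.1 p.2 b = 0
  · simp [hK]
  rw [A.deg_K _ _ _ hK]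
  by_cases hD : A.deg p.1 + A.deg p.2 = D
  · rw [if_pos hD, Finset.sum_eq_single (A.deg p.1, A.deg p.2)]
    · simp
    · rintro ⟨i, j⟩ - hne
      by_cases hi : A.deg p.1 = i
      · by_cases hj : A.deg p.2 = j
        · exact absurd (by rw [hi, hj]) hne
        · simp [hj]
      · simp [hi]
    · exact fun h => absurd (Finset.HasAntidiagonal.mem_antidiagonal.2 hD) h
  · rw [if_neg hD, Finset.sum_eq_zero]
    rintro ⟨i, j⟩ hij
    rw [Finset.HasAntidiagonal.mem_antidiagonal] at hij
    by_cases hi : A.deg p.1 = i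
    · by_cases hj : A.deg p.2 = j
      · exact absurd (by rw [hi, hj]; exact hij) hD
      · simp [hj]
    · simp [hi]

/-- A left ideal generated by homogeneous elements contains the homogeneous parts of its elements. -/
lemma isHomIdeal_span {S : Set R} (hS : ∀ f ∈ S, ∃ e, ∀ a, A.coef f a ≠ 0 → A.deg a = e) :
    A.IsHomIdeal (Ideal.span S) := by
  intro f hf
  induction hf using Submodule.span_induction with
  | mem x hx =>
    intro D
    obtain ⟨e, he⟩ := hS x hx
    by_cases hD : e = D
    · have : A.degPart D x = x := by
        refine A.ext _ _ fun a => ?_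
        by_cases ha : A.coef x a = 0
        · rw [ha]
          by_contra h
          exact (A.coef_terms_ne.1 h).2 ha
        · exact A.coef_terms_of (p := fun a => A.deg a = D) ((he a ha).trans hD) x
      rw [this]
      exact Submodule.subset_span hx
    · have : A.degPart D x = 0 := A.eq_zero fun a => by
        by_contra h
        obtain ⟨h1, h2⟩ := A.coef_terms_ne.1 h
        exact hD ((he a h2).symm.trans h1)
      rw [this]
      exact zero_mem _
  | zero => intro D; rw [degPart, A.terms_zero]; exact zero_mem _
  | add x y _ _ hx hy =>
    intro D
    rw [degPart, A.terms_add]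
    exact add_mem (hx D) (hy D)
  | smul a x _ hx =>
    intro D
    rw [smul_eq_mul, degPart_mul]
    exact sum_mem fun ij _ => Ideal.mul_mem_left _ _ (hx ij.2)

end CoefRing

/-! ### Gröbner cones of homogeneous left ideals of differential operators. -/

namespace HD

variable {n : ℕ} {k : Type*} [Field k]

lemma coefRing_K {a x b : Exps n} (h : (coefRing n k).K a x b ≠ 0) :
    ∃ γ : Fin n →₀ ℕ, b.1 + (γ, γ) = (a + x).1 := by
  obtain ⟨-, γ, e1, e2, -⟩ := structConst_ne_zero h
  exact ⟨γ, Prod.ext e1 e2⟩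

lemma eq_of_degree_eq {a b : Exps n} (hd : degree a = degree b) (h : a.1 = b.1) : a = b := by
  refine Prod.ext h ?_
  simp only [degree, h] at hd
  omega

lemma IsAdmissibleOrder.lt_zero
    {lt : (Fin n →₀ ℕ) × (Fin n →₀ ℕ) → (Fin n →₀ ℕ) × (Fin n →₀ ℕ) → Prop}
    (h : IsAdmissibleOrder lt) (α : Fin n →₀ ℕ) : α = 0 ∨ lt (α, 0) 0 := by
  have hadd : ∀ α β : Fin n →₀ ℕ, lt (α, 0) 0 → lt (β, 0) 0 → lt (α + β, 0) 0 := by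
    intro α β hα hβ
    have := h.add_left (α, 0) _ _ hβ
    rw [add_zero, Prod.mk_add_mk, add_zero] at this
    exact h.strictTotal.trans _ _ _ this hα
  induction α using Finsupp.induction_linear with
  | zero => exact Or.inl rfl
  | add α β hα hβ =>
    rcases hα with rfl | hα
    · rwa [zero_add]
    · rcases hβ with rfl | hβ
      · rw [add_zero]; exact Or.inr hα
      · exact Or.inr (hadd α β hα hβ)
  | single i r =>
    induction r with
    | zero => exact Or.inl (Finsupp.single_zero i)
    | succ r ih =>
      right
      rw [Finsupp.single_add]
      rcases ih with h0 | ih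
      · rw [h0, zero_add]; exact h.x_lt_one i
      · exact hadd _ _ ih (h.x_lt_one i)

lemma IsAdmissibleOrder.zero_lt
    {lt : (Fin n →₀ ℕ) × (Fin n →₀ ℕ) → (Fin n →₀ ℕ) × (Fin n →₀ ℕ) → Prop}
    (h : IsAdmissibleOrder lt) (γ : Fin n →₀ ℕ) : γ = 0 ∨ lt 0 (γ, γ) := by
  have hadd : ∀ α β : Fin n →₀ ℕ, lt 0 (α, α) → lt 0 (β, β) → lt 0 (α + β, α + β) := by
    intro α β hα hβ
    have := h.add_left (α, α) _ _ hβ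
    rw [add_zero, Prod.mk_add_mk] at this
    exact h.strictTotal.trans _ _ _ hα this
  induction γ using Finsupp.induction_linear with
  | zero => exact Or.inl rfl
  | add α β hα hβ =>
    rcases hα with rfl | hα
    · rwa [zero_add]
    · rcases hβ with rfl | hβ
      · rw [add_zero]; exact Or.inr hα
      · exact Or.inr (hadd α β hα hβ)
  | single i r =>
    induction r with
    | zero => exact Or.inl (Finsupp.single_zero i)
    | succ r ih =>
      right
      rw [Finsupp.single_add]
      rcases ih with h0 | ih
      · rw [h0, zero_add]; exact h.one_lt_x_xi i
      · exact hadd _ _ ih (h.one_lt_x_xi i)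

/-- Within one degree the exponent of h is determined by the rest, so the order on `(α, β)` is total
there. An exponent of degree zero is a pure power of x, where `x_lt_one` applies, and `one_lt_x_xi`
handles the lower terms of products. -/
lemma isBase {lt : (Fin n →₀ ℕ) × (Fin n →₀ ℕ) → (Fin n →₀ ℕ) × (Fin n →₀ ℕ) → Prop}
    (h : IsAdmissibleOrder lt) : (coefRing n k).IsBase fun a b => lt a.1 b.1 where
  irrefl a := h.strictTotal.irrefl a.1
  trans a b c := h.strictTotal.trans a.1 b.1 c.1
  tri a b hd := by
    by_cases hab : lt a.1 b.1
    · exact Or.inl hab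
    · by_cases hba : lt b.1 a.1
      · exact Or.inr (Or.inr hba)
      · exact Or.inr (Or.inl (eq_of_degree_eq hd (h.strictTotal.trichotomous _ _ hab hba)))
  add d a b := h.add_left d.1 a.1 b.1
  K a x b hK := by
    obtain ⟨γ, hγ⟩ := coefRing_K hK
    rcases h.zero_lt γ with rfl | hlt
    · left
      refine eq_of_degree_eq ((degree_structConst hK).trans (degree_add a x).symm) ?_
      rw [← hγ]
      exact (add_zero b.1).symm
    · right
      rw [← hγ]
      simpa using h.add_left b.1 _ _ hlt
  neg d hd h0 := by
    have hd' : d.1.2.degree + d.2 = 0 := hd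
    have hβ : d.1.2 = 0 := (Finsupp.degree_eq_zero_iff _).1 (by omega)
    have hd1 : d.1 = (d.1.1, 0) := Prod.ext rfl hβ
    rcases h.lt_zero d.1.1 with h1 | h1
    · refine absurd (Prod.ext (Prod.ext h1 hβ) ?_) h0
      change d.2 = 0
      omega
    · rw [hd1]; exact h1

/-- The generators of the cone dual to the local weights. -/
def generators (n : ℕ) : Fin n ⊕ Fin n → Fin n ⊕ Fin n → ℤ
  | Sum.inl i => Pi.single (Sum.inl i) 1
  | Sum.inr i => -Pi.single (Sum.inl i) 1 - Pi.single (Sum.inr i) 1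

lemma generators_inl_eq (i : Fin n) : (fun j => (generators n (Sum.inl i) j : ℝ)) =
    Pi.single (Sum.inl i) 1 := by
  ext j
  simp only [generators, Pi.single_apply]
  split_ifs <;> simp

lemma generators_inr_eq (i : Fin n) : (fun j => (generators n (Sum.inr i) j : ℝ)) =
    -Pi.single (Sum.inl i) 1 - Pi.single (Sum.inr i) 1 := by
  ext j
  simp only [generators, Pi.sub_apply, Pi.neg_apply, Pi.single_apply]
  push_cast
  split_ifs <;> simp

lemma dotProduct_inl (w : Fin n ⊕ Fin n → ℝ) (i : Fin n) :
    w ⬝ᵥ (fun j => (generators n (Sum.inl i) j : ℝ)) = w (Sum.inl i) := by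
  rw [generators_inl_eq, dotProduct_single, mul_one]

lemma dotProduct_inr (w : Fin n ⊕ Fin n → ℝ) (i : Fin n) :
    w ⬝ᵥ (fun j => (generators n (Sum.inr i) j : ℝ)) = -(w (Sum.inl i) + w (Sum.inr i)) := by
  rw [generators_inr_eq, dotProduct_sub, dotProduct_neg, dotProduct_single, dotProduct_single]
  ring

lemma mem_Wloc_iff (w : Fin n ⊕ Fin n → ℝ) :
    w ∈ Wloc n ↔ ∀ j, w ⬝ᵥ (fun i => (generators n j i : ℝ)) ≤ 0 := by
  rw [Sum.forall]
  simp only [dotProduct_inl, dotProduct_inr]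
  exact ⟨fun h => ⟨fun i => (h i).1, fun i => neg_nonpos.2 (h i).2⟩,
    fun h i => ⟨h.1 i, neg_nonpos.1 (h.2 i)⟩⟩

/-- The integral vectors of the cone dual to the local weights. -/
def dualPoints (n : ℕ) : Set (Fin n ⊕ Fin n → ℝ) :=
  {z | ∃ c : Fin n ⊕ Fin n → ℤ, (∀ w ∈ Wloc n, w ⬝ᵥ (fun i => (c i : ℝ)) ≤ 0) ∧
    z = fun i => (c i : ℝ)}

lemma pt_add (a b : (Fin n →₀ ℕ) × (Fin n →₀ ℕ)) : pt (a + b) = pt a + pt b := by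
  ext (i | i) <;> simp [pt]

variable (n k) in
lemma weightSpace : (coefRing n k).WeightSpace (fun a => pt a.1) (dualPoints n) (Wloc n)
    (generators n) where
  pt_add a b := pt_add a.1 b.1
  pt_int := ⟨fun a => Sum.elim (fun i => (a.1.1 i : ℤ)) fun i => (a.1.2 i : ℤ), fun a => by
    ext (i | i) <;> simp [pt]⟩
  zero_mem := ⟨0, fun w _ => by simp [dotProduct], by ext; simp⟩
  pt_mem d hd := by
    have hd' : d.1.2.degree + d.2 = 0 := hd
    have hβ : d.1.2 = 0 := (Finsupp.degree_eq_zero_iff _).1 (by omega)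
    have hpt : pt d.1 = fun i => ((Sum.elim (fun i => (d.1.1 i : ℤ)) (fun _ => 0) i : ℤ) : ℝ) := by
      ext (i | i) <;> simp [pt, hβ]
    refine ⟨_, fun w hw => ?_, hpt⟩
    simp only [dotProduct, Fintype.sum_sum_type, Sum.elim_inl, Sum.elim_inr, Int.cast_zero,
      mul_zero, Finset.sum_const_zero, add_zero, Int.cast_natCast]
    exact Finset.sum_nonpos fun i _ => mul_nonpos_of_nonpos_of_nonneg (hw i).1 (Nat.cast_nonneg _)
  pt_K a x b h := by
    obtain ⟨γ, hγ⟩ := coefRing_K h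
    refine ⟨_, ⟨fun i => -Sum.elim (fun i => (γ i : ℤ)) (fun i => (γ i : ℤ)) i, fun w hw => ?_, rfl⟩,
      ?_⟩
    · simp only [dotProduct, Fintype.sum_sum_type, Sum.elim_inl, Sum.elim_inr, Int.cast_neg,
        Int.cast_natCast]
      rw [← Finset.sum_add_distrib]
      refine Finset.sum_nonpos fun i _ => ?_
      have := mul_nonneg (hw i).2 (Nat.cast_nonneg (α := ℝ) (γ i))
      linarith
    · rw [← pt_add]
      change pt b.1 = pt (a + x).1 + _
      rw [← hγ, pt_add]
      ext (i | i) <;> simp [pt]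
  mem_W := mem_Wloc_iff
  γ_mem j := ⟨generators n j, fun w hw => (mem_Wloc_iff w).1 hw j, rfl⟩
  N_eq := by
    rintro _ ⟨c, hc, rfl⟩
    -- The vector is tested on the extreme rays of the cone of local weights: (u, v) = (0, e_i),
    -- then (-e_i, e_i). The two inequalities are the nonnegativity of the coefficients on the
    -- generators.
    have h1 : ∀ i, c (Sum.inr i) ≤ 0 := fun i => by
      have := hc (Pi.single (Sum.inr i) 1) fun j => by
        by_cases h : j = i
        · subst h; simp
        · simp [h]
      rw [single_dotProduct, one_mul] at this
      exact_mod_cast this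
    have h2 : ∀ i, c (Sum.inr i) ≤ c (Sum.inl i) := fun i => by
      have := hc (Pi.single (Sum.inr i) 1 - Pi.single (Sum.inl i) 1) fun j => by
        by_cases h : j = i
        · subst h; simp
        · simp [h]
      rw [sub_dotProduct, single_dotProduct, single_dotProduct, one_mul, one_mul,
        sub_nonpos] at this
      exact_mod_cast this
    refine ⟨Sum.elim (fun i => ((c (Sum.inl i) - c (Sum.inr i) : ℤ) : ℝ))
      fun i => ((-c (Sum.inr i) : ℤ) : ℝ), ?_, ?_⟩
    · rintro (i | i)
      · rw [Sum.elim_inl]; exact_mod_cast sub_nonneg.2 (h2 i)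
      · rw [Sum.elim_inr]; exact_mod_cast neg_nonneg.2 (h1 i)
    · ext (i | i) <;>
        simp [Fintype.sum_sum_type, Finset.sum_apply, generators, Pi.single_apply]

lemma isLocalWeight {w : Fin n ⊕ Fin n → ℝ} (hw : w ∈ Wloc n) :
    (coefRing n k).IsLocalWeight fun a => wt w a.1 :=
  (weightSpace n k).isLocalWeight hw

lemma terms_eq (p : Exps n → Prop) (P : HD n k) : terms p P = (coefRing n k).terms p P := by
  classical
  refine (coefRing n k).ext _ _ fun a => ?_
  rw [CoefRing.coef_terms]
  refine (coef_terms p P a).trans ?_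
  congr

lemma initialForm_eq (w : Fin n ⊕ Fin n → ℝ) (P : HD n k) :
    initialForm w P = (coefRing n k).init (fun a => wt w a.1) P := terms_eq _ P

lemma component_eq (w : Fin n ⊕ Fin n → ℝ) (e : ℝ) (P : HD n k) :
    component w e P = (coefRing n k).comp (fun a => wt w a.1) e P := terms_eq _ P

lemma mem_gr_iff {w : Fin n ⊕ Fin n → ℝ} {P : HD n k} :
    P ∈ gr k w ↔ (coefRing n k).FinWt (fun a => wt w a.1) P := by
  constructor
  · intro hP
    induction hP using Submodule.span_induction with
    | mem x hx =>
      obtain ⟨e, he⟩ := hx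
      rw [component_eq] at he
      rw [← he]
      exact (CoefRing.comp_isHom _ e x).finWt
    | zero => exact ⟨∅, fun a ha => absurd ((coefRing n k).coef_zero a) ha⟩
    | add x y _ _ hx hy => exact hx.add hy
    | smul r x _ hx => exact hx.smul r
  · rintro ⟨s, hs⟩
    rw [← CoefRing.sum_comp hs]
    refine sum_mem fun e _ => Submodule.subset_span ⟨e, ?_⟩
    rw [component_eq]
    exact CoefRing.comp_eq_self (CoefRing.comp_isHom _ e P)

/-- Both products are bilinear and agree on homogeneous components, of which `P` and `Q` have
finitely many. -/
lemma grMul_eq {w : Fin n ⊕ Fin n → ℝ} (hw : w ∈ Wloc n) {P Q : HD n k} (hP : P ∈ gr k w)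
    (hQ : Q ∈ gr k w) : grMul w P Q = (coefRing n k).grMul (fun a => wt w a.1) P Q := by
  set φ : Exps n → ℝ := fun a => wt w a.1 with hφ
  obtain ⟨s, hs⟩ := mem_gr_iff.1 hP
  obtain ⟨t, ht⟩ := mem_gr_iff.1 hQ
  have hterm : ∀ e : ℝ × ℝ, component w (e.1 + e.2) (component w e.1 P * component w e.2 Q) =
      (coefRing n k).grMul φ ((coefRing n k).comp φ e.1 P) ((coefRing n k).comp φ e.2 Q) := by
    intro e
    rw [component_eq, component_eq, component_eq, (isLocalWeight hw).comp_mul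
      (CoefRing.comp_isHom φ e.1 P).wtLE (CoefRing.comp_isHom φ e.2 Q).wtLE,
      CoefRing.comp_eq_self (CoefRing.comp_isHom φ e.1 P),
      CoefRing.comp_eq_self (CoefRing.comp_isHom φ e.2 Q)]
  have hzero : ∀ (u : Finset ℝ) (X : HD n k), (∀ a, (coefRing n k).coef X a ≠ 0 → φ a ∈ u) →
      ∀ e, (coefRing n k).comp φ e X ≠ 0 → e ∈ u := by
    intro u X hu e he
    obtain ⟨a, ha⟩ := (coefRing n k).exists_coef_ne_zero he
    obtain ⟨h1, h2⟩ := (coefRing n k).coef_terms_ne.1 ha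
    exact h1 ▸ hu a h2
  rw [grMul, finsum_eq_sum_of_support_subset (s := s ×ˢ t)]
  · simp only [hterm]
    rw [Finset.sum_product]
    simp only [← CoefRing.grMul_sum_right, ← CoefRing.grMul_sum_left]
    rw [CoefRing.sum_comp hs, CoefRing.sum_comp ht]
  · intro e he
    rw [Function.mem_support, hterm] at he
    refine Finset.mem_coe.2 (Finset.mem_product.2 ⟨hzero s P hs _ fun h => he ?_,
      hzero t Q ht _ fun h => he ?_⟩)
    · rw [h, CoefRing.grMul_zero_left]
    · rw [h, CoefRing.grMul_zero_right]

lemma coef_single (m : (Fin n →₀ ℕ) × ℕ) (c : MvPowerSeries (Fin n) k) (b : Exps n) :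
    coef ((family n k).symm (Finsupp.single m c)) b =
      open Classical in if m = (b.1.2, b.2) then MvPowerSeries.coeff b.1.1 c else 0 :=
  symCoef_single b m c

lemma coef_d_ne_zero {i : Fin n} {a : Exps n} (h : coef (d i : HD n k) a ≠ 0) :
    a = ((0, Finsupp.single i 1), 0) := by
  classical
  rw [d, coef_single] at h
  split_ifs at h with h1
  · simp only [Prod.mk.injEq] at h1
    rw [MvPowerSeries.coeff_one] at h
    split_ifs at h with h2
    · exact Prod.ext (Prod.ext h2 h1.1.symm) h1.2.symm
    · exact absurd rfl h
  · exact absurd rfl h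

lemma coef_ser_X_ne_zero {i : Fin n} {a : Exps n}
    (h : coef (ser (MvPowerSeries.X i) : HD n k) a ≠ 0) : a = ((Finsupp.single i 1, 0), 0) := by
  classical
  rw [ser, coef_single] at h
  split_ifs at h with h1
  · simp only [Prod.ext_iff, Prod.fst_zero, Prod.snd_zero] at h1
    rw [MvPowerSeries.coeff_X] at h
    split_ifs at h with h2
    · exact Prod.ext (Prod.ext h2 h1.1.symm) h1.2.symm
    · exact absurd rfl h
  · exact absurd rfl h

lemma coef_d_mul_ser_X (i : Fin n) :
    coef (d i * ser (MvPowerSeries.X i) : HD n k) ((0, 0), 1) = 1 := by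
  classical
  have h1 := sub_eq_iff_eq_add.1 (d_mul_ser (k := k) i (MvPowerSeries.X i))
  rw [MvPowerSeries.pderiv_X_self, h, d, ser_mul_monomial, ser_mul_monomial] at h1
  rw [d, h1]
  refine ((coefRing n k).coef_add _ _ _).trans ?_
  change coef _ _ + coef _ _ = 1
  rw [coef_single, coef_single, if_pos rfl, if_neg (by simp)]
  simp

/-- In ∂_i x_i = x_i ∂_i + h the term h has weight 0, while the class of the product has weight u_i
+ v_i. So h survives in the graded ring exactly when this sum vanishes. -/
lemma coef_grMul_d_ser_X {w : Fin n ⊕ Fin n → ℝ} (hw : w ∈ Wloc n) (i : Fin n) :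
    coef (grMul w (d i) (ser (MvPowerSeries.X i)) : HD n k) ((0, 0), 1) =
      open Classical in if w (Sum.inl i) + w (Sum.inr i) = 0 then 1 else 0 := by
  classical
  have hd : (coefRing n k).IsHom (fun a => wt w a.1) (d i : HD n k) (w (Sum.inr i)) := by
    intro a ha
    rw [coef_d_ne_zero ha]
    simp [wt, pt, dotProduct, Fintype.sum_sum_type, Finsupp.single_apply]
  have hx : (coefRing n k).IsHom (fun a => wt w a.1) (ser (MvPowerSeries.X i) : HD n k)
      (w (Sum.inl i)) := by
    intro a ha
    rw [coef_ser_X_ne_zero ha]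
    simp [wt, pt, dotProduct, Fintype.sum_sum_type, Finsupp.single_apply]
  have h1 := (isLocalWeight (k := k) hw).comp_mul hd.wtLE hx.wtLE
  rw [CoefRing.comp_eq_self hd, CoefRing.comp_eq_self hx] at h1
  rw [grMul_eq hw (mem_gr_iff.2 hd.finWt) (mem_gr_iff.2 hx.finWt), ← h1]
  refine ((coefRing n k).coef_terms _ _ _).trans ?_
  have h0 : wt w ((0, 0) : (Fin n →₀ ℕ) × (Fin n →₀ ℕ)) = 0 := by
    simp [wt, pt, dotProduct]
  simp only [h0]
  rw [add_comm (w (Sum.inr i)), if_congr eq_comm rfl rfl]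
  congr 1
  exact coef_d_mul_ser_X i

/-- The underlying set detects the zeros of u_i, through geometric series as for power series, and
the product detects the zeros of u_i + v_i, through ∂_i x_i. -/
lemma sameGr_iff {w w' : Fin n ⊕ Fin n → ℝ} (hw : w ∈ Wloc n) (hw' : w' ∈ Wloc n) :
    SameGr k w w' ↔ CoefRing.SameZeros (generators n) w w' := by
  classical
  have hwt : ∀ (w : Fin n ⊕ Fin n → ℝ) (i : Fin n),
      wt w ((Finsupp.single i 1, 0) : (Fin n →₀ ℕ) × (Fin n →₀ ℕ)) = w (Sum.inl i) := by
    intro w i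
    simp [wt, pt, dotProduct, Fintype.sum_sum_type, Finsupp.single_apply]
  constructor
  · rintro ⟨hgr, hmul⟩
    have key : ∀ w ∈ Wloc n, ∀ w' ∈ Wloc n, gr k w = gr k w' → ∀ i, w (Sum.inl i) = 0 →
        w' (Sum.inl i) = 0 := by
      intro w hw w' hw' h i hi
      by_contra hi'
      obtain ⟨f, hf, hf'⟩ := CoefRing.exists_isHom_not_finWt (isLocalWeight (k := k) hw)
        (isLocalWeight hw') (d := ((Finsupp.single i 1, 0), 0))
        (by simp [coefRing, degree]) (by rw [hwt, hi]) (by rwa [hwt])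
      exact hf' (mem_gr_iff.1 (h ▸ mem_gr_iff.2 hf.finWt))
    rintro (i | i)
    · rw [dotProduct_inl, dotProduct_inl]
      exact ⟨key w hw w' hw' hgr i, key w' hw' w hw hgr.symm i⟩
    · rw [dotProduct_inr, dotProduct_inr, neg_eq_zero, neg_eq_zero]
      have hd : (d i : HD n k) ∈ gr k w := mem_gr_iff.2
        ⟨{wt w (0, Finsupp.single i 1)}, fun a ha => by
          rw [coef_d_ne_zero ha]; exact Finset.mem_singleton_self _⟩
      have hx : (ser (MvPowerSeries.X i) : HD n k) ∈ gr k w := mem_gr_iff.2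
        ⟨{wt w (Finsupp.single i 1, 0)}, fun a ha => by
          rw [coef_ser_X_ne_zero ha]; exact Finset.mem_singleton_self _⟩
      have h1 := coef_grMul_d_ser_X (k := k) hw i
      rw [hmul _ hd _ hx, coef_grMul_d_ser_X hw' i] at h1
      by_cases e1 : w (Sum.inl i) + w (Sum.inr i) = 0
      · by_cases e2 : w' (Sum.inl i) + w' (Sum.inr i) = 0
        · exact iff_of_true e1 e2
        · simp [e1, e2] at h1
      · by_cases e2 : w' (Sum.inl i) + w' (Sum.inr i) = 0
        · simp [e1, e2] at h1
        · exact iff_of_false e1 e2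
  · intro h
    have key : ∀ w ∈ Wloc n, ∀ w' ∈ Wloc n, CoefRing.SameZeros (generators n) w w' →
        gr k w ≤ gr k w' := by
      intro w hw w' hw' h
      refine Submodule.span_le.2 ?_
      rintro f ⟨e, he⟩
      rw [component_eq] at he
      refine mem_gr_iff.2 (((weightSpace n k).sameWeight hw hw' h).finWt
        (isLocalWeight hw) (isLocalWeight hw') (e := e) ?_)
      rw [← he]
      exact CoefRing.comp_isHom _ e f
    have hgr : gr k w = gr k w' := (key w hw w' hw' h).antisymm (key w' hw' w hw h.symm)
    refine ⟨hgr, fun P hP Q hQ => ?_⟩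
    rw [grMul_eq hw hP hQ, grMul_eq hw' (hgr ▸ hP) (hgr ▸ hQ)]
    exact ((weightSpace n k).sameWeight hw hw' h).grMul_eq P Q

/-- The span of the initial forms is itself stable under the graded product, so it is the smallest
admissible subspace. -/
lemma initialIdeal_eq {w : Fin n ⊕ Fin n → ℝ} (hw : w ∈ Wloc n) (I : Ideal (HD n k)) :
    initialIdeal w I = (coefRing n k).inSpan (fun a => wt w a.1) I := by
  have hφ := isLocalWeight (k := k) hw
  apply le_antisymm
  · refine sInf_le ⟨fun P hP => ?_, fun A hA B hB => ?_⟩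
    · rw [initialForm_eq]
      exact Submodule.subset_span ⟨P, hP, rfl⟩
    · have hle : (coefRing n k).inSpan (fun a => wt w a.1) I ≤ gr k w := by
        refine Submodule.span_le.2 ?_
        rintro _ ⟨f, -, rfl⟩
        obtain ⟨e, he⟩ := hφ.init_isHom f
        exact mem_gr_iff.2 he.finWt
      rw [grMul_eq hw hA (hle hB)]
      exact hφ.grMul_mem (mem_gr_iff.1 hA) hB
  · refine le_sInf fun J hJ => Submodule.span_le.2 ?_
    rintro _ ⟨f, hf, rfl⟩
    rw [← initialForm_eq]
    exact hJ.1 f hf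

lemma isHomIdeal {I : Ideal (HD n k)} (hI : IsHomogeneousIdeal I) :
    (coefRing n k).IsHomIdeal I := by
  obtain ⟨S, hS, rfl⟩ := hI
  exact CoefRing.isHomIdeal_span hS

lemma groebnerCone_eq {w : Fin n ⊕ Fin n → ℝ} (hw : w ∈ Wloc n) {I : Ideal (HD n k)}
    (hI : IsHomogeneousIdeal I)
    {lt : (Fin n →₀ ℕ) × (Fin n →₀ ℕ) → (Fin n →₀ ℕ) × (Fin n →₀ ℕ) → Prop}
    (hlt : IsAdmissibleOrder lt) {G : Finset (HD n k)}
    (hG : IsReducedStandardBasis coef (ltH (refine (wt w) lt)) (I : Set _) G) :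
    groebnerCone I w = {w' | w' ∈ Wloc n ∧ CoefRing.SameZeros (generators n) w w' ∧
      ∀ g ∈ G, (coefRing n k).init (fun a => wt w a.1) g =
        (coefRing n k).init (fun a => wt w' a.1) g} := by
  ext w'
  refine and_congr_right fun hw' => ?_
  rw [sameGr_iff hw hw']
  refine and_congr_right fun hs => ?_
  rw [initialIdeal_eq hw, initialIdeal_eq hw']
  exact (isLocalWeight hw).inSpan_eq_iff (isLocalWeight hw') ((weightSpace n k).sameWeight hw hw' hs)
    (isBase hlt) (isHomIdeal hI) hG

lemma newton_eq (g : HD n k) :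
    newton g = convexHull ℝ ((coefRing n k).newtonPoints (fun a => pt a.1) (dualPoints n) g) := by
  rw [newton]
  congr 1
  ext x
  constructor
  · rintro ⟨a, z, ha, hz, rfl⟩
    exact ⟨a, _, ⟨z, hz, rfl⟩, ha, rfl⟩
  · rintro ⟨a, _, ⟨z, hz, rfl⟩, ha, rfl⟩
    exact ⟨a, z, ha, hz, rfl⟩

/-- The weight `2|β| - |α|` of an exponent, followed by the exponent. -/
def admissibleKey (a : (Fin n →₀ ℕ) × (Fin n →₀ ℕ)) : ℤ ×ₗ (Lex (Fin n →₀ ℕ) ×ₗ Lex (Fin n →₀ ℕ)) :=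
  toLex (2 * (a.2.degree : ℤ) - a.1.degree, toLex (toLex a.1, toLex a.2))

-- With weight -1 on x_i and 2 on ξ_i, the product x_i ξ_i has weight 1, so both conditions of
-- admissibility are decided by the weight; ties are broken lexicographically.
variable (n) in
lemma exists_isAdmissibleOrder :
    ∃ lt : (Fin n →₀ ℕ) × (Fin n →₀ ℕ) → (Fin n →₀ ℕ) × (Fin n →₀ ℕ) → Prop,
      IsAdmissibleOrder lt := by
  have hadd : ∀ a b : (Fin n →₀ ℕ) × (Fin n →₀ ℕ),
      admissibleKey (a + b) = admissibleKey a + admissibleKey b := by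
    intro a b
    refine Prod.ext ?_ rfl
    change 2 * ((a.2 + b.2).degree : ℤ) - (a.1 + b.1).degree =
      (2 * (a.2.degree : ℤ) - a.1.degree) + (2 * (b.2.degree : ℤ) - b.1.degree)
    rw [map_add, map_add]
    push_cast
    ring
  have hinj : Function.Injective (admissibleKey (n := n)) := fun a b h =>
    congrArg (fun x : ℤ ×ₗ (Lex (Fin n →₀ ℕ) ×ₗ Lex (Fin n →₀ ℕ)) =>
      ((ofLex (ofLex (ofLex x).2).1, ofLex (ofLex (ofLex x).2).2) :
        (Fin n →₀ ℕ) × (Fin n →₀ ℕ))) h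
  refine ⟨fun a b => admissibleKey a < admissibleKey b,
    { strictTotal :=
        { trichotomous := fun a b h1 h2 => hinj (le_antisymm (not_lt.1 h2) (not_lt.1 h1))
          irrefl := fun a => lt_irrefl _
          trans := fun a b c h1 h2 => h1.trans h2 }
      add_left := fun d a b h => by rw [hadd, hadd]; exact add_lt_add_right h _
      x_lt_one := fun i => Prod.Lex.toLex_lt_toLex.2 (Or.inl ?_)
      one_lt_x_xi := fun i => Prod.Lex.toLex_lt_toLex.2 (Or.inl ?_) }⟩
  · simp
  · simp

theorem exists_reduced_groebnerCone_eq {I : Ideal (HD n k)} (hI : IsHomogeneousIdeal I)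
    {w : Fin n ⊕ Fin n → ℝ} (hw : w ∈ Wloc n) (hI0 : I ≠ ⊥)
    {lt : (Fin n →₀ ℕ) × (Fin n →₀ ℕ) → (Fin n →₀ ℕ) × (Fin n →₀ ℕ) → Prop}
    (hlt : IsAdmissibleOrder lt) : ∃ G : Finset (HD n k),
      (∀ G', IsReducedStandardBasis coef (ltH (refine (wt w) lt)) (I : Set _) G' ↔ G' = G) ∧
      groebnerCone I w = normalCone (Wloc n) (∑ g ∈ G, newton g)
        (face w (∑ g ∈ G, newton g)) := by
  have hadm := (isBase (k := k) hlt).ord (isLocalWeight hw)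
  obtain ⟨G, hG⟩ := hadm.exists_unique_reduced (isHomIdeal hI)
  have hG' := (hG G).2 rfl
  refine ⟨G, hG, ?_⟩
  rw [groebnerCone_eq hw hI hlt hG']
  simp only [newton_eq]
  exact ((weightSpace n k).normalCone_eq hw (hadm.nonempty_of_reduced hI0 hG')
    fun g hg => ne_zero_of_reduced hG' hg).symm

theorem isRelOpenRationalCone_groebnerCone {I : Ideal (HD n k)} (hI : IsHomogeneousIdeal I)
    {w : Fin n ⊕ Fin n → ℝ} (hw : w ∈ Wloc n) : IsRelOpenRationalCone (groebnerCone I w) := by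
  obtain ⟨lt, hlt⟩ := exists_isAdmissibleOrder n
  have hadm := (isBase (k := k) hlt).ord (isLocalWeight hw)
  obtain ⟨G, hG⟩ := hadm.exists_reduced (isHomIdeal hI)
  rw [groebnerCone_eq hw hI hlt hG]
  exact (weightSpace n k).isRelOpenRationalCone hw fun g hg => ne_zero_of_reduced hG hg

end HD

end LocalGroebner

end

theorem mainTheorem3 {n : ℕ} {k : Type*} [Field k] :
    (∀ (I : Ideal (MvPowerSeries (Fin n) k)) (u : Fin n → ℝ), u ∈ LocalGroebner.Comm.Uloc n →
      (I ≠ ⊥ → ∀ lt, LocalGroebner.Comm.IsLocalOrder lt →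
        ∃ G : Finset (MvPowerSeries (Fin n) k),
          (∀ G', LocalGroebner.IsReducedStandardBasis LocalGroebner.Comm.coef
            (LocalGroebner.refine (LocalGroebner.Comm.wt u) lt) (I : Set _) G' ↔ G' = G) ∧
          LocalGroebner.Comm.groebnerCone I u =
            LocalGroebner.normalCone (LocalGroebner.Comm.Uloc n)
              (∑ g ∈ G, LocalGroebner.Comm.newton g)
              (LocalGroebner.face u (∑ g ∈ G, LocalGroebner.Comm.newton g))) ∧
      LocalGroebner.IsRelOpenRationalCone (LocalGroebner.Comm.groebnerCone I u)) ∧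
    (∀ (I : Ideal (LocalGroebner.HD n k)), LocalGroebner.HD.IsHomogeneousIdeal I →
      ∀ w : Fin n ⊕ Fin n → ℝ, w ∈ LocalGroebner.HD.Wloc n →
      (I ≠ ⊥ → ∀ lt, LocalGroebner.HD.IsAdmissibleOrder lt →
        ∃ G : Finset (LocalGroebner.HD n k),
          (∀ G', LocalGroebner.IsReducedStandardBasis LocalGroebner.HD.coef
            (LocalGroebner.HD.ltH (LocalGroebner.refine (LocalGroebner.HD.wt w) lt))
            (I : Set _) G' ↔ G' = G) ∧
          LocalGroebner.HD.groebnerCone I w =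
            LocalGroebner.normalCone (LocalGroebner.HD.Wloc n)
              (∑ g ∈ G, LocalGroebner.HD.newton g)
              (LocalGroebner.face w (∑ g ∈ G, LocalGroebner.HD.newton g))) ∧
      LocalGroebner.IsRelOpenRationalCone (LocalGroebner.HD.groebnerCone I w)) :=
  ⟨fun I _ hu => ⟨fun hI _ hlt => LocalGroebner.Comm.exists_reduced_groebnerCone_eq I hu hI hlt,
      LocalGroebner.Comm.isRelOpenRationalCone_groebnerCone I hu⟩,
    fun _ hI _ hw => ⟨fun hI0 _ hlt => LocalGroebner.HD.exists_reduced_groebnerCone_eq hI hw hI0 hlt,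
      LocalGroebner.HD.isRelOpenRationalCone_groebnerCone hI hw⟩⟩
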